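/- Let $p$ be a prime, let $n, m, e \ge 0$ be integers with $n > m(e+1)+1$, and let $S \to R$ be a surjective ring homomorphism whose kernel $\mathfrak a$ carries divided powers, such that $p$ is nilpotent in $S$ and $p^m\mathfrak a = 0$. *Notation.* $\mathcal W_n(S)$ is the image of $(\mathrm{Res},F)\colon W_{n+1}(S)\to W_n(S)\times W_n(S)$; $\mathcal J_{n+1}\subset W_{n+1}(S)$ is the kernel of $W_{n+1}(S)\to R$, $\kappa\colon\mathcal J_{n+1}\to\mathcal W_n(S)$ is the natural map, and $\dot\sigma\colon\mathcal J_{n+1}\to W_n(S)$ extends $V^{-1}\colon VW_n(S)\to W_n(S)$ by $0$ on the Witt vectors over $\mathfrak a$ with logarithmic coordinates $[a,0,\dots,0]$. A relative truncated display of level $n$ for $S\to R$ consists of $(P,Q,\iota,\epsilon,F,\dot F)$, where $P,Q$ are $\mathcal W_n(S)$-modules with $P$ finitely generated projective, $\iota\colon Q\to P$ and $\epsilon\colon\mathcal J_{n+1}\otimes P\to Q$ are linear, $F\colon P\to W_n(S)\otimes_{\mathrm{Res},\mathcal W_n(S)}P$ and $\dot F\colon Q\to W_n(S)\otimes_{\mathrm{Res},\mathcal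 W_n(S)}P$ are Frobenius-linear, such that $\iota\circ\epsilon$ and $\epsilon\circ(\mathrm{id}\otimes\iota)$ are multiplication via $\kappa$; the cokernels of $\iota$ and $\epsilon$ are finitely generated projective $R$-modules; $\dot F(\epsilon(\tau\otimes x))=\dot\sigma(\tau)F(x)$; $\dot F(Q)$ generates $W_n(S)\otimes P$; and $Q/\mathrm{im}\,\epsilon\to P/\kappa(\mathcal J_{n+1})P$ is injective. A truncated display of level $n$ over $R$ is a relative one for $\mathrm{id}\colon R\to R$; its Hodge filtration is the surjection $R\otimes_{\mathcal W_n(R)}P=P/\kappa(VW_n(R))P\to P/\iota(Q)$. When $pR=0$, it is nilpotent of order $\le e$ if $(\bar V^e)^\sharp=0$ on $\iota(Q)/I_nP$, where $I_n=\kappa(VW_n(R))$ and $\bar V^\sharp\colon\iota(Q)/I_nP\to R\otimes_{\mathrm{Frob},R}\iota(Q)/I_nP$ is induced by $\dot F(y)\mapsto 1\otimes\iota(y)$; in general the condition is imposed on the base change to $R/pR$. A lift of a truncated display over $R$ is a (relative) truncated display over $S$ (for $S\to R$) together with an identification of its base change to $R$ with the given one; morphisms of lifts induce the identity over $R$. *Statement.*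 Let $\bar{\mathcal P}=(\bar P,\bar Q,\dots)$ be a truncated display of level $n$ over $R$, nilpotent of order $\le e$. Then: 1. $\bar{\mathcal P}$ has a lift $\tilde{\mathcal P}=(\tilde P,\tilde Q,\dots)$ to a relative truncated display for $S\to R$. Between any two such lifts there is a morphism of lifts; every such morphism induces an isomorphism on $S\otimes_{\mathcal W_n(S)}\tilde P$, which does not depend on the morphism. So $\mathbb D_{\bar{\mathcal P}}(S):=S\otimes_{\mathcal W_n(S)}\tilde P$ is well defined up to unique isomorphism. 2. For each lift $\mathcal P=(P,Q,\dots)$ of $\bar{\mathcal P}$ to a truncated display of level $n$ over $S$, there are morphisms of lifts from its associated relative truncated display to $\tilde{\mathcal P}$, and they all induce one and the same isomorphism $S\otimes_{\mathcal W_n(S)}P\cong\mathbb D_{\bar{\mathcal P}}(S)$. 3. Transporting the Hodge filtration $S\otimes_{\mathcal W_n(S)}P\to P/\iota(Q)$ along this isomorphism defines a bijection from the set of isomorphism classes of lifts of $\bar{\mathcal P}$ to truncated displays of level $n$ over $S$ to the set of lifts of the Hodge filtration of $\bar{\mathcal P}$ to $\mathbb D_{\bar{\mathcal P}}(S)$,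 that is, of commutative diagrams (up to isomorphism) $$\begin{array}{ccc}\mathbb D_{\bar{\mathcal P}}(S)&\to&\breve T\\ \downarrow&&\downarrow\\ R\otimes_{\mathcal W_n(R)}\bar P&\to&\bar P/\iota(\bar Q)\end{array}$$ in which $\breve T$ is a finitely generated projective $S$-module and the right vertical arrow induces an isomorphism $R\otimes_S\breve T\cong\bar P/\iota(\bar Q)$. -/

import Mathlib

open scoped TensorProduct
open CategoryTheory

universe u

noncomputable section

namespace Disp

section WittRings

variable (p : ℕ) [Fact p.Prime] (n : ℕ)

/-- The ring of truncated Witt vectors `W_n(R)`. -/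
abbrev W (R : Type u) [CommRing R] : Type u := TruncatedWittVector p n R

/-- A ring homomorphism out of `W(R)` which kills the kernel of `W(R) → W_n(R)` factors
through `W_n(R)`. -/
def W.desc {R : Type u} [CommRing R] {A : Type u} [CommRing A] (g : WittVector p R →+* A)
    (h : RingHom.ker (WittVector.truncate (p := p) (R := R) n) ≤ RingHom.ker g) :
    W p n R →+* A :=
  RingHom.liftOfSurjective (WittVector.truncate (p := p) (R := R) n)
    (WittVector.truncate_surjective p n R) ⟨g, h⟩

theorem W.desc_truncate {R : Type u} [CommRing R] {A : Type u} [CommRing A]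
    (g : WittVector p R →+* A)
    (h : RingHom.ker (WittVector.truncate (p := p) (R := R) n) ≤ RingHom.ker g)
    (x : WittVector p R) : W.desc p n g h (WittVector.truncate n x) = g x :=
  RingHom.liftOfRightInverse_comp_apply _ _ _ ⟨g, h⟩ x

theorem ker_truncate_le_frobenius (R : Type u) [CommRing R] :
    RingHom.ker (WittVector.truncate (p := p) (R := R) (n + 1)) ≤
      RingHom.ker ((WittVector.truncate (p := p) (R := R) n).comp WittVector.frobenius) := by
  intro x hx
  rw [WittVector.mem_ker_truncate] at hx
  rw [RingHom.mem_ker, RingHom.comp_apply, ← RingHom.mem_ker]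
  have hx' : x = (WittVector.verschiebung)^[n + 1] (x.shift (n + 1)) :=
    WittVector.eq_iterate_verschiebung (fun i hi => hx i hi)
  rw [hx', Function.iterate_succ_apply', WittVector.frobenius_verschiebung]
  refine Ideal.mul_mem_right _ _ ?_
  rw [WittVector.mem_ker_truncate]
  intro i hi
  exact WittVector.iterate_verschiebung_coeff_eq_zero _ hi

/-- The Frobenius `F : W_{n+1}(R) → W_n(R)`. -/
def W.frob (R : Type u) [CommRing R] : W p (n + 1) R →+* W p n R :=
  W.desc p (n + 1) ((WittVector.truncate n).comp WittVector.frobenius)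
    (ker_truncate_le_frobenius p n R)

/-- The restriction `Res : W_{n+1}(R) → W_n(R)`. -/
def W.res (R : Type u) [CommRing R] : W p (n + 1) R →+* W p n R :=
  TruncatedWittVector.truncate (Nat.le_succ n)

/-- Functoriality of `W_n`; on coordinates it is the given homomorphism. -/
def W.map {R S : Type u} [CommRing R] [CommRing S] (φ : R →+* S) : W p n R →+* W p n S :=
  W.desc p n ((WittVector.truncate n).comp (WittVector.map φ)) (by
    intro x hx
    rw [WittVector.mem_ker_truncate] at hx
    rw [RingHom.mem_ker, RingHom.comp_apply, ← RingHom.mem_ker, WittVector.mem_ker_truncate]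
    intro i hi
    rw [WittVector.map_coeff, hx i hi, map_zero])

/-- The first Witt component `𝐰₀ : W_n(R) → R`, for `n ≥ 1`. -/
def W.zeroth [NeZero n] (R : Type u) [CommRing R] : W p n R →+* R :=
  W.desc p n WittVector.constantCoeff (by
    intro x hx
    rw [WittVector.mem_ker_truncate] at hx
    rw [RingHom.mem_ker]
    exact hx 0 (Nat.pos_of_ne_zero (NeZero.ne n)))

theorem W.zeroth_truncate [NeZero n] (R : Type u) [CommRing R] (x : WittVector p R) :
    W.zeroth p n R (WittVector.truncate n x) = x.coeff 0 :=
  W.desc_truncate p n WittVector.constantCoeff _ x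

theorem W.zeroth_apply [NeZero n] (R : Type u) [CommRing R] (x : W p n R) :
    W.zeroth p n R x = x.coeff ⟨0, Nat.pos_of_ne_zero (NeZero.ne n)⟩ := by
  obtain ⟨y, rfl⟩ := WittVector.truncate_surjective p n R x
  rw [W.zeroth_truncate, WittVector.coeff_truncate]

theorem W.frob_truncate (R : Type u) [CommRing R] (x : WittVector p R) :
    W.frob p n R (WittVector.truncate (n + 1) x) =
      WittVector.truncate n (WittVector.frobenius x) :=
  W.desc_truncate p (n + 1) ((WittVector.truncate n).comp WittVector.frobenius) _ x

theorem W.map_truncate {R S : Type u} [CommRing R] [CommRing S] (φ : R →+* S)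
    (x : WittVector p R) :
    W.map p n φ (WittVector.truncate n x) = WittVector.truncate n (WittVector.map φ x) :=
  W.desc_truncate p n ((WittVector.truncate n).comp (WittVector.map φ)) _ x

theorem W.map_frob {R S : Type u} [CommRing R] [CommRing S] (φ : R →+* S)
    (x : W p (n + 1) R) :
    W.map p n φ (W.frob p n R x) = W.frob p n S (W.map p (n + 1) φ x) := by
  obtain ⟨y, rfl⟩ := WittVector.truncate_surjective p (n + 1) R x
  rw [W.frob_truncate, W.map_truncate, W.map_truncate, W.frob_truncate,
    WittVector.IsPoly.map (WittVector.frobenius_isPoly p) φ y]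

theorem W.map_res {R S : Type u} [CommRing R] [CommRing S] (φ : R →+* S)
    (x : W p (n + 1) R) :
    W.map p n φ (W.res p n R x) = W.res p n S (W.map p (n + 1) φ x) := by
  obtain ⟨y, rfl⟩ := WittVector.truncate_surjective p (n + 1) R x
  rw [W.res, W.res, TruncatedWittVector.truncate_wittVector_truncate, W.map_truncate,
    W.map_truncate, TruncatedWittVector.truncate_wittVector_truncate]

theorem W.map_zeroth [NeZero n] {R S : Type u} [CommRing R] [CommRing S] (φ : R →+* S)
    (x : W p n R) : φ (W.zeroth p n R x) = W.zeroth p n S (W.map p n φ x) := by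
  obtain ⟨y, rfl⟩ := WittVector.truncate_surjective p n R x
  rw [W.zeroth_truncate, W.map_truncate, W.zeroth_truncate, WittVector.map_coeff]

/-- The ring `𝒲_n(R)`: the image of `(Res, F) : W_{n+1}(R) → W_n(R) × W_n(R)`. -/
def CalW (R : Type u) [CommRing R] : Type u :=
  ((W.res p n R).prod (W.frob p n R)).range

instance (R : Type u) [CommRing R] : CommRing (CalW p n R) :=
  inferInstanceAs (CommRing ((W.res p n R).prod (W.frob p n R)).range)

/-- The surjection `W_{n+1}(R) → 𝒲_n(R)`. -/
def CalW.of (R : Type u) [CommRing R] : W p (n + 1) R →+* CalW p n R :=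
  ((W.res p n R).prod (W.frob p n R)).rangeRestrict

/-- The projection `Res : 𝒲_n(R) → W_n(R)`. -/
def CalW.res (R : Type u) [CommRing R] : CalW p n R →+* W p n R :=
  (RingHom.fst _ _).comp ((W.res p n R).prod (W.frob p n R)).range.subtype

/-- The projection `F : 𝒲_n(R) → W_n(R)`. -/
def CalW.frob (R : Type u) [CommRing R] : CalW p n R →+* W p n R :=
  (RingHom.snd _ _).comp ((W.res p n R).prod (W.frob p n R)).range.subtype

/-- Functoriality of `𝒲_n`. -/
def CalW.map {R S : Type u} [CommRing R] [CommRing S] (φ : R →+* S) :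
    CalW p n R →+* CalW p n S :=
  RingHom.restrict (RingHom.prodMap (W.map p n φ) (W.map p n φ))
    ((W.res p n R).prod (W.frob p n R)).range ((W.res p n S).prod (W.frob p n S)).range (by
      rintro _ ⟨x, rfl⟩
      refine ⟨W.map p (n + 1) φ x, ?_⟩
      exact Prod.ext (W.map_res p n φ x).symm (W.map_frob p n φ x).symm)

theorem CalW.res_map {R S : Type u} [CommRing R] [CommRing S] (φ : R →+* S)
    (x : CalW p n R) : CalW.res p n S (CalW.map p n φ x) = W.map p n φ (CalW.res p n R x) :=
  rfl

/-- `W_n(R)` is regarded as a `𝒲_n(R)`-algebra via `Res`. -/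
instance (R : Type u) [CommRing R] : Algebra (CalW p n R) (W p n R) :=
  (CalW.res p n R).toAlgebra

/-- `R` is regarded as a `𝒲_n(R)`-algebra via `𝐰₀ ∘ Res`. -/
instance [NeZero n] (R : Type u) [CommRing R] : Algebra (CalW p n R) R :=
  ((W.zeroth p n R).comp (CalW.res p n R)).toAlgebra

theorem CalW.map_algebraMap_W {R S : Type u} [CommRing R] [CommRing S] (φ : R →+* S)
    (x : CalW p n R) :
    W.map p n φ (algebraMap (CalW p n R) (W p n R) x) =
      algebraMap (CalW p n S) (W p n S) (CalW.map p n φ x) :=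
  rfl

theorem CalW.map_algebraMap [NeZero n] {R S : Type u} [CommRing R] [CommRing S] (φ : R →+* S)
    (x : CalW p n R) :
    φ (algebraMap (CalW p n R) R x) = algebraMap (CalW p n S) S (CalW.map p n φ x) :=
  W.map_zeroth p n φ (CalW.res p n R x)

end WittRings

section Thickening

variable (p : ℕ) [Fact p.Prime] (n : ℕ) {S : Type u} [CommRing S] (𝔞 : Ideal S)

/-- The ideal `𝒥_{n+1} = W_{n+1}(𝔞) + I_{n+1}(S)` of `W_{n+1}(S)`. Since
`I_{n+1}(S) = V W_n(S)` is the kernel of `𝐰₀`, this is the kernel of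
`W_{n+1}(S) → S → S/𝔞`. For `𝔞 = 0` it is `I_{n+1}(S)`. -/
def J : Ideal (W p (n + 1) S) :=
  RingHom.ker ((Ideal.Quotient.mk 𝔞).comp (W.zeroth p (n + 1) S))

theorem mem_J (x : W p (n + 1) S) : x ∈ J p n 𝔞 ↔ W.zeroth p (n + 1) S x ∈ 𝔞 := by
  rw [J, RingHom.mem_ker, RingHom.comp_apply, Ideal.Quotient.eq_zero_iff_mem]

/-- Functoriality of `𝒥_{n+1}`. -/
def J.map {S' : Type u} [CommRing S'] {𝔞 : Ideal S} {𝔞' : Ideal S'} (φ : S →+* S')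
    (h : 𝔞 ≤ 𝔞'.comap φ) (x : J p n 𝔞) : J p n 𝔞' :=
  ⟨W.map p (n + 1) φ x, by
    have hx := (mem_J p n 𝔞 x.1).1 x.2
    rw [mem_J, ← W.map_zeroth]
    exact h hx⟩

variable {𝔞}

/-- For `x ∈ 𝔞` the Witt vector with logarithmic coordinates `[x, 0, 0, …]`. The `i`-th
logarithmic coordinate of a Witt vector `(t₀, t₁, …)` with entries in `𝔞` is its `i`-th
divided Witt polynomial
`∑_{k ≤ i} t_k ^ (p ^ (i - k)) / p ^ (i - k) = ∑_{k ≤ i} (p ^ (i - k) - 1)! γ_{p ^ (i - k)}(t_k)`;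
the recursion says that these vanish for `i ≥ 1`. -/
def logVec (γ : DividedPowers 𝔞) (x : S) : ℕ → S
  | 0 => x
  | i + 1 => -∑ k : Fin (i + 1),
      (Nat.factorial (p ^ (i + 1 - (k : ℕ)) - 1) : S) *
        γ.dpow (p ^ (i + 1 - (k : ℕ))) (logVec γ x k)
decreasing_by exact k.2

/-- The map `σ̇ : 𝒥_{n+1} → W_n(S)` which extends `V⁻¹` on `I_{n+1}(S)` and vanishes on the
Witt vectors with logarithmic coordinates `[x, 0, …, 0]`: the difference of `ξ ∈ 𝒥_{n+1}` and
the vector with logarithmic coordinates `[ξ₀, 0, …, 0]` has first entry `0`, and `V⁻¹` is the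
shift. For `𝔞 = 0` this is `V⁻¹`. -/
def sigmaDot (γ : DividedPowers 𝔞) (ξ : J p n 𝔞) : W p n S :=
  TruncatedWittVector.mk p fun i : Fin n =>
    ((ξ : W p (n + 1) S) - WittVector.truncate (n + 1)
      (WittVector.mk p (logVec p γ (W.zeroth p (n + 1) S ξ)))).coeff i.succ

end Thickening

section TensorMap

variable {A A' B B' P P' : Type u} [CommRing A] [CommRing A'] [CommRing B] [CommRing B']
  [Algebra A B] [Algebra A' B'] [AddCommGroup P] [Module A P] [AddCommGroup P'] [Module A' P']
  {ψ : A →+* A'} (χ : B →+* B') (h : ∀ x, χ (algebraMap A B x) = algebraMap A' B' (ψ x))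
  (f : P →ₛₗ[ψ] P')

/-- The additive map underlying `tensorMap`. -/
def tensorMapAux : (B ⊗[A] P) →+ (B' ⊗[A'] P') :=
  TensorProduct.liftAddHom
    (AddMonoidHom.mk' (fun b => AddMonoidHom.mk' (fun x => χ b ⊗ₜ[A'] f x)
        (fun x y => by rw [map_add, TensorProduct.tmul_add]))
      (fun b c => AddMonoidHom.ext fun x =>
        (congrArg (fun t => t ⊗ₜ[A'] f x) (map_add χ b c)).trans
          (TensorProduct.add_tmul _ _ _)))
    (fun r b x => by
      have h1 : χ (r • b) = ψ r • χ b := by rw [Algebra.smul_def, map_mul, h, Algebra.smul_def]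
      have h2 : f (r • x) = ψ r • f x := f.map_smulₛₗ r x
      change χ (r • b) ⊗ₜ[A'] f x = χ b ⊗ₜ[A'] f (r • x)
      rw [h1, h2, TensorProduct.smul_tmul])

theorem tensorMapAux_tmul (b : B) (x : P) :
    tensorMapAux χ h f (b ⊗ₜ[A] x) = χ b ⊗ₜ[A'] f x :=
  rfl

/-- For a homomorphism `χ : B → B'` of algebras over `ψ : A → A'` and a `ψ`-linear map
`f : P → P'`, the `χ`-linear map `B ⊗_A P → B' ⊗_{A'} P'`, `b ⊗ x ↦ χ(b) ⊗ f(x)`. -/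
def tensorMap : (B ⊗[A] P) →ₛₗ[χ] (B' ⊗[A'] P') where
  toFun := tensorMapAux χ h f
  map_add' := map_add _
  map_smul' b z := by
    induction z with
    | zero => rw [smul_zero, map_zero, smul_zero]
    | add x y hx hy => rw [smul_add, map_add, hx, hy, map_add, smul_add]
    | tmul c x =>
      rw [TensorProduct.smul_tmul', tensorMapAux_tmul, tensorMapAux_tmul, smul_eq_mul, map_mul,
        TensorProduct.smul_tmul', smul_eq_mul]

theorem tensorMap_tmul (b : B) (x : P) : tensorMap χ h f (b ⊗ₜ[A] x) = χ b ⊗ₜ[A'] f x :=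
  rfl

end TensorMap

/-- Data and axioms of a relative truncated display of level `n ≥ 1` for the divided power
thickening `S → R = S/𝔞` (with divided powers `γ` on `𝔞`).

* A linear map `ε : 𝒥_{n+1} ⊗_{𝒲_n(S)} P → Q` is written as a map `ε` of two variables, additive in
  the first one and linear in the second one; `𝒲_n(S)` acts on `𝒥_{n+1}` through the surjection
  `W_{n+1}(S) → 𝒲_n(S)`, and `eps_smul` is linearity in the first variable.
* The cokernels of `ι` and `ε` are annihilated by `κ(𝒥_{n+1})`, the kernel of `𝒲_n(S) → S/𝔞`
  (by `iota_eps` and `eps_iota`), hence they are `S/𝔞`-modules and coincide with their base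
  change to `S/𝔞`; in this form the axioms say that they are finitely generated projective
  `S/𝔞`-modules. -/
structure RelDisplay (p : ℕ) [Fact p.Prime] (n : ℕ) [NeZero n] {S : Type u} [CommRing S]
    (𝔞 : Ideal S) (γ : DividedPowers 𝔞) where
  P : Type u
  [instAddCommGroupP : AddCommGroup P]
  [instModuleP : Module (CalW p n S) P]
  Q : Type u
  [instAddCommGroupQ : AddCommGroup Q]
  [instModuleQ : Module (CalW p n S) Q]
  iota : Q →ₗ[CalW p n S] P
  eps : J p n 𝔞 →+ P →ₗ[CalW p n S] Q
  eps_smul : ∀ (c : W p (n + 1) S) (j : J p n 𝔞) (x : P),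
    eps (c • j) x = CalW.of p n S c • eps j x
  F : P →ₛₗ[CalW.frob p n S] (W p n S ⊗[CalW p n S] P)
  Fdot : Q →ₛₗ[CalW.frob p n S] (W p n S ⊗[CalW p n S] P)
  finite : Module.Finite (CalW p n S) P
  projective : Module.Projective (CalW p n S) P
  iota_eps : ∀ (j : J p n 𝔞) (x : P), iota (eps j x) = CalW.of p n S j • x
  eps_iota : ∀ (j : J p n 𝔞) (y : Q), eps j (iota y) = CalW.of p n S j • y
  finite_coker_iota : Module.Finite (S ⧸ 𝔞)
    ((S ⧸ 𝔞) ⊗[CalW p n S] (P ⧸ LinearMap.range iota))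
  projective_coker_iota : Module.Projective (S ⧸ 𝔞)
    ((S ⧸ 𝔞) ⊗[CalW p n S] (P ⧸ LinearMap.range iota))
  finite_coker_eps : Module.Finite (S ⧸ 𝔞)
    ((S ⧸ 𝔞) ⊗[CalW p n S] (Q ⧸ Submodule.span (CalW p n S) {y | ∃ j x, y = eps j x}))
  projective_coker_eps : Module.Projective (S ⧸ 𝔞)
    ((S ⧸ 𝔞) ⊗[CalW p n S] (Q ⧸ Submodule.span (CalW p n S) {y | ∃ j x, y = eps j x}))
  Fdot_eps : ∀ (j : J p n 𝔞) (x : P), Fdot (eps j x) = sigmaDot p n γ j • F x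
  span_Fdot : Submodule.span (W p n S) (Set.range Fdot) = ⊤
  /-- The map `Q / im ε → P / κ(𝒥_{n+1})P` induced by `ι` is injective. -/
  hodge_injective : ∀ y : Q,
    iota y ∈ ((J p n 𝔞).map (CalW.of p n S) • ⊤ : Submodule (CalW p n S) P) →
      y ∈ Submodule.span (CalW p n S) {y | ∃ j x, y = eps j x}

attribute [instance] RelDisplay.instAddCommGroupP RelDisplay.instModuleP
  RelDisplay.instAddCommGroupQ RelDisplay.instModuleQ

/-- Truncated displays of level `n` over `R`: the case `𝔞 = 0` of the above. Then
`𝒥_{n+1} = I_{n+1}(R)` and `σ̇ = V⁻¹`. -/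
abbrev Display (p : ℕ) [Fact p.Prime] (n : ℕ) [NeZero n] (R : Type u) [CommRing R] :=
  RelDisplay p n (⊥ : Ideal R) (dividedPowersBot R)

section Morphisms

variable {p : ℕ} [Fact p.Prime] {n : ℕ} [NeZero n]

namespace RelDisplay

section Hodge

variable {S : Type u} [CommRing S] {𝔞 : Ideal S} {γ : DividedPowers 𝔞}

/-- The `S`-module `S ⊗_{𝒲_n(S)} P`. For a relative truncated display which lifts a nilpotent
truncated display `𝒫̄` over `R = S/𝔞` this is the value at `S` of the crystal of `𝒫̄`. -/
abbrev Fiber (X : RelDisplay p n 𝔞 γ) : Type u := S ⊗[CalW p n S] X.P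

/-- For a truncated display over `S` (the case `𝔞 = 0`) the `S`-module `P/ι(Q)`, written as
`S ⊗_{𝒲_n(S)} P/ι(Q)`. -/
abbrev HodgeQuot (X : RelDisplay p n 𝔞 γ) : Type u :=
  S ⊗[CalW p n S] (X.P ⧸ LinearMap.range X.iota)

/-- For a truncated display over `S` (the case `𝔞 = 0`) the Hodge filtration
`S ⊗_{𝒲_n(S)} P = P/κ(I_{n+1})P → P/ι(Q)`. -/
def hodge (X : RelDisplay p n 𝔞 γ) : X.Fiber →ₗ[S] X.HodgeQuot :=
  (LinearMap.range X.iota).mkQ.baseChange S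

end Hodge

section Hom

variable {S S' : Type u} [CommRing S] [CommRing S'] {𝔞 : Ideal S} {γ : DividedPowers 𝔞}
  {𝔞' : Ideal S'} {γ' : DividedPowers 𝔞'}

/-- Homomorphisms `X → Y` of relative truncated displays over a ring homomorphism
`φ : S → S'` with `φ(𝔞) ⊆ 𝔞'`. For `φ = id` and `𝔞 = 𝔞'` these are the morphisms in the category
of relative truncated displays for `S → S/𝔞`. -/
structure Hom (φ : S →+* S') (h : 𝔞 ≤ 𝔞'.comap φ) (X : RelDisplay p n 𝔞 γ)
    (Y : RelDisplay p n 𝔞' γ') where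
  f₀ : X.P →ₛₗ[CalW.map p n φ] Y.P
  f₁ : X.Q →ₛₗ[CalW.map p n φ] Y.Q
  map_iota : ∀ y, f₀ (X.iota y) = Y.iota (f₁ y)
  map_eps : ∀ (j : J p n 𝔞) (x : X.P), f₁ (X.eps j x) = Y.eps (J.map p n φ h j) (f₀ x)
  map_F : ∀ x, tensorMap (W.map p n φ) (CalW.map_algebraMap_W p n φ) f₀ (X.F x) = Y.F (f₀ x)
  map_Fdot : ∀ y,
    tensorMap (W.map p n φ) (CalW.map_algebraMap_W p n φ) f₀ (X.Fdot y) = Y.Fdot (f₁ y)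

namespace Hom

variable {φ : S →+* S'} {h : 𝔞 ≤ 𝔞'.comap φ} {X : RelDisplay p n 𝔞 γ} {Y : RelDisplay p n 𝔞' γ'}

/-- `f : X → Y` is a base change of `X` along `φ` if it is universal among the homomorphisms
over `φ` from `X` to relative truncated displays for `S' → S'/𝔞'`. -/
def IsBaseChange (f : Hom φ h X Y) : Prop :=
  ∀ (Z : RelDisplay p n 𝔞' γ') (g : Hom φ h X Z),
    ∃! k : Hom (RingHom.id S') le_rfl Y Z,
      (∀ x, k.f₀ (f.f₀ x) = g.f₀ x) ∧ ∀ y, k.f₁ (f.f₁ y) = g.f₁ y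

/-- The induced map `S ⊗_{𝒲_n(S)} P → S' ⊗_{𝒲_n(S')} P'`. -/
def fiberMap (f : Hom φ h X Y) : X.Fiber →ₛₗ[φ] Y.Fiber :=
  tensorMap φ (CalW.map_algebraMap p n φ) f.f₀

/-- The induced map `P/ι(Q) → P'/ι'(Q')`. -/
def hodgeQuotMap (f : Hom φ h X Y) : X.HodgeQuot →ₛₗ[φ] Y.HodgeQuot :=
  tensorMap φ (CalW.map_algebraMap p n φ)
    (Submodule.mapQ (LinearMap.range X.iota) (LinearMap.range Y.iota) f.f₀ (by
      rintro _ ⟨y, rfl⟩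
      exact ⟨f.f₁ y, (f.map_iota y).symm⟩))

end Hom

end Hom

end RelDisplay

section Nilpotence

/-- The Frobenius `x ↦ x ^ p` of a ring in which `p = 0`. -/
def frobeniusOfZero {R : Type u} [CommRing R] (hp : (p : R) = 0) : R →+* R where
  toFun x := x ^ p
  map_one' := one_pow p
  map_mul' x y := mul_pow x y p
  map_zero' := zero_pow (Fact.out : p.Prime).ne_zero
  map_add' x y := by
    obtain ⟨r, hr⟩ := exists_add_pow_prime_eq (Fact.out : p.Prime) x y
    rw [hr, hp, zero_mul, zero_mul, zero_mul, add_zero]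

/-- The object `E^k(M)` for an endofunctor `E`. -/
def iterObj {C : Type*} [Category C] (E : C ⥤ C) (M : C) : ℕ → C
  | 0 => M
  | k + 1 => E.obj (iterObj E M k)

/-- The `k`-th iterate of `V : M → E(M)`. -/
def iterHom {C : Type*} [Category C] (E : C ⥤ C) {M : C} (V : M ⟶ E.obj M) :
    (k : ℕ) → (M ⟶ iterObj E M k)
  | 0 => 𝟙 M
  | k + 1 => V ≫ E.map (iterHom E V k)

open scoped ChangeOfRings in
/-- Let `pR = 0`. The truncated display `X` over `R` is nilpotent of order `≤ e`: The linear map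
`V♯ : P/I_nP → R ⊗_{Frob,R} P/I_nP` is determined by `V♯(Ḟ y) = 1 ⊗ ι(y)` for `y ∈ Q`; it restricts
to `V̄♯ : N → R ⊗_{Frob,R} N` where `N = ι(Q)/I_nP` is the image of `R ⊗ Q` in
`R ⊗ P = P/I_nP`; and the iterate `(V̄^e)♯ : N → R ⊗_{Frob^e,R} N` is zero. -/
def NilpotentOrderLEOfZero {R : Type u} [CommRing R] (hp : (p : R) = 0) (X : Display p n R)
    (e : ℕ) : Prop :=
  let E := ModuleCat.extendScalars.{u, u, u} (frobeniusOfZero hp)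
  let M := ModuleCat.of R X.Fiber
  let N := ModuleCat.of R (LinearMap.range (X.iota.baseChange R))
  let incl : N ⟶ M := ModuleCat.ofHom (LinearMap.range (X.iota.baseChange R)).subtype
  ∃ (V : M ⟶ E.obj M) (Vbar : N ⟶ E.obj N),
    (∀ y : X.Q,
      V.hom (tensorMap (W.zeroth p n R) (ψ := RingHom.id (CalW p n R)) (fun _ => rfl)
          (LinearMap.id : X.P →ₗ[CalW p n R] X.P) (X.Fdot y)) =
        ((1 : R) ⊗ₜ[R, frobeniusOfZero hp] ((1 : R) ⊗ₜ[CalW p n R] X.iota y : X.Fiber))) ∧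
    Vbar ≫ E.map incl = incl ≫ V ∧
    iterHom E Vbar e = 0

theorem natCast_eq_zero_mod (p : ℕ) (R : Type u) [CommRing R] :
    (p : R ⧸ Ideal.span {(p : R)}) = 0 := by
  rw [← map_natCast (Ideal.Quotient.mk _), Ideal.Quotient.eq_zero_iff_mem]
  exact Ideal.mem_span_singleton_self _

/-- The truncated display `X` over `R` is nilpotent of order `≤ e`: its base change to `R/pR`
is so. -/
def NilpotentOrderLE {R : Type u} [CommRing R] (X : Display p n R) (e : ℕ) : Prop :=
  ∃ (X₀ : Display p n (R ⧸ Ideal.span {(p : R)}))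
    (f : RelDisplay.Hom (Ideal.Quotient.mk (Ideal.span {(p : R)})) bot_le X X₀),
    f.IsBaseChange ∧ NilpotentOrderLEOfZero (natCast_eq_zero_mod p R) X₀ e

end Nilpotence

section Lifts

variable {S R : Type u} [CommRing S] [CommRing R]

/-- A lift of the truncated display `Xbar` over `R` along `f : S → R` to a relative truncated
display for `S → S/𝔞` (where `f(𝔞) = 0`): a relative truncated display `obj` together with a
homomorphism `red : obj → Xbar` over `f` which identifies `Xbar` with the base change of `obj`. -/
structure Lift (f : S →+* R) (𝔞 : Ideal S) (γ : DividedPowers 𝔞)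
    (h : 𝔞 ≤ (⊥ : Ideal R).comap f) (Xbar : Display p n R) where
  obj : RelDisplay p n 𝔞 γ
  red : RelDisplay.Hom f h obj Xbar
  isBaseChange : red.IsBaseChange

/-- Lifts of a truncated display over `R` to truncated displays over `S`. -/
abbrev AbsLift (f : S →+* R) (Xbar : Display p n R) :=
  Lift f ⊥ (dividedPowersBot S) bot_le Xbar

/-- Lifts of a truncated display over `R` to relative truncated displays for `S → R`. -/
abbrev RelLift (f : S →+* R) (γ : DividedPowers (RingHom.ker f)) (Xbar : Display p n R) :=
  Lift f (RingHom.ker f) γ le_rfl Xbar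

variable {f : S →+* R} {Xbar : Display p n R}

/-- A homomorphism over `id_S` between two lifts of `Xbar` which lifts the identity of `Xbar`.
If `X` is a lift to a truncated display over `S` and `Y` is a lift to a relative truncated
display for `S → R`, this is the same as a morphism from the relative truncated display
associated to `X` to `Y`. -/
structure LiftHom {𝔞 𝔟 : Ideal S} {γ : DividedPowers 𝔞} {δ : DividedPowers 𝔟}
    {h : 𝔞 ≤ (⊥ : Ideal R).comap f} {h' : 𝔟 ≤ (⊥ : Ideal R).comap f} (hab : 𝔞 ≤ 𝔟)
    (X : Lift f 𝔞 γ h Xbar) (Y : Lift f 𝔟 δ h' Xbar) where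
  hom : RelDisplay.Hom (RingHom.id S) hab X.obj Y.obj
  red₀ : ∀ x, Y.red.f₀ (hom.f₀ x) = X.red.f₀ x
  red₁ : ∀ y, Y.red.f₁ (hom.f₁ y) = X.red.f₁ y

/-- There is a homomorphism `X → Y` lifting the identity of `Xbar`, each such homomorphism
induces an isomorphism `S ⊗_{𝒲_n(S)} P_X → S ⊗_{𝒲_n(S)} P_Y`, and this isomorphism is independent
of the choice. -/
def CanonicallyIsomorphicFibers {𝔞 𝔟 : Ideal S} {γ : DividedPowers 𝔞} {δ : DividedPowers 𝔟}
    {h : 𝔞 ≤ (⊥ : Ideal R).comap f} {h' : 𝔟 ≤ (⊥ : Ideal R).comap f} (hab : 𝔞 ≤ 𝔟)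
    (X : Lift f 𝔞 γ h Xbar) (Y : Lift f 𝔟 δ h' Xbar) : Prop :=
  Nonempty (LiftHom hab X Y) ∧
    (∀ α : LiftHom hab X Y, Function.Bijective α.hom.fiberMap) ∧
    ∀ α β : LiftHom hab X Y, α.hom.fiberMap = β.hom.fiberMap

/-- Two lifts of `Xbar` to truncated displays over `S` are isomorphic if there is an isomorphism
of truncated displays which lifts the identity of `Xbar`. -/
def AbsLift.IsIso (X X' : AbsLift f Xbar) : Prop :=
  ∃ α : LiftHom le_rfl X X', Function.Bijective α.hom.f₀ ∧ Function.Bijective α.hom.f₁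

variable (f Xbar) in
/-- The isomorphism classes of lifts of `Xbar` to truncated displays over `S`. -/
def AbsLiftClass : Type (u + 1) := Quot (AbsLift.IsIso (f := f) (Xbar := Xbar))

/-- A lift of the Hodge filtration of `Xbar` to `D = S ⊗_{𝒲_n(S)} P` for a lift `Y` of
`Xbar` to a relative truncated display for `S → R`: a commutative diagram with upper row
`D → T`, lower row the Hodge filtration `R ⊗ P̄ → P̄/ι(Q̄)`, and vertical maps the reduction and `ρ`,
where `T` is a finitely generated projective `S`-module and `ρ` induces an isomorphism
`R ⊗_S T = T / ker(f)T ≅ P̄/ι(Q̄)`. -/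
structure HodgeLift {γ : DividedPowers (RingHom.ker f)} (Y : RelLift f γ Xbar) where
  T : Type u
  [instAddCommGroup : AddCommGroup T]
  [instModule : Module S T]
  finite : Module.Finite S T
  projective : Module.Projective S T
  π : Y.obj.Fiber →ₗ[S] T
  ρ : T →ₛₗ[f] Xbar.HodgeQuot
  comm : ∀ z, ρ (π z) = Xbar.hodge (Y.red.fiberMap z)
  ρ_surjective : Function.Surjective ρ
  ρ_ker : ∀ t, ρ t = 0 ↔ t ∈ (RingHom.ker f • ⊤ : Submodule S T)

attribute [instance] HodgeLift.instAddCommGroup HodgeLift.instModule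

namespace HodgeLift

variable {γ : DividedPowers (RingHom.ker f)} {Y : RelLift f γ Xbar}

/-- Isomorphism of lifts of the Hodge filtration. -/
def IsIso (H H' : HodgeLift Y) : Prop :=
  ∃ θ : H.T ≃ₗ[S] H'.T, (∀ z, θ (H.π z) = H'.π z) ∧ ∀ t, H'.ρ (θ t) = H.ρ t

variable (Y) in
/-- The set of lifts of the Hodge filtration of `Xbar` to `S ⊗_{𝒲_n(S)} P` (where isomorphic
diagrams are identified, i.e. quotients `T` of `S ⊗_{𝒲_n(S)} P`). -/
def Class : Type (u + 1) := Quot (IsIso (Y := Y))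

/-- The lift `H` of the Hodge filtration of `Xbar` to `S ⊗_{𝒲_n(S)} P_Y` is the Hodge filtration
`S ⊗_{𝒲_n(S)} P_X → P_X/ι(Q_X)` of the truncated display `X` over `S`, transported by the
isomorphism `S ⊗_{𝒲_n(S)} P_X ≅ S ⊗_{𝒲_n(S)} P_Y` which is induced by `α`. -/
def IsHodgeOf {X : AbsLift f Xbar} (α : LiftHom bot_le X Y) (H : HodgeLift Y) : Prop :=
  ∃ θ : X.obj.HodgeQuot ≃ₗ[S] H.T,
    (∀ z, θ (X.obj.hodge z) = H.π (α.hom.fiberMap z)) ∧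
    ∀ t, H.ρ (θ t) = X.red.hodgeQuotMap t

end HodgeLift

end Lifts

end Morphisms

end Disp

end

/-! Since 𝔞 carries divided powers, Witt vectors over 𝔞 have logarithmic coordinates. In these,
addition is componentwise, W(S) acts on the i-th coordinate through the i-th ghost component, σ̇
shifts all coordinates by one place, and F = pσ̇. These rules hold universally: they are checked on
ghost components over a torsion-free ring containing the needed divided powers (`exists_dp_cover`,
`logWitt_add`, `mul_logWitt`) and give `glog_mul` and `glog_frobenius`.

As p is nilpotent, every relative truncated display has a normal decomposition P = L ⊕ T, Q = L ⊕ 𝒥T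
(`exists_normalDec`), and the Frobenius-linear map Ψ, equal to Ḟ on L and to F on T, has a bijective
linearization (`exists_factor`). Three consequences are used throughout. An element y of Q is
determined by ι(y) and Ḟ(y) (`Q_ext`). A display can be built from P, an idempotent and Ψ
(`ofNormal`). Base change along a surjection has a concrete description (`isSurjBaseChange`). Since
W_n(S) → W_n(R) and 𝒲_n(S) → 𝒲_n(R) have nil kernels, the data P, e, Ψ lift, so relative lifts exist
(`exists_relLift`).

Morphisms between lifts come from successive approximation. A linear lift of the identity is
compatible with Ψ up to an error with coefficients in W_n(𝔞), that is, with at most n logarithmic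
coordinates. Subtracting the error replaces it by its image under Ḟ or Fι, which has one coordinate
less, so n corrections suffice (`exists_pred`). This does not use the nilpotence order.

Uniqueness on S ⊗ P is where that order enters. By `dglog_Fdot`, the i-th logarithmic coordinate of
the difference of two morphisms at Ḟ(y) is a combination of (i+1)-st coordinates at ι(y), plus p
times another such combination. Modulo p, coordinates of positive index descend to the reduction of
the display over R/p, and the recursion becomes composition with V♯; e iterations vanish on the
Hodge submodule. Hence if the coordinates of index ≤ k lie in an ideal 𝔠, those of index ≤ k - (e+1)
lie in p𝔠 (`dglog_mem_mul`). After m rounds, which use up m(e+1) < n coordinates, the zeroth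
coordinate lies in p^m𝔞 = 0.

For the deformation statement, a morphism from an absolute lift X to a relative lift Y is bijective
on P, and the image of Q_X in Q_Y depends only on the transported Hodge filtration (`exists_f₁_eq`);
hence injectivity. For surjectivity, an idempotent splitting a given lift of the filtration,
together with the maps F and Ḟ of Y, defines a display over S (`exists_lift`). -/

noncomputable section

namespace Disp

/-! ### Divided power polynomial rings over torsion-free rings -/

section DividedPowerPolynomials

open Polynomial

variable {K : Type*} [CommRing K] (A : Subring K)

/-- The subring of `K[X]` of all `∑ a_n X ^ n / n!` with `a_n ∈ A`, if `K` is a `ℚ`-algebra. -/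
def dpSubring : Subring K[X] where
  carrier := {f | ∀ n, (n.factorial : K) * f.coeff n ∈ A}
  mul_mem' {f g} hf hg n := by
    rw [coeff_mul, Finset.mul_sum]
    refine A.sum_mem fun ij hij => ?_
    rw [Finset.HasAntidiagonal.mem_antidiagonal] at hij
    have h := Nat.add_choose_mul_factorial_mul_factorial ij.1 ij.2
    rw [← Nat.choose_symm_add] at h
    rw [hij] at h
    have h2 : (n.factorial : K) * (f.coeff ij.1 * g.coeff ij.2) =
        (n.choose ij.1 : K) * (((ij.1).factorial * f.coeff ij.1) *
          ((ij.2).factorial * g.coeff ij.2)) := by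
      rw [← h]; push_cast; ring
    rw [h2]
    exact A.mul_mem (natCast_mem A _) (A.mul_mem (hf _) (hg _))
  one_mem' n := by
    rcases n with _ | n
    · simp
    · simp [coeff_one]
  add_mem' {f g} hf hg n := by
    rw [coeff_add, mul_add]; exact A.add_mem (hf n) (hg n)
  zero_mem' n := by simp
  neg_mem' {f} hf n := by
    rw [coeff_neg, mul_neg]; exact A.neg_mem (hf n)

theorem C_mem_dpSubring {a : K} (ha : a ∈ A) : C a ∈ dpSubring A := by
  intro n
  rcases n with _ | n
  · simpa using ha
  · simp

variable {S : Type*} [CommRing S] {𝔞 : Ideal S} (γ : DividedPowers 𝔞) (ψ : A →+* S) {a : S}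

variable {A} in
/-- The additive map underlying `dpEval`. -/
def dpEvalAux (a : S) : dpSubring A →+ S where
  toFun f := ∑ᶠ n, ψ ⟨_, f.2 n⟩ * γ.dpow n a
  map_zero' := by
    refine (finsum_congr fun n => ?_).trans finsum_zero
    have : (⟨_, (0 : dpSubring A).2 n⟩ : A) = 0 := Subtype.ext (by simp)
    rw [this, map_zero, zero_mul]
  map_add' f g := by
    have hfin (f : dpSubring A) :
        (Function.support fun n => ψ ⟨_, f.2 n⟩ * γ.dpow n a).Finite := by
      refine f.1.support.finite_toSet.subset fun n hn => ?_
      rw [Finset.mem_coe, mem_support_iff]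
      intro h0
      refine hn ?_
      have : (⟨_, f.2 n⟩ : A) = 0 := Subtype.ext (by simp [h0])
      simp only [this, map_zero, zero_mul]
    rw [← finsum_add_distrib (hfin f) (hfin g)]
    refine finsum_congr fun n => ?_
    rw [← add_mul, ← map_add]
    congr 2
    exact Subtype.ext (by simp [mul_add])

theorem dpEvalAux_monomial (n : ℕ) (c : K) (hc : (n.factorial : K) * c ∈ A)
    (h : monomial n c ∈ dpSubring A) :
    dpEvalAux γ ψ a ⟨monomial n c, h⟩ = ψ ⟨_, hc⟩ * γ.dpow n a := by
  change ∑ᶠ k, ψ ⟨_, h k⟩ * γ.dpow k a = _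
  rw [finsum_eq_single _ n]
  · congr 2
    exact Subtype.ext (by simp)
  · intro k hk
    have : (⟨_, h k⟩ : A) = 0 := Subtype.ext (by simp [coeff_monomial, hk.symm])
    rw [this, map_zero, zero_mul]

theorem monomial_mem_dpSubring {n : ℕ} {c : K} (hc : (n.factorial : K) * c ∈ A) :
    monomial n c ∈ dpSubring A := by
  intro k
  rw [coeff_monomial]
  split_ifs with h
  · rwa [← h]
  · simp

theorem dpSubring_induction {q : dpSubring A → Prop}
    (hmono : ∀ n c (hc : (n.factorial : K) * c ∈ A),
      q ⟨monomial n c, monomial_mem_dpSubring A hc⟩)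
    (hadd : ∀ f g, q f → q g → q (f + g)) (h0 : q 0) (f : dpSubring A) : q f := by
  have : f = ∑ n ∈ f.1.support, ⟨monomial n _, monomial_mem_dpSubring A (f.2 n)⟩ := by
    apply Subtype.ext
    rw [AddSubmonoidClass.coe_finsetSum]
    exact f.1.as_sum_support
  rw [this]
  exact Finset.sum_induction _ q hadd h0 fun n _ => hmono n _ (f.2 n)

variable {A} in
/-- The ring homomorphism `∑ a_n X ^ n / n! ↦ ∑ ψ(a_n) γ_n(a)`. -/
def dpEval (ha : a ∈ 𝔞) : dpSubring A →+* S where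
  __ := dpEvalAux γ ψ a
  map_one' := by
    have h : (monomial 0 1 : K[X]) ∈ dpSubring A := (dpSubring A).one_mem
    refine (dpEvalAux_monomial A γ ψ 0 1 (by simp) h).trans ?_
    rw [γ.dpow_zero ha, mul_one]
    exact (congrArg ψ (Subtype.ext (by simp))).trans (map_one ψ)
  map_mul' f g := by
    change dpEvalAux γ ψ a (f * g) = dpEvalAux γ ψ a f * dpEvalAux γ ψ a g
    induction f using dpSubring_induction with
    | h0 => simp
    | hadd f f' h h' => rw [add_mul, map_add, h, h', map_add, add_mul]
    | hmono n c hc =>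
      induction g using dpSubring_induction with
      | h0 => simp
      | hadd f f' h h' => rw [mul_add, map_add, h, h', map_add, mul_add]
      | hmono m d hd =>
        have key : ((n + m).factorial : K) * (c * d) =
            ((n + m).choose n : K) * ((n.factorial * c) * (m.factorial * d)) := by
          rw [← Nat.add_choose_mul_factorial_mul_factorial n m, ← Nat.choose_symm_add]; push_cast; ring
        have hcd : ((n + m).factorial : K) * (c * d) ∈ A := by
          rw [key]; exact A.mul_mem (natCast_mem A _) (A.mul_mem hc hd)
        have h1 : (⟨monomial n c, monomial_mem_dpSubring A hc⟩ : dpSubring A) *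
            ⟨monomial m d, monomial_mem_dpSubring A hd⟩ =
            ⟨monomial (n + m) (c * d), monomial_mem_dpSubring A hcd⟩ :=
          Subtype.ext (monomial_mul_monomial _ _ _ _)
        rw [h1, dpEvalAux_monomial A γ ψ _ _ hcd, dpEvalAux_monomial A γ ψ _ _ hc,
          dpEvalAux_monomial A γ ψ _ _ hd]
        have h2 : (⟨_, hcd⟩ : A) = ((n + m).choose n : A) * (⟨_, hc⟩ * ⟨_, hd⟩) :=
          Subtype.ext (by simpa using key)
        rw [h2, map_mul, map_mul, map_natCast]
        linear_combination -ψ ⟨_, hc⟩ * ψ ⟨_, hd⟩ * (γ.mul_dpow (m := n) (n := m) ha)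

theorem dpEval_monomial (ha : a ∈ 𝔞) (n : ℕ) (c : K) (hc : (n.factorial : K) * c ∈ A)
    (h : monomial n c ∈ dpSubring A) :
    dpEval γ ψ ha ⟨monomial n c, h⟩ = ψ ⟨_, hc⟩ * γ.dpow n a :=
  dpEvalAux_monomial A γ ψ n c hc h

theorem dpEval_C (ha : a ∈ 𝔞) (c : K) (hc : c ∈ A) (h : C c ∈ dpSubring A) :
    dpEval γ ψ ha ⟨C c, h⟩ = ψ ⟨c, hc⟩ := by
  rw [← monomial_zero_left] at h
  refine (dpEval_monomial A γ ψ ha 0 c (by simpa using hc) h).trans ?_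
  rw [γ.dpow_zero ha, mul_one]
  exact congrArg ψ (Subtype.ext (by simp))

/-- Any sequence of elements and two elements of a divided power ideal come from a ring
without torsion in which the divided powers of the latter two exist. -/
theorem exists_dp_cover (c : ℕ → S) {a b : S} (ha : a ∈ 𝔞) (hb : b ∈ 𝔞) :
    ∃ (K : Type) (_ : CommRing K) (_ : Algebra ℚ K) (D : Subring K) (ev : D →+* S)
      (c' : ℕ → D) (x y : ℕ → D), (∀ i, ev (c' i) = c i) ∧ (∀ i, ev (x i) = γ.dpow i a) ∧
      (∀ i, ev (y i) = γ.dpow i b) ∧ (∀ i, (i.factorial : K) * x i = (x 1 : K) ^ i) ∧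
      ∀ i, (i.factorial : K) * y i = (y 1 : K) ^ i := by
  -- The coefficient ring is ℤ[X_0, X_1, …], placed inside a ℚ-algebra; its variables will map to
  -- the given sequence.
  let ρ : MvPolynomial ℕ ℤ →+* MvPolynomial ℕ ℚ := MvPolynomial.map (Int.castRingHom ℚ)
  have hρ : Function.Injective ρ := MvPolynomial.map_injective _ (Int.cast_injective)
  let E : MvPolynomial ℕ ℤ ≃+* ρ.range :=
    RingEquiv.ofBijective ρ.rangeRestrict
      ⟨fun x y h => hρ (congrArg Subtype.val h), ρ.rangeRestrict_surjective⟩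
  let ψ₀ : ρ.range →+* S :=
    ((MvPolynomial.aeval c : MvPolynomial ℕ ℤ →ₐ[ℤ] S) : MvPolynomial ℕ ℤ →+* S).comp
      E.symm.toRingHom
  let K₀ := MvPolynomial ℕ ℚ
  have hq {L : Type} [CommRing L] [Algebra ℚ L] (n : ℕ) :
      (n.factorial : L) * algebraMap ℚ L (n.factorial : ℚ)⁻¹ = 1 := by
    rw [← map_natCast (algebraMap ℚ L), ← map_mul, mul_inv_cancel₀, map_one]
    exact_mod_cast n.factorial_ne_zero
  -- The divided powers of `a` are adjoined first; those of `b` are then adjoined over the resulting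
  -- ring.
  let A₁ := dpSubring ρ.range
  let ψ₁ := dpEval γ ψ₀ ha
  let A₂ := dpSubring A₁
  let ψ₂ := dpEval γ ψ₁ hb
  have hx₁ (n : ℕ) : (n.factorial : K₀) * algebraMap ℚ K₀ (n.factorial : ℚ)⁻¹ ∈ ρ.range := by
    rw [hq]; exact one_mem _
  have hy₁ (n : ℕ) :
      (n.factorial : K₀[X]) * algebraMap ℚ K₀[X] (n.factorial : ℚ)⁻¹ ∈ A₁ := by
    rw [hq]; exact one_mem _
  have hc (i : ℕ) : ρ (MvPolynomial.X i) ∈ ρ.range := ⟨_, rfl⟩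
  refine ⟨K₀[X][X], inferInstance, inferInstance, A₂, ψ₂,
    fun i => ⟨C (C (ρ (MvPolynomial.X i))),
      C_mem_dpSubring _ (C_mem_dpSubring _ (hc i))⟩,
    fun n => ⟨C (monomial n (algebraMap ℚ K₀ (n.factorial : ℚ)⁻¹)),
      C_mem_dpSubring _ (monomial_mem_dpSubring _ (hx₁ n))⟩,
    fun n => ⟨monomial n (algebraMap ℚ K₀[X] (n.factorial : ℚ)⁻¹),
      monomial_mem_dpSubring _ (hy₁ n)⟩, fun i => ?_, fun n => ?_, fun n => ?_, fun n => ?_,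
      fun n => ?_⟩
  · rw [dpEval_C _ _ _ _ _ (C_mem_dpSubring _ (hc i)), dpEval_C _ _ _ _ _ (hc i)]
    have : E.symm ⟨_, hc i⟩ = MvPolynomial.X i := by
      rw [RingEquiv.symm_apply_eq]; rfl
    change MvPolynomial.aeval c (E.symm ⟨_, hc i⟩) = c i
    rw [this, MvPolynomial.aeval_X]
  · rw [dpEval_C _ _ _ _ _ (monomial_mem_dpSubring _ (hx₁ n)), dpEval_monomial _ _ _ _ _ _ (hx₁ n)]
    have : (⟨_, hx₁ n⟩ : ρ.range) = 1 := Subtype.ext (hq n)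
    rw [this, map_one, one_mul]
  · rw [dpEval_monomial _ _ _ _ _ _ (hy₁ n)]
    have : (⟨_, hy₁ n⟩ : A₁) = 1 := Subtype.ext (hq n)
    rw [this, map_one, one_mul]
  · have h1 : (n.factorial : K₀[X]) * monomial n (algebraMap ℚ K₀ (n.factorial : ℚ)⁻¹) =
        (monomial 1 (algebraMap ℚ K₀ (Nat.factorial 1 : ℚ)⁻¹)) ^ n := by
      rw [← C_eq_natCast, C_mul_monomial, hq]
      simp
    have h2 := congrArg C h1
    rw [map_mul, map_pow, map_natCast] at h2
    exact h2
  · change (n.factorial : K₀[X][X]) * monomial n (algebraMap ℚ K₀[X] (n.factorial : ℚ)⁻¹) =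
        (monomial 1 (algebraMap ℚ K₀[X] (Nat.factorial 1 : ℚ)⁻¹)) ^ n
    rw [← C_eq_natCast, C_mul_monomial, hq]
    simp

end DividedPowerPolynomials

end Disp
end

noncomputable section

namespace Disp

/-! ### Witt vectors with one logarithmic coordinate, and the extension of V⁻¹ -/

section LogVectors

variable (p : ℕ) [Fact p.Prime]

/-- The integers `r_i` such that the `i`-th coordinate of the Witt vector with logarithmic
coordinates `[x, 0, 0, …]` is `r_i γ_{p ^ i}(x)`. -/
def logCoeff : ℕ → ℤ
  | 0 => 1
  | i + 1 => -∑ k : Fin (i + 1), (Nat.factorial (p ^ (i + 1 - (k : ℕ)) - 1) : ℤ) *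
      (logCoeff k ^ (p ^ (i + 1 - (k : ℕ))) *
        Nat.uniformBell (p ^ (i + 1 - (k : ℕ))) (p ^ (k : ℕ)))
decreasing_by exact k.2

variable {S : Type u} [CommRing S] {𝔞 : Ideal S} (γ : DividedPowers 𝔞)

omit [Fact p.Prime] in
theorem logVec_zero' (x : S) : logVec p γ x 0 = x := by rw [logVec]

/-- The divided power γ_q(γ_r(a)) is an integral multiple of γ_{qr}(a), with the coefficient
`Nat.uniformBell`. This turns the recursion for `logVec` into an integer recursion independent of S,
so that these vectors can be lifted to a torsion-free ring. -/
theorem logVec_eq {a : S} (ha : a ∈ 𝔞) (i : ℕ) :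
    logVec p γ a i = (logCoeff p i : S) * γ.dpow (p ^ i) a := by
  induction i using Nat.strong_induction_on with
  | _ i ih =>
    rcases i with _ | i
    · rw [logVec_zero', logCoeff, pow_zero, γ.dpow_one ha]; simp
    · rw [logVec, logCoeff]
      rw [Int.cast_neg, Int.cast_sum, neg_mul, Finset.sum_mul]
      congr 1
      refine Finset.sum_congr rfl fun k _ => ?_
      have hk : p ^ (k : ℕ) ≠ 0 := pow_ne_zero _ (Fact.out : p.Prime).ne_zero
      rw [ih k k.2, γ.dpow_mul (γ.dpow_mem hk ha), γ.dpow_comp hk ha, ← pow_add,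
        Nat.sub_add_cancel k.2.le]
      push_cast
      ring

theorem logVec_mem {a : S} (ha : a ∈ 𝔞) (i : ℕ) : logVec p γ a i ∈ 𝔞 := by
  rw [logVec_eq p γ ha]
  exact 𝔞.mul_mem_left _ (γ.dpow_mem (pow_ne_zero _ (Fact.out : p.Prime).ne_zero) ha)

theorem logVec_of_zero (i : ℕ) : logVec p γ 0 i = 0 := by
  rw [logVec_eq p γ 𝔞.zero_mem,
    γ.dpow_eval_zero (pow_ne_zero _ (Fact.out : p.Prime).ne_zero), mul_zero]

theorem ghostComponent_eq_sum {R : Type*} [CommRing R] (n : ℕ) (x : WittVector p R) :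
    WittVector.ghostComponent n x =
      ∑ i ∈ Finset.range (n + 1), (p : R) ^ i * x.coeff i ^ p ^ (n - i) := by
  rw [WittVector.ghostComponent_apply, wittPolynomial_eq_sum_C_mul_X_pow]
  simp

/-- The Witt vector with coordinates `r_i g_{p ^ i}`. -/
def logSeq {D : Type*} [CommRing D] (g : ℕ → D) : WittVector p D :=
  WittVector.mk p fun i => (logCoeff p i : D) * g (p ^ i)

/-- The i-th logarithmic coordinate is the i-th ghost component divided by p^i, so the recursion
defining `logVec` says exactly that the higher ghost components vanish. -/
theorem ghostComponent_logSeq {K : Type} [CommRing K] [Algebra ℚ K] (g : ℕ → K)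
    (hg : ∀ i, (i.factorial : K) * g i = g 1 ^ i) (i : ℕ) :
    WittVector.ghostComponent i (logSeq p g) = if i = 0 then g 1 else 0 := by
  classical
  -- Over a ℚ-algebra the unit ideal has divided powers xⁿ/n!, so `logVec` itself is available with
  -- first entry `g 1`.
  let γ' := DividedPowers.RatAlgebra.dividedPowers (⊤ : Ideal K)
  have hunit (n : ℕ) : IsUnit (n.factorial : K) := by
    rw [← map_natCast (algebraMap ℚ K)]
    exact (IsUnit.mk0 _ (by exact_mod_cast n.factorial_ne_zero)).map _
  have hfac (n : ℕ) (y : K) : (n.factorial : K) * γ' n y = y ^ n := by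
    rw [DividedPowers.RatAlgebra.dpow_apply, if_pos Submodule.mem_top,
      Ring.mul_inverse_cancel_left _ _ (hunit n)]
  have hg' (n : ℕ) : g n = γ' n (g 1) := (hunit n).mul_left_cancel ((hg n).trans (hfac n _).symm)
  have hc (i : ℕ) : (logSeq p g).coeff i = logVec p γ' (g 1) i := by
    rw [logVec_eq p γ' Submodule.mem_top, ← hg']; rfl
  rw [ghostComponent_eq_sum]
  rcases i with _ | i
  · simp [hc, logVec_zero']
  · rw [Finset.sum_range_succ, if_neg i.succ_ne_zero, hc (i + 1), logVec, Nat.sub_self, pow_zero,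
      pow_one, mul_neg, Finset.mul_sum, ← Finset.sum_range (n := i + 1) (f := fun k =>
        (p : K) ^ (i + 1) * (((p ^ (i + 1 - k) - 1).factorial : K) *
          γ' (p ^ (i + 1 - k)) (logVec p γ' (g 1) k))), add_neg_eq_zero]
    refine Finset.sum_congr rfl fun k hk => ?_
    rw [Finset.mem_range] at hk
    have h0 : p ^ (i + 1 - k) ≠ 0 := pow_ne_zero _ (Fact.out : p.Prime).ne_zero
    rw [hc, ← hfac (p ^ (i + 1 - k)), ← Nat.mul_factorial_pred h0]
    have : (p : K) ^ (i + 1) = p ^ k * p ^ (i + 1 - k) := by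
      rw [← pow_add, Nat.add_sub_cancel' hk.le]
    rw [this]
    push_cast
    ring

/-- The map W(D) → W(K) is injective, and the ghost map of K is bijective because p is invertible
there. -/
theorem witt_subring_ext {K : Type} [CommRing K] [Algebra ℚ K] {D : Subring K}
    {x y : WittVector p D}
    (h : ∀ n, WittVector.ghostComponent n (WittVector.map D.subtype x) =
      WittVector.ghostComponent n (WittVector.map D.subtype y)) : x = y := by
  have hp : (p : ℚ) * (p : ℚ)⁻¹ = 1 :=
    mul_inv_cancel₀ (by exact_mod_cast (Fact.out : p.Prime).ne_zero)
  have hpK : algebraMap ℚ K (p : ℚ)⁻¹ * (p : K) = 1 := by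
    rw [← map_natCast (algebraMap ℚ K), ← map_mul, mul_comm, hp, map_one]
  let _ : Invertible (p : K) := ⟨algebraMap ℚ K (p : ℚ)⁻¹, hpK, by rw [mul_comm]; exact hpK⟩
  exact WittVector.map_injective _ D.subtype_injective
    ((WittVector.ghostMap.bijective_of_invertible p K).1 (funext h))

theorem ghostComponent_map_logSeq {K : Type} [CommRing K] [Algebra ℚ K] {D : Subring K}
    (g : ℕ → D) (hg : ∀ i, (i.factorial : K) * g i = (g 1 : K) ^ i) (i : ℕ) :
    WittVector.ghostComponent i (WittVector.map D.subtype (logSeq p g)) =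
      if i = 0 then (g 1 : K) else 0 := by
  have : WittVector.map D.subtype (logSeq p g) = logSeq p fun n => (g n : K) := by
    ext i; simp [logSeq]
  rw [this, ghostComponent_logSeq p _ hg]

/-- The Witt vector with logarithmic coordinates `[a, 0, 0, …]`. -/
def logWitt (a : S) : WittVector p S := WittVector.mk p (logVec p γ a)

omit [Fact p.Prime] in
theorem logWitt_coeff (a : S) (i : ℕ) : (logWitt p γ a).coeff i = logVec p γ a i := rfl

theorem map_logSeq {D : Type} [CommRing D] (ev : D →+* S) (g : ℕ → D) {a : S} (ha : a ∈ 𝔞)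
    (h : ∀ i, ev (g i) = γ.dpow i a) : WittVector.map ev (logSeq p g) = logWitt p γ a := by
  ext i
  rw [WittVector.map_coeff, logWitt_coeff, logVec_eq p γ ha, ← h]
  simp [logSeq]

/-- The Frobenius is given by integral polynomials. The two rings may lie in different universes,
which is needed because the torsion-free cover lives in `Type`. -/
theorem map_frobenius' {R R' : Type*} [CommRing R] [CommRing R'] (φ : R →+* R')
    (x : WittVector p R) :
    WittVector.map φ (WittVector.frobenius x) = WittVector.frobenius (WittVector.map φ x) := by
  ext n
  rw [WittVector.map_coeff, WittVector.coeff_frobenius, WittVector.coeff_frobenius,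
    MvPolynomial.map_aeval, MvPolynomial.aeval_def, MvPolynomial.coe_eval₂Hom]
  exact congrArg₂ (fun f g => MvPolynomial.eval₂ f g _) (RingHom.ext_int _ _)
    (funext fun i => (WittVector.map_coeff φ x i).symm)

/-- The Frobenius shifts the ghost vector (a, 0, 0, …) to zero. -/
theorem frobenius_logWitt {a : S} (ha : a ∈ 𝔞) :
    WittVector.frobenius (logWitt p γ a) = 0 := by
  obtain ⟨K, _, _, D, ev, c', x, y, hc, hx, hy, hx1, hy1⟩ := exists_dp_cover γ (fun _ => 0) ha ha
  have : WittVector.frobenius (logSeq p x) = 0 := by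
    refine witt_subring_ext p fun n => ?_
    rw [map_frobenius', WittVector.ghostComponent_frobenius, ghostComponent_map_logSeq p x hx1, map_zero, map_zero,
      if_neg n.succ_ne_zero]
  rw [← map_logSeq p γ ev x ha hx, ← map_frobenius', this,
    map_zero]

theorem logWitt_add {a b : S} (ha : a ∈ 𝔞) (hb : b ∈ 𝔞) :
    logWitt p γ (a + b) = logWitt p γ a + logWitt p γ b := by
  obtain ⟨K, _, _, D, ev, c', x, y, hc, hx, hy, hx1, hy1⟩ := exists_dp_cover γ (fun _ => 0) ha hb
  -- This is the universal expression for the divided powers of a sum.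
  let z : ℕ → D := fun n => ∑ k ∈ Finset.HasAntidiagonal.antidiagonal n, x k.1 * y k.2
  have hx0 : (x 0 : K) = 1 := by simpa using hx1 0
  have hy0 : (y 0 : K) = 1 := by simpa using hy1 0
  have hz (n : ℕ) : (n.factorial : K) * z n = ((x 1 : K) + y 1) ^ n := by
    rw [(Commute.all _ _).add_pow']
    simp only [z, AddSubmonoidClass.coe_finsetSum, Subring.coe_mul, Finset.mul_sum]
    refine Finset.sum_congr rfl fun k hk => ?_
    rw [Finset.HasAntidiagonal.mem_antidiagonal] at hk
    rw [← hx1, ← hy1, ← hk, ← Nat.add_choose_mul_factorial_mul_factorial, ← Nat.choose_symm_add]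
    push_cast
    ring
  have hz1 : (z 1 : K) = x 1 + y 1 := by simpa using hz 1
  have : logSeq p z = logSeq p x + logSeq p y := by
    refine witt_subring_ext p fun n => ?_
    rw [map_add, map_add, ghostComponent_map_logSeq p x hx1, ghostComponent_map_logSeq p y hy1,
      ghostComponent_map_logSeq p z (by simpa only [hz1] using hz), hz1]
    split_ifs <;> simp
  rw [← map_logSeq p γ ev x ha hx, ← map_logSeq p γ ev y hb hy, ← map_add, ← this]
  refine (map_logSeq p γ ev z (𝔞.add_mem ha hb) fun n => ?_).symm
  rw [γ.dpow_add ha hb, map_sum]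
  exact Finset.sum_congr rfl fun k _ => by rw [map_mul, hx, hy]

/-- On ghost vectors, multiplying (a, 0, 0, …) by c only sees the zeroth ghost component of c, which
is its zeroth entry. -/
theorem mul_logWitt (c : WittVector p S) {a : S} (ha : a ∈ 𝔞) :
    c * logWitt p γ a = logWitt p γ (c.coeff 0 * a) := by
  obtain ⟨K, _, _, D, ev, c', x, y, hc, hx, hy, hx1, hy1⟩ := exists_dp_cover γ c.coeff ha ha
  let z : ℕ → D := fun n => c' 0 ^ n * x n
  have hz1 : (z 1 : K) = c' 0 * x 1 := by simp [z]
  have hz (n : ℕ) : (n.factorial : K) * z n = (z 1 : K) ^ n := by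
    rw [hz1, mul_pow, ← hx1]
    simp only [z, Subring.coe_mul, Subring.coe_pow]
    ring
  have : logSeq p z = WittVector.mk p c' * logSeq p x := by
    refine witt_subring_ext p fun n => ?_
    rw [map_mul, map_mul, ghostComponent_map_logSeq p x hx1, ghostComponent_map_logSeq p z hz, hz1]
    rcases n with _ | n
    · simp [ghostComponent_eq_sum]
    · simp
  have hc' : WittVector.map ev (WittVector.mk p c') = c := by
    ext i; rw [WittVector.map_coeff]; exact hc i
  rw [← map_logSeq p γ ev x ha hx]
  nth_rw 1 [← hc']
  rw [← map_mul, ← this]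
  refine map_logSeq p γ ev z (𝔞.mul_mem_left _ ha) fun n => ?_
  rw [γ.dpow_mul ha, map_mul, map_pow, hc, hx]

/-- The extension of `V⁻¹` which vanishes on the vectors with logarithmic coordinates
`[a, 0, 0, …]`. -/
def vinv (ξ : WittVector p S) : WittVector p S :=
  (ξ - logWitt p γ (ξ.coeff 0)).shift 1

theorem verschiebung_vinv (ξ : WittVector p S) :
    WittVector.verschiebung (vinv p γ ξ) = ξ - logWitt p γ (ξ.coeff 0) := by
  have h0 : (ξ - logWitt p γ (ξ.coeff 0)).coeff 0 = 0 := by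
    rw [← WittVector.constantCoeff_apply, map_sub, WittVector.constantCoeff_apply,
      WittVector.constantCoeff_apply, logWitt_coeff, logVec_zero', sub_self]
  exact (WittVector.eq_iterate_verschiebung (n := 1)
    (fun i hi => by rwa [Nat.lt_one_iff.1 hi])).symm

variable {p} {γ}

/-- Injectivity of V reduces every identity for `vinv` to one after applying V, where the explicit
formula is available. -/
theorem vinv_eq_iff {ξ η : WittVector p S} :
    vinv p γ ξ = η ↔ WittVector.verschiebung η = ξ - logWitt p γ (ξ.coeff 0) := by
  rw [← verschiebung_vinv]
  exact ⟨fun h => by rw [h], fun h => (WittVector.verschiebung_injective _ _ h).symm⟩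

theorem eq_logWitt_add (ξ : WittVector p S) :
    ξ = logWitt p γ (ξ.coeff 0) + WittVector.verschiebung (vinv p γ ξ) := by
  rw [verschiebung_vinv]; ring

theorem logWitt_zero : logWitt p γ 0 = 0 := by
  ext i; rw [logWitt_coeff, logVec_of_zero, WittVector.zero_coeff]

theorem add_coeff_zero (ξ η : WittVector p S) : (ξ + η).coeff 0 = ξ.coeff 0 + η.coeff 0 :=
  map_add WittVector.constantCoeff ξ η

theorem mul_coeff_zero (ξ η : WittVector p S) : (ξ * η).coeff 0 = ξ.coeff 0 * η.coeff 0 :=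
  map_mul WittVector.constantCoeff ξ η

theorem vinv_add {ξ η : WittVector p S} (hξ : ξ.coeff 0 ∈ 𝔞) (hη : η.coeff 0 ∈ 𝔞) :
    vinv p γ (ξ + η) = vinv p γ ξ + vinv p γ η := by
  rw [vinv_eq_iff, map_add, verschiebung_vinv, verschiebung_vinv, add_coeff_zero,
    logWitt_add p γ hξ hη]
  ring

/-- On the V-part this is the projection formula V(F(c)η) = cV(η); the logarithmic part is absorbed
by `mul_logWitt`. -/
theorem vinv_mul (c : WittVector p S) {ξ : WittVector p S} (hξ : ξ.coeff 0 ∈ 𝔞) :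
    vinv p γ (c * ξ) = WittVector.frobenius c * vinv p γ ξ := by
  rw [vinv_eq_iff, mul_comm, WittVector.verschiebung_mul_frobenius, verschiebung_vinv,
    mul_coeff_zero, ← mul_logWitt p γ _ hξ]
  ring

/-- The Frobenius kills the logarithmic part, and FV = p on the rest. The factor p here drives the
final divisibility argument. -/
theorem frobenius_eq_vinv {ξ : WittVector p S} (hξ : ξ.coeff 0 ∈ 𝔞) :
    WittVector.frobenius ξ = p * vinv p γ ξ := by
  conv_lhs => rw [eq_logWitt_add (γ := γ) ξ]
  rw [map_add, frobenius_logWitt p γ hξ, WittVector.frobenius_verschiebung]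
  ring

theorem vinv_verschiebung (ξ : WittVector p S) :
    vinv p γ (WittVector.verschiebung ξ) = ξ := by
  rw [vinv_eq_iff, WittVector.verschiebung_coeff_zero, logWitt_zero, sub_zero]

theorem vinv_zero : vinv p γ 0 = 0 := by
  rw [vinv_eq_iff, WittVector.zero_coeff, logWitt_zero, sub_zero, map_zero]

end LogVectors

end Disp
end

noncomputable section

namespace Disp

/-! ### Logarithmic coordinates as iterates of σ̇ -/

section LogFiltration

variable {p : ℕ} [Fact p.Prime] {S : Type u} [CommRing S] {𝔞 : Ideal S} (γ : DividedPowers 𝔞)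

/-- The ideal obtained from `I` by requiring `ξ₀ ∈ 𝔞` and `σ̇(ξ) ∈ I`. -/
def vinvIdeal (I : Ideal (WittVector p S)) : Ideal (WittVector p S) where
  carrier := {ξ | ξ.coeff 0 ∈ 𝔞 ∧ vinv p γ ξ ∈ I}
  add_mem' {ξ η} hξ hη := by
    refine ⟨?_, ?_⟩
    · rw [add_coeff_zero]; exact 𝔞.add_mem hξ.1 hη.1
    · rw [vinv_add hξ.1 hη.1]; exact I.add_mem hξ.2 hη.2
  zero_mem' := by
    refine ⟨by simp, ?_⟩
    rw [vinv_zero]; exact I.zero_mem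
  smul_mem' c ξ hξ := by
    refine ⟨?_, ?_⟩
    · rw [smul_eq_mul, mul_coeff_zero]; exact 𝔞.mul_mem_left _ hξ.1
    · rw [smul_eq_mul, vinv_mul c hξ.1]; exact I.mul_mem_left _ hξ.2

theorem mem_vinvIdeal {I : Ideal (WittVector p S)} {ξ : WittVector p S} :
    ξ ∈ vinvIdeal γ I ↔ ξ.coeff 0 ∈ 𝔞 ∧ vinv p γ ξ ∈ I := Iff.rfl

/-- The Witt vectors over `𝔞` whose logarithmic coordinates vanish from the `k`-th on. -/
def logIdeal : ℕ → Ideal (WittVector p S)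
  | 0 => ⊥
  | k + 1 => vinvIdeal γ (logIdeal k)

/-- The Witt vectors whose first `k` entries lie in `𝔞`. -/
def coeffIdeal : ℕ → Ideal (WittVector p S)
  | 0 => ⊤
  | k + 1 => vinvIdeal γ (coeffIdeal k)

variable {γ}

theorem map_logWitt {R : Type u} [CommRing R] (φ : S →+* R) (h : 𝔞 ≤ RingHom.ker φ) {a : S}
    (ha : a ∈ 𝔞) : WittVector.map φ (logWitt p γ a) = 0 := by
  ext i
  rw [WittVector.map_coeff, logWitt_coeff, WittVector.zero_coeff]
  exact h (logVec_mem p γ ha i)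

theorem map_vinv {R : Type u} [CommRing R] (φ : S →+* R) (h : 𝔞 ≤ RingHom.ker φ)
    {ξ : WittVector p S} (hξ : ξ.coeff 0 ∈ 𝔞) :
    WittVector.verschiebung (WittVector.map φ (vinv p γ ξ)) = WittVector.map φ ξ := by
  rw [← WittVector.map_verschiebung, verschiebung_vinv, map_sub, map_logWitt φ h hξ, sub_zero]

/-- Logarithmic vectors have entries in 𝔞, so modulo 𝔞 the map σ̇ is the plain shift of entries. -/
theorem mem_coeffIdeal {k : ℕ} {ξ : WittVector p S} :
    ξ ∈ coeffIdeal γ k ↔ ∀ i < k, ξ.coeff i ∈ 𝔞 := by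
  induction k generalizing ξ with
  | zero => simp [coeffIdeal]
  | succ k ih =>
    rw [coeffIdeal, mem_vinvIdeal, ih]
    have key (h0 : ξ.coeff 0 ∈ 𝔞) (i : ℕ) : (vinv p γ ξ).coeff i ∈ 𝔞 ↔ ξ.coeff (i + 1) ∈ 𝔞 := by
      have h1 := congrArg (fun x => x.coeff (i + 1))
        (map_vinv (γ := γ) (Ideal.Quotient.mk 𝔞) (Ideal.mk_ker).ge h0)
      simp only [WittVector.verschiebung_coeff_add_one, WittVector.map_coeff] at h1
      rw [← Ideal.Quotient.eq_zero_iff_mem, h1, Ideal.Quotient.eq_zero_iff_mem]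
    constructor
    · rintro ⟨h0, h⟩ i hi
      rcases i with _ | i
      · exact h0
      · exact (key h0 i).1 (h i (by omega))
    · intro h
      have h0 := h 0 k.succ_pos
      exact ⟨h0, fun i hi => (key h0 i).2 (h (i + 1) (by omega))⟩

theorem map_eq_zero_of_mem_logIdeal {R : Type u} [CommRing R] (φ : S →+* R)
    (h : 𝔞 ≤ RingHom.ker φ) {k : ℕ} {ξ : WittVector p S} (hξ : ξ ∈ logIdeal γ k) :
    WittVector.map φ ξ = 0 := by
  induction k generalizing ξ with
  | zero => rw [(Ideal.mem_bot.1 hξ : ξ = 0), map_zero]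
  | succ k ih => rw [← map_vinv φ h hξ.1, ih hξ.2, map_zero]

theorem truncate_verschiebung_congr {k : ℕ} {ξ η : WittVector p S}
    (h : WittVector.truncate k ξ = WittVector.truncate k η) :
    WittVector.truncate (k + 1) (WittVector.verschiebung ξ) =
      WittVector.truncate (k + 1) (WittVector.verschiebung η) := by
  ext i
  rw [WittVector.coeff_truncate, WittVector.coeff_truncate]
  rcases i with ⟨_ | i, hi⟩
  · simp
  · have := congrArg (fun x => x.coeff ⟨i, by omega⟩) h
    simpa [WittVector.coeff_truncate] using this

/-- Rebuilding ξ from its logarithmic coordinates one at a time, those of index ≥ k only affect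
entries of index ≥ k and may be dropped. -/
theorem exists_mem_logIdeal {k : ℕ} {ξ : WittVector p S} (hξ : ξ ∈ coeffIdeal γ k) :
    ∃ ξ' ∈ logIdeal γ k, WittVector.truncate k ξ' = WittVector.truncate k ξ := by
  induction k generalizing ξ with
  | zero => exact ⟨0, Ideal.zero_mem _, by ext i; exact i.elim0⟩
  | succ k ih =>
    obtain ⟨η, hη, h⟩ := ih hξ.2
    have h0 : (logWitt p γ (ξ.coeff 0) + WittVector.verschiebung η).coeff 0 = ξ.coeff 0 := by
      rw [add_coeff_zero, logWitt_coeff, logVec_zero', WittVector.verschiebung_coeff_zero, add_zero]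
    refine ⟨logWitt p γ (ξ.coeff 0) + WittVector.verschiebung η, ⟨by rw [h0]; exact hξ.1, ?_⟩, ?_⟩
    · have : vinv p γ (logWitt p γ (ξ.coeff 0) + WittVector.verschiebung η) = η := by
        rw [vinv_eq_iff, h0]; ring
      rwa [this]
    · conv_rhs => rw [eq_logWitt_add (γ := γ) ξ]
      rw [map_add, map_add, truncate_verschiebung_congr h]

variable (γ) in
/-- The logarithmic coordinates of a Witt vector. -/
def glog (i : ℕ) (ξ : WittVector p S) : S := ((vinv p γ)^[i] ξ).coeff 0

theorem glog_succ (i : ℕ) (ξ : WittVector p S) : glog γ (i + 1) ξ = glog γ i (vinv p γ ξ) := rfl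

theorem glog_mem {i : ℕ} {ξ : WittVector p S} (hξ : ξ ∈ coeffIdeal γ (i + 1)) :
    glog γ i ξ ∈ 𝔞 := by
  induction i generalizing ξ with
  | zero => exact hξ.1
  | succ i ih => exact ih hξ.2

theorem glog_add {i : ℕ} {ξ η : WittVector p S} (hξ : ξ ∈ coeffIdeal γ (i + 1))
    (hη : η ∈ coeffIdeal γ (i + 1)) : glog γ i (ξ + η) = glog γ i ξ + glog γ i η := by
  induction i generalizing ξ η with
  | zero => exact add_coeff_zero ξ η
  | succ i ih => rw [glog_succ, vinv_add hξ.1 hη.1, ih hξ.2 hη.2]; rfl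

/-- Each application of σ̇ twists the scalar by the Frobenius, and the Frobenius shifts ghost
components. -/
theorem glog_mul {i : ℕ} (c : WittVector p S) {ξ : WittVector p S}
    (hξ : ξ ∈ coeffIdeal γ (i + 1)) :
    glog γ i (c * ξ) = WittVector.ghostComponent i c * glog γ i ξ := by
  induction i generalizing c ξ with
  | zero =>
    have : WittVector.ghostComponent 0 c = c.coeff 0 := by simp [ghostComponent_eq_sum]
    rw [this]; exact mul_coeff_zero c ξ
  | succ i ih =>
    rw [glog_succ, vinv_mul c hξ.1, ih _ hξ.2, WittVector.ghostComponent_frobenius]; rfl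

theorem glog_frobenius {i : ℕ} {ξ : WittVector p S} (hξ : ξ ∈ coeffIdeal γ (i + 2)) :
    glog γ i (WittVector.frobenius ξ) = p * glog γ (i + 1) ξ := by
  rw [frobenius_eq_vinv hξ.1, glog_mul _ hξ.2, map_natCast, glog_succ]

theorem glog_of_coeff_eq_zero {i : ℕ} {ξ : WittVector p S} (hξ : ∀ j ≤ i, ξ.coeff j = 0) :
    glog γ i ξ = 0 := by
  induction i generalizing ξ with
  | zero => exact hξ 0 le_rfl
  | succ i ih =>
    rw [glog_succ]
    refine ih fun j hj => ?_
    rw [← WittVector.verschiebung_coeff_add_one, verschiebung_vinv, hξ 0 (Nat.zero_le _),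
      logWitt_zero, sub_zero]
    exact hξ _ (by omega)

/-- Additivity reduces this to a difference whose first entries vanish. It makes the coordinates of
index below n meaningful on W_n. -/
theorem glog_congr {n i : ℕ} (hi : i < n) {ξ η : WittVector p S} (hξ : ξ ∈ coeffIdeal γ (i + 1))
    (h : WittVector.truncate n ξ = WittVector.truncate n η) : glog γ i ξ = glog γ i η := by
  have h0 (j : ℕ) (hj : j ≤ i) : (η - ξ).coeff j = 0 := by
    have h1 : WittVector.truncate n (η - ξ) = 0 := by rw [map_sub, h, sub_self]
    have := (WittVector.mem_ker_truncate n (η - ξ)).1 h1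
    exact this j (by omega)
  have h2 : η - ξ ∈ coeffIdeal γ (i + 1) :=
    mem_coeffIdeal.2 fun j hj => by rw [h0 j (by omega)]; exact 𝔞.zero_mem
  have h3 := glog_add hξ h2
  rw [glog_of_coeff_eq_zero h0, add_zero, add_sub_cancel] at h3
  exact h3.symm

end LogFiltration

/-! ### The operators on truncated Witt vectors -/

section Truncated

variable {p : ℕ} [Fact p.Prime] {n : ℕ} {S : Type u} [CommRing S] {𝔞 : Ideal S}
  {γ : DividedPowers 𝔞}

theorem truncate_zeroth [NeZero n] (ξ : WittVector p S) :
    W.zeroth p n S (WittVector.truncate n ξ) = ξ.coeff 0 := W.zeroth_truncate p n S ξ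

theorem truncate_res (ξ : WittVector p S) :
    W.res p n S (WittVector.truncate (n + 1) ξ) = WittVector.truncate n ξ := by
  rw [W.res, TruncatedWittVector.truncate_wittVector_truncate]

theorem exists_truncate (y : W p n S) : ∃ ξ, WittVector.truncate n ξ = y :=
  WittVector.truncate_surjective p n S y

theorem W.map_surjective {R : Type u} [CommRing R] {φ : S →+* R} (h : Function.Surjective φ) :
    Function.Surjective (W.map p n φ) := by
  intro y
  obtain ⟨η, rfl⟩ := exists_truncate y
  obtain ⟨ξ, rfl⟩ := WittVector.map_surjective φ h η
  exact ⟨_, W.map_truncate p n φ ξ⟩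

/-- This is the bridge through which all properties of σ̇ on 𝒥_{n+1} follow from those of `vinv` on
untruncated Witt vectors. -/
theorem sigmaDot_truncate (ξ : WittVector p S) (h : WittVector.truncate (n + 1) ξ ∈ J p n 𝔞) :
    sigmaDot p n γ ⟨_, h⟩ = WittVector.truncate n (vinv p γ ξ) := by
  ext i
  rw [sigmaDot, TruncatedWittVector.coeff_mk, WittVector.coeff_truncate]
  change (WittVector.truncate (n + 1) ξ - WittVector.truncate (n + 1)
    (logWitt p γ (W.zeroth p (n + 1) S (WittVector.truncate (n + 1) ξ)))).coeff _ = _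
  rw [truncate_zeroth, ← map_sub, WittVector.coeff_truncate, ← verschiebung_vinv]
  exact WittVector.verschiebung_coeff_succ _ _

theorem truncate_mem_J (ξ : WittVector p S) :
    WittVector.truncate (n + 1) ξ ∈ J p n 𝔞 ↔ ξ.coeff 0 ∈ 𝔞 := by
  rw [mem_J, truncate_zeroth]

theorem sigmaDot_add (j k : J p n 𝔞) :
    sigmaDot p n γ (j + k) = sigmaDot p n γ j + sigmaDot p n γ k := by
  obtain ⟨j, hj⟩ := j
  obtain ⟨k, hk⟩ := k
  obtain ⟨ξ, rfl⟩ := exists_truncate j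
  obtain ⟨η, rfl⟩ := exists_truncate k
  have h : WittVector.truncate (n + 1) (ξ + η) ∈ J p n 𝔞 := by
    rw [map_add]; exact (J p n 𝔞).add_mem hj hk
  have h2 : (⟨_, hj⟩ + ⟨_, hk⟩ : J p n 𝔞) = ⟨_, h⟩ := Subtype.ext (map_add _ ξ η).symm
  rw [h2, sigmaDot_truncate, sigmaDot_truncate, sigmaDot_truncate,
    vinv_add ((truncate_mem_J ξ).1 hj) ((truncate_mem_J η).1 hk), map_add]

theorem sigmaDot_smul (c : W p (n + 1) S) (j : J p n 𝔞) :
    sigmaDot p n γ (c • j) = W.frob p n S c * sigmaDot p n γ j := by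
  obtain ⟨j, hj⟩ := j
  obtain ⟨ξ, rfl⟩ := exists_truncate j
  obtain ⟨c, rfl⟩ := exists_truncate c
  have h : WittVector.truncate (n + 1) (c * ξ) ∈ J p n 𝔞 := by
    rw [map_mul]; exact (J p n 𝔞).mul_mem_left _ hj
  have h2 : (WittVector.truncate (n + 1) c • ⟨_, hj⟩ : J p n 𝔞) = ⟨_, h⟩ :=
    Subtype.ext (map_mul _ c ξ).symm
  rw [h2, sigmaDot_truncate, sigmaDot_truncate, W.frob_truncate,
    vinv_mul c ((truncate_mem_J ξ).1 hj), map_mul]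

theorem natCast_mul_sigmaDot (j : J p n 𝔞) :
    (p : W p n S) * sigmaDot p n γ j = W.frob p n S j := by
  obtain ⟨j, hj⟩ := j
  obtain ⟨ξ, rfl⟩ := exists_truncate j
  rw [sigmaDot_truncate, W.frob_truncate, frobenius_eq_vinv ((truncate_mem_J ξ).1 hj), map_mul,
    map_natCast]

variable (n 𝔞) in
/-- The element `V(1)` of `𝒥_{n+1}`. -/
def verOne : J p n 𝔞 := ⟨WittVector.truncate (n + 1) (WittVector.verschiebung 1), by
  rw [truncate_mem_J, WittVector.verschiebung_coeff_zero]; exact 𝔞.zero_mem⟩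

theorem sigmaDot_verOne : sigmaDot p n γ (verOne n 𝔞) = 1 := by
  rw [verOne, sigmaDot_truncate, vinv_verschiebung, map_one]

/-- An element of 𝒥_{n+1} is the sum of the logarithmic vector of its zeroth entry and V of its
image under σ̇. -/
theorem eq_zero_of_sigmaDot {j : J p n 𝔞} (h0 : W.zeroth p (n + 1) S j = 0)
    (h : sigmaDot p n γ j = 0) : j = 0 := by
  obtain ⟨j, hj⟩ := j
  obtain ⟨ξ, rfl⟩ := exists_truncate j
  rw [truncate_zeroth] at h0
  rw [sigmaDot_truncate] at h
  apply Subtype.ext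
  change WittVector.truncate (n + 1) ξ = 0
  rw [eq_logWitt_add (γ := γ) ξ, h0, logWitt_zero, zero_add,
    truncate_verschiebung_congr (η := 0) (by rw [h, map_zero]), map_zero, map_zero]

theorem zeroth_eq_zero_of_of_eq_zero [NeZero n] {x : W p (n + 1) S} (h : CalW.of p n S x = 0) :
    W.zeroth p (n + 1) S x = 0 := by
  have h2 : W.res p n S x = 0 := congrArg (CalW.res p n S) h
  obtain ⟨ξ, rfl⟩ := exists_truncate x
  rw [truncate_res] at h2
  rw [truncate_zeroth, ← truncate_zeroth (n := n), h2, map_zero]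

theorem algebraMap_of [NeZero n] (x : W p (n + 1) S) :
    algebraMap (CalW p n S) S (CalW.of p n S x) = W.zeroth p (n + 1) S x := by
  obtain ⟨ξ, rfl⟩ := exists_truncate x
  change W.zeroth p n S (W.res p n S _) = _
  rw [truncate_res, truncate_zeroth, truncate_zeroth]

theorem CalW.of_surjective : Function.Surjective (CalW.of p n S) :=
  RingHom.rangeRestrict_surjective _

theorem CalW.res_of (x : W p (n + 1) S) : CalW.res p n S (CalW.of p n S x) = W.res p n S x := rfl

theorem CalW.frob_of (x : W p (n + 1) S) : CalW.frob p n S (CalW.of p n S x) = W.frob p n S x := rfl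

theorem CalW.ext' {x y : CalW p n S} (h : CalW.res p n S x = CalW.res p n S y)
    (h' : CalW.frob p n S x = CalW.frob p n S y) : x = y :=
  Subtype.ext (Prod.ext h h')

theorem CalW.map_of {R : Type u} [CommRing R] (φ : S →+* R) (x : W p (n + 1) S) :
    CalW.map p n φ (CalW.of p n S x) = CalW.of p n R (W.map p (n + 1) φ x) :=
  CalW.ext' (W.map_res p n φ x) (W.map_frob p n φ x)

theorem CalW.frob_map {R : Type u} [CommRing R] (φ : S →+* R) (x : CalW p n S) :
    CalW.frob p n R (CalW.map p n φ x) = W.map p n φ (CalW.frob p n S x) := rfl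

theorem CalW.map_surjective {R : Type u} [CommRing R] {φ : S →+* R} (h : Function.Surjective φ) :
    Function.Surjective (CalW.map p n φ) := by
  intro y
  obtain ⟨y, rfl⟩ := CalW.of_surjective y
  obtain ⟨x, rfl⟩ := W.map_surjective h y
  exact ⟨_, CalW.map_of φ x⟩

theorem W.map_id' (x : W p n S) : W.map p n (RingHom.id S) x = x := by
  obtain ⟨ξ, rfl⟩ := exists_truncate x
  rw [W.map_truncate]
  congr 1

theorem CalW.map_id' (x : CalW p n S) : CalW.map p n (RingHom.id S) x = x :=
  CalW.ext' (W.map_id' _) (W.map_id' _)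

theorem W.zeroth_surjective [NeZero n] : Function.Surjective (W.zeroth p n S) := fun s =>
  ⟨WittVector.truncate n (WittVector.teichmuller p s), by
    rw [truncate_zeroth, WittVector.teichmuller_coeff_zero]⟩

theorem CalW.algebraMap_surjective [NeZero n] :
    Function.Surjective (algebraMap (CalW p n S) S) := fun s => by
  obtain ⟨x, rfl⟩ := W.zeroth_surjective (p := p) (n := n + 1) s
  exact ⟨_, algebraMap_of x⟩

theorem mem_map_J [NeZero n] {x : CalW p n S} :
    x ∈ (J p n 𝔞).map (CalW.of p n S) ↔ algebraMap (CalW p n S) S x ∈ 𝔞 := by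
  rw [Ideal.mem_map_iff_of_surjective _ CalW.of_surjective]
  constructor
  · rintro ⟨y, hy, rfl⟩
    rw [algebraMap_of]; exact (mem_J p n 𝔞 y).1 hy
  · intro h
    obtain ⟨y, rfl⟩ := CalW.of_surjective x
    exact ⟨y, (mem_J p n 𝔞 y).2 (by rwa [← algebraMap_of]), rfl⟩

/-- Compatibility of a ring homomorphism with divided powers. -/
def DPCompat {S' : Type u} [CommRing S'] {𝔞' : Ideal S'} (γ : DividedPowers 𝔞)
    (γ' : DividedPowers 𝔞') (φ : S →+* S') : Prop :=
  ∀ a ∈ 𝔞, ∀ k ≠ 0, φ (γ k a) = γ' k (φ a)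

theorem DPCompat.bot {S' : Type u} [CommRing S'] {φ : S →+* S'} (h : 𝔞 ≤ (⊥ : Ideal S').comap φ) :
    DPCompat γ (dividedPowersBot S') φ := fun a ha k hk => by
  have h1 : φ a = 0 := h ha
  rw [h1, (dividedPowersBot S').dpow_eval_zero hk]
  exact h (γ.dpow_mem hk ha)

/-- This compatibility is what makes a display over S a source of morphisms to relative displays. -/
theorem DPCompat.of_bot {𝔟 : Ideal S} {δ : DividedPowers 𝔟} :
    DPCompat (dividedPowersBot S) δ (RingHom.id S) := fun a ha k hk => by
  rw [Ideal.mem_bot] at ha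
  subst ha
  rw [(dividedPowersBot S).dpow_eval_zero hk, map_zero, δ.dpow_eval_zero hk]

theorem DPCompat.id : DPCompat γ γ (RingHom.id S) := fun _ _ _ _ => rfl

/-- Compatibility with divided powers is needed because the subtracted logarithmic vector has
entries r_i γ_{p^i}(ξ_0). -/
theorem map_sigmaDot {S' : Type u} [CommRing S'] {𝔞' : Ideal S'} {γ' : DividedPowers 𝔞'}
    {φ : S →+* S'} (h : 𝔞 ≤ 𝔞'.comap φ) (hc : DPCompat γ γ' φ) (j : J p n 𝔞) :
    W.map p n φ (sigmaDot p n γ j) = sigmaDot p n γ' (J.map p n φ h j) := by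
  obtain ⟨j, hj⟩ := j
  obtain ⟨ξ, rfl⟩ := exists_truncate j
  have h0 := (truncate_mem_J ξ).1 hj
  have h1 : (WittVector.map φ ξ).coeff 0 ∈ 𝔞' := by rw [WittVector.map_coeff]; exact h h0
  have h2 : J.map p n φ h ⟨_, hj⟩ = ⟨_, (truncate_mem_J _).2 h1⟩ :=
    Subtype.ext (W.map_truncate p (n + 1) φ ξ)
  rw [h2, sigmaDot_truncate, sigmaDot_truncate, W.map_truncate]
  congr 1
  symm
  rw [vinv_eq_iff, ← WittVector.map_verschiebung, verschiebung_vinv, map_sub]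
  congr 1
  ext i
  have hi : p ^ i ≠ 0 := pow_ne_zero _ (Fact.out : p.Prime).ne_zero
  rw [WittVector.map_coeff, logWitt_coeff, logWitt_coeff, logVec_eq p γ h0, WittVector.map_coeff,
    logVec_eq p γ' (h h0), map_mul, hc _ h0 _ hi, map_intCast]

/-- Over the zero ideal every element is of the form V(η), and η can be lifted entrywise. -/
theorem J.map_surjective {R : Type u} [CommRing R] {φ : S →+* R} (hφ : Function.Surjective φ)
    (h : 𝔞 ≤ (⊥ : Ideal R).comap φ) : Function.Surjective (J.map p n φ h) := by
  rintro ⟨k, hk⟩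
  obtain ⟨η, rfl⟩ := exists_truncate k
  have h0 := (truncate_mem_J η).1 hk
  rw [Ideal.mem_bot] at h0
  obtain ⟨ξ, hξ⟩ := WittVector.map_surjective φ hφ (vinv p (dividedPowersBot R) η)
  have h1 : (WittVector.verschiebung ξ).coeff 0 ∈ 𝔞 := by
    rw [WittVector.verschiebung_coeff_zero]; exact 𝔞.zero_mem
  refine ⟨⟨_, (truncate_mem_J _).2 h1⟩, Subtype.ext ?_⟩
  change W.map p (n + 1) φ (WittVector.truncate (n + 1) _) = WittVector.truncate (n + 1) η
  rw [W.map_truncate, WittVector.map_verschiebung, hξ, verschiebung_vinv, h0, logWitt_zero,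
    sub_zero]

end Truncated

/-! ### Nilpotent elements of Witt rings -/

section Nilpotent

variable {p : ℕ} [Fact p.Prime] {n : ℕ} {S : Type u} [CommRing S]

/-- If p^N = 0 in S, then multiplication by p^N raises the V-adic filtration by at least one step.
-/
theorem isNilpotent_natCast_W (hp : IsNilpotent (p : S)) : IsNilpotent (p : W p n S) := by
  obtain ⟨N, hN⟩ := hp
  have key (k : ℕ) : ∃ ξ : WittVector p S,
      (p : WittVector p S) ^ (N * k) = WittVector.verschiebung^[k] ξ := by
    induction k with
    | zero => exact ⟨1, by simp⟩
    | succ k ih =>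
      obtain ⟨ξ, hξ⟩ := ih
      have h1 (η : WittVector p S) (c : ℕ) : (c : WittVector p S) * WittVector.verschiebung^[k] η =
          WittVector.verschiebung^[k] ((c : WittVector p S) * η) := by
        rw [← nsmul_eq_mul, ← nsmul_eq_mul]
        exact ((Function.Commute.iterate_left
          (fun x => map_nsmul WittVector.verschiebung c x) k) η).symm
      have h2 : (((p ^ N : ℕ) : WittVector p S) * ξ).coeff 0 = 0 := by
        rw [mul_coeff_zero]
        have : ((p ^ N : ℕ) : WittVector p S).coeff 0 = 0 := by
          rw [← WittVector.constantCoeff_apply, map_natCast]; push_cast; exact hN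
        rw [this, zero_mul]
      refine ⟨(((p ^ N : ℕ) : WittVector p S) * ξ).shift 1, ?_⟩
      rw [mul_add, mul_one, pow_add, hξ, mul_comm, ← Nat.cast_pow, h1,
        Function.iterate_succ_apply]
      congr 1
      exact WittVector.eq_iterate_verschiebung (n := 1) fun i hi => by rwa [Nat.lt_one_iff.1 hi]
  obtain ⟨ξ, hξ⟩ := key n
  refine ⟨N * n, ?_⟩
  have h3 : WittVector.truncate n (WittVector.verschiebung^[n] ξ) = 0 := by
    rw [← RingHom.mem_ker, WittVector.mem_ker_truncate]
    exact fun i hi => WittVector.iterate_verschiebung_coeff_eq_zero _ hi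
  rw [← hξ, map_pow, map_natCast] at h3
  exact h3

theorem isNilpotent_W [NeZero n] (hp : IsNilpotent (p : S)) {y : W p n S}
    (hy : IsNilpotent (W.zeroth p n S y)) : IsNilpotent y := by
  obtain ⟨k, hk⟩ := hy
  obtain ⟨N, hN⟩ := isNilpotent_natCast_W (n := n) hp
  rw [← map_pow] at hk
  obtain ⟨ξ, hξ⟩ := exists_truncate (y ^ k)
  rw [← hξ, truncate_zeroth] at hk
  have h1 : ξ = WittVector.verschiebung (ξ.shift 1) :=
    WittVector.eq_iterate_verschiebung (n := 1) fun i hi => by rwa [Nat.lt_one_iff.1 hi]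
  generalize ξ.shift 1 = η at h1
  -- From V(x)V(y) = pV(xy): powers of an element of VW are divisible by high powers of p, which is
  -- nilpotent in W_n.
  have h2 (m : ℕ) : ξ ^ (m + 1) = p ^ m * WittVector.verschiebung (η ^ (m + 1)) := by
    induction m with
    | zero => simpa using h1
    | succ m ih =>
      rw [pow_succ, ih, h1, mul_assoc, ← WittVector.verschiebung_mul_frobenius,
        WittVector.frobenius_verschiebung, pow_succ (p : WittVector p S), pow_succ η (m + 1),
        mul_assoc]
      congr 1
      rw [← mul_assoc, mul_comm _ (p : WittVector p S), ← nsmul_eq_mul, map_nsmul, nsmul_eq_mul]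
  refine ⟨k * (N + 1), ?_⟩
  rw [pow_mul, ← hξ, ← map_pow, h2, map_mul, map_pow, map_natCast, hN, zero_mul]

theorem frobenius_coeff_zero (ξ : WittVector p S) :
    (WittVector.frobenius ξ).coeff 0 = ξ.coeff 0 ^ p + p * ξ.coeff 1 := by
  have := WittVector.ghostComponent_frobenius 0 ξ
  simpa [ghostComponent_eq_sum, Finset.sum_range_succ] using this

/-- Both components of x must be nilpotent. The Frobenius component has zeroth entry ξ_0^p + pξ_1.
-/
theorem isNilpotent_CalW [NeZero n] (hp : IsNilpotent (p : S)) {x : CalW p n S}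
    (hx : IsNilpotent (algebraMap (CalW p n S) S x)) : IsNilpotent x := by
  have h1 : IsNilpotent (CalW.res p n S x) := isNilpotent_W hp hx
  have h2 : IsNilpotent (CalW.frob p n S x) := by
    refine isNilpotent_W hp ?_
    obtain ⟨x, rfl⟩ := CalW.of_surjective x
    obtain ⟨ξ, rfl⟩ := exists_truncate x
    rw [algebraMap_of, truncate_zeroth] at hx
    rw [CalW.frob_of, W.frob_truncate, truncate_zeroth, frobenius_coeff_zero]
    exact (Commute.all _ _).isNilpotent_add
      (hx.pow_of_pos (Fact.out : p.Prime).ne_zero)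
      ((Commute.all _ _).isNilpotent_mul_right hp)
  obtain ⟨a, ha⟩ := h1
  obtain ⟨b, hb⟩ := h2
  refine ⟨a + b, CalW.ext' ?_ ?_⟩
  · rw [map_pow, pow_add, ha, zero_mul, map_zero]
  · rw [map_pow, pow_add, hb, mul_zero, map_zero]

/-- Because a^p = p! γ_p(a) is a multiple of p. -/
theorem DividedPowers.isNilpotent {𝔞 : Ideal S} (γ : DividedPowers 𝔞) (hp : IsNilpotent (p : S))
    {a : S} (ha : a ∈ 𝔞) : IsNilpotent a := by
  have h1 := γ.factorial_mul_dpow_eq_pow (n := p) ha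
  have h2 : IsNilpotent (a ^ p) := by
    rw [← h1, ← Nat.mul_factorial_pred (Fact.out : p.Prime).ne_zero]
    push_cast
    rw [mul_assoc]
    exact (Commute.all _ _).isNilpotent_mul_right hp
  obtain ⟨k, hk⟩ := h2
  exact ⟨p * k, by rw [pow_mul, hk]⟩

end Nilpotent

end Disp
end

noncomputable section

namespace Disp

/-! ### Lifting semilinear maps from projective modules -/

section Lifting

/-- Semilinear maps out of projective modules can be chosen subject to an additive semilinear
relation. -/
theorem exists_semilinear_of_rel {A B P M : Type*} [CommRing A] [CommRing B] (σ : A →+* B)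
    [AddCommGroup P] [Module A P] [Module.Projective A P] [AddCommGroup M] [Module B M]
    (r : P → M → Prop) (h0 : r 0 0) (hadd : ∀ x y m m', r x m → r y m' → r (x + y) (m + m'))
    (hsmul : ∀ a x m, r x m → r (a • x) (σ a • m)) (htot : ∀ x, ∃ m, r x m) :
    ∃ g : P →ₛₗ[σ] M, ∀ x, r x (g x) := by
  -- A section of the free cover on the set P: the map is prescribed by arbitrary choices on basis
  -- elements and restricted along the section.
  obtain ⟨s, hs⟩ := (Module.projective_def (R := A) (P := P)).1 inferInstance
  choose t ht using htot
  refine ⟨{ toFun := fun x => (s x).sum fun q a => σ a • t q, map_add' := fun x y => ?_,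
            map_smul' := fun c x => ?_ }, fun x => ?_⟩
  · rw [map_add, Finsupp.sum_add_index']
    · simp
    · intro q a b; rw [map_add, add_smul]
  · rw [map_smul, Finsupp.sum_smul_index' (by simp), Finsupp.smul_sum]
    exact Finsupp.sum_congr fun q _ => by rw [smul_eq_mul, map_mul, mul_smul]
  · have h1 : x = (s x).sum fun q a => a • q := (hs x).symm
    change r x ((s x).sum fun q a => σ a • t q)
    have h2 : ∀ f : P →₀ A, r (f.sum fun q a => a • q) (f.sum fun q a => σ a • t q) := by
      intro f
      induction f using Finsupp.induction_linear with
      | zero => simpa using h0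
      | add f g hf hg =>
        rw [Finsupp.sum_add_index' (by simp) (fun q a b => add_smul a b q),
          Finsupp.sum_add_index' (by simp) (fun q a b => by rw [map_add, add_smul])]
        exact hadd _ _ _ _ hf hg
      | single q a =>
        rw [Finsupp.sum_single_index (by simp), Finsupp.sum_single_index (by simp)]
        exact hsmul _ _ _ (ht q)
    have h3 := h2 (s x)
    rwa [← h1] at h3

theorem exists_dual_basis (A P : Type*) [CommRing A] [AddCommGroup P] [Module A P]
    [Module.Finite A P] [Module.Projective A P] :
    ∃ (r : ℕ) (x : Fin r → P) (φ : Fin r → P →ₗ[A] A), ∀ y, ∑ i, φ i y • x i = y := by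
  obtain ⟨r, f, hf⟩ := Module.Finite.exists_fin' A P
  obtain ⟨s, hs⟩ := Module.projective_lifting_property f LinearMap.id hf
  refine ⟨r, fun i => f (Pi.single i 1), fun i => (LinearMap.proj i).comp s, fun y => ?_⟩
  simp only [LinearMap.comp_apply, LinearMap.proj_apply, ← map_smul, ← map_sum]
  conv_rhs => rw [← LinearMap.id_apply (R := A) y, ← hs, LinearMap.comp_apply]
  congr 1
  ext j
  simp [Finset.sum_apply, Pi.single_apply]

end Lifting

/-! ### Finitely generated modules modulo nil ideals -/

section NilIdeals

variable {A P P' : Type*} [CommRing A] [AddCommGroup P] [Module A P] [AddCommGroup P']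
  [Module A P'] {I : Ideal A}

theorem eq_top_of_nil [Module.Finite A P] (hI : ∀ x ∈ I, IsNilpotent x) {N : Submodule A P}
    (h : ∀ x : P, ∃ y ∈ N, x - y ∈ (I • ⊤ : Submodule A P)) : N = ⊤ := by
  refine top_le_iff.1 (Submodule.le_of_le_smul_of_le_jacobson_bot (I := I) Module.Finite.fg_top
    ?_ ?_)
  · exact le_trans (b := nilradical A) (fun x hx => mem_nilradical.2 (hI x hx))
      Ideal.radical_le_jacobson
  · intro x _
    obtain ⟨y, hy, hxy⟩ := h x
    rw [← add_sub_cancel y x]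
    exact Submodule.add_mem_sup hy hxy

/-- By Cayley–Hamilton, g satisfies a monic equation with lower coefficients in I, so some power of
g is a nilpotent element of A[g]. The ideal I only has to be nil, not nilpotent. -/
theorem isNilpotent_end [Module.Finite A P] (hI : ∀ x ∈ I, IsNilpotent x) {g : Module.End A P}
    (hg : ∀ x, g x ∈ (I • ⊤ : Submodule A P)) : IsNilpotent g := by
  obtain ⟨q, hq, -, hqc, hq0⟩ :=
    LinearMap.exists_monic_and_natDegree_eq_and_coeff_mem_pow_and_aeval_eq_zero A g I
      (by rintro _ ⟨x, rfl⟩; exact hg x)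
  have h1 : IsNilpotent (q - Polynomial.X ^ q.natDegree) := by
    rw [Polynomial.isNilpotent_iff]
    intro i
    rw [Polynomial.coeff_sub, Polynomial.coeff_X_pow]
    rcases lt_trichotomy i q.natDegree with h | h | h
    · rw [if_neg h.ne, sub_zero]
      exact hI _ (Ideal.pow_le_self (by omega) (hqc i))
    · rw [if_pos h, h, Polynomial.Monic.coeff_natDegree hq, sub_self]
      exact IsNilpotent.zero
    · rw [if_neg h.ne', Polynomial.coeff_eq_zero_of_natDegree_lt h, sub_zero]
      exact IsNilpotent.zero
  have h2 := h1.map (Polynomial.aeval g)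
  rw [map_sub, hq0, zero_sub, map_pow, Polynomial.aeval_X, isNilpotent_neg_iff] at h2
  obtain ⟨k, hk⟩ := h2
  exact ⟨q.natDegree * k, by rw [pow_mul, hk]⟩

/-- Idempotent endomorphisms lift along nil ideals. -/
theorem exists_idempotent_end [Module.Finite A P] (hI : ∀ x ∈ I, IsNilpotent x)
    (e₀ : P →ₗ[A] P) (h : ∀ x, e₀ (e₀ x) - e₀ x ∈ (I • ⊤ : Submodule A P)) :
    ∃ e : P →ₗ[A] P, (∀ x, e (e x) = e x) ∧ ∀ x, e x - e₀ x ∈ (I • ⊤ : Submodule A P) := by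
  have hle (g : Module.End A P) :
      (I • ⊤ : Submodule A P) ≤ (I • ⊤ : Submodule A P).comap g := by
    rw [← Submodule.map_le_iff_le_comap, Submodule.map_smul'']
    exact Submodule.smul_mono le_rfl le_top
  let ρ : Module.End A P →+* Module.End A (P ⧸ (I • ⊤ : Submodule A P)) :=
    { toFun := fun g => Submodule.mapQ _ _ g (hle g)
      map_one' := by ext; rfl
      map_mul' := fun _ _ => by ext; rfl
      map_zero' := by ext; rfl
      map_add' := fun _ _ => by ext; rfl }
  have hρ (g : Module.End A P) (x : P) : ρ g (Submodule.Quotient.mk x) =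
      Submodule.Quotient.mk (g x) := rfl
  obtain ⟨e, he, hee⟩ := exists_isIdempotentElem_eq_of_ker_isNilpotent ρ (fun g hg =>
    isNilpotent_end hI fun x => by
      rw [← Submodule.Quotient.mk_eq_zero, ← hρ, (RingHom.mem_ker).1 hg]; rfl) (ρ e₀) ⟨_, rfl⟩ (by
      rw [IsIdempotentElem, ← map_mul]
      ext x
      exact (Submodule.Quotient.eq _).2 (h x))
  refine ⟨e, fun x => congrArg (fun g : Module.End A P => g x) he, fun x => ?_⟩
  rw [← Submodule.Quotient.eq, ← hρ, ← hρ, hee]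

/-- Surjectivity is Nakayama. A section s exists as P' is projective; then id - sg maps into ker g ⊆
IP, hence is nilpotent, but it is the identity on ker g. -/
theorem bijective_of_nil [Module.Finite A P] [Module.Finite A P'] [Module.Projective A P']
    (hI : ∀ x ∈ I, IsNilpotent x) (g : P →ₗ[A] P')
    (hsurj : ∀ y, ∃ x, y - g x ∈ (I • ⊤ : Submodule A P'))
    (hinj : ∀ x, g x = 0 → x ∈ (I • ⊤ : Submodule A P)) : Function.Bijective g := by
  have hs : Function.Surjective g := LinearMap.range_eq_top.1 (eq_top_of_nil hI fun y => by
    obtain ⟨x, hx⟩ := hsurj y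
    exact ⟨g x, ⟨x, rfl⟩, hx⟩)
  refine ⟨?_, hs⟩
  obtain ⟨s, hs⟩ := Module.projective_lifting_property g LinearMap.id hs
  have hgs (y : P') : g (s y) = y := congrArg (fun k : P' →ₗ[A] P' => k y) hs
  obtain ⟨k, hk⟩ := isNilpotent_end hI (g := LinearMap.id - s.comp g) fun x =>
    hinj _ (by simp [hgs])
  have h1 (k : ℕ) (x : P) (hx : g x = 0) : ((LinearMap.id - s.comp g : Module.End A P) ^ k) x = x := by
    induction k with
    | zero => rfl
    | succ k ih => rw [pow_succ', Module.End.mul_apply, ih]; simp [hx]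
  rw [injective_iff_map_eq_zero]
  intro x hx
  rw [← h1 k x hx, hk]; rfl

end NilIdeals

/-! ### Tensor products and semilinear descent -/

section Tensor

variable {A B C P M : Type u} [CommRing A] [CommRing B] [CommRing C] [Algebra A B]
  [AddCommGroup P] [Module A P] [AddCommGroup M] [Module C M]

/-- The map `b ⊗ x ↦ χ(b) G(x)`. -/
def semiLift (χ : B →+* C) (G : P →+ M)
    (hG : ∀ (a : A) x, G (a • x) = χ (algebraMap A B a) • G x) : (B ⊗[A] P) →ₛₗ[χ] M where
  __ := TensorProduct.liftAddHom
    (AddMonoidHom.mk' (fun b => AddMonoidHom.mk' (fun x => χ b • G x)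
        (fun x y => by rw [map_add, smul_add]))
      (fun b c => AddMonoidHom.ext fun x => by
        change χ (b + c) • G x = χ b • G x + χ c • G x
        rw [map_add, add_smul]))
    (fun r b x => by
      change χ (r • b) • G x = χ b • G (r • x)
      rw [hG, Algebra.smul_def, map_mul, mul_comm, mul_smul])
  map_smul' b z := by
    change TensorProduct.liftAddHom _ _ (b • z) = χ b • TensorProduct.liftAddHom _ _ z
    induction z with
    | zero => rw [smul_zero, map_zero, smul_zero]
    | add x y hx hy => rw [smul_add, map_add, hx, hy, map_add, smul_add]
    | tmul c x =>
      rw [TensorProduct.smul_tmul']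
      change χ (b • c) • G x = χ b • χ c • G x
      rw [smul_eq_mul, map_mul, mul_smul]

/-- The extension of a functional to the base change. -/
def dualExt (B : Type u) [CommRing B] [Algebra A B] (φ : P →ₗ[A] A) : (B ⊗[A] P) →ₗ[B] B :=
  semiLift (RingHom.id B) ((algebraMap A B).toAddMonoidHom.comp φ.toAddMonoidHom) fun a x => by
    simp

theorem dualExt_tmul (φ : P →ₗ[A] A) (b : B) (x : P) :
    dualExt B φ (b ⊗ₜ x) = b * algebraMap A B (φ x) := rfl

/-- A dual basis remains one after base change, so elements of B ⊗ P are detected by the functionals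
`dualExt B (φ i)`. -/
theorem semilinear_eq_of_dual_basis {r : ℕ} {x : Fin r → P} {φ : Fin r → P →ₗ[A] A}
    (h : ∀ y, ∑ i, φ i y • x i = y) (z : B ⊗[A] P) :
    ∑ i, dualExt B (φ i) z • ((1 : B) ⊗ₜ[A] x i) = z := by
  induction z with
  | zero => simp
  | add z w hz hw => simp only [map_add, add_smul, Finset.sum_add_distrib, hz, hw]
  | tmul b y =>
    conv_rhs => rw [← h y]
    rw [TensorProduct.tmul_sum]
    refine Finset.sum_congr rfl fun i _ => ?_
    rw [dualExt_tmul, TensorProduct.smul_tmul', smul_eq_mul, mul_one, TensorProduct.tmul_smul,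
      ← Algebra.commutes, ← Algebra.smul_def, TensorProduct.smul_tmul']

variable {A' B' P' : Type u} [CommRing A'] [CommRing B'] [Algebra A' B'] [AddCommGroup P']
  [Module A' P'] {ψ : A →+* A'} {χ : B →+* B'}
  {h : ∀ x, χ (algebraMap A B x) = algebraMap A' B' (ψ x)} {f : P →ₛₗ[ψ] P'}

theorem tensorMap_surjective (hχ : Function.Surjective χ) (hf : Function.Surjective f) :
    Function.Surjective (tensorMap χ h f) := by
  intro z
  induction z with
  | zero => exact ⟨0, map_zero _⟩
  | add x y hx hy =>
    obtain ⟨x, rfl⟩ := hx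
    obtain ⟨y, rfl⟩ := hy
    exact ⟨x + y, map_add _ _ _⟩
  | tmul b x =>
    obtain ⟨b, rfl⟩ := hχ b
    obtain ⟨x, rfl⟩ := hf x
    exact ⟨b ⊗ₜ x, rfl⟩

theorem tmul_mem_of_mem_smul (h : ∀ x, χ (algebraMap A B x) = algebraMap A' B' (ψ x)) {x : P}
    (hx : x ∈ (RingHom.ker ψ • ⊤ : Submodule A P)) (b : B) :
    b ⊗ₜ[A] x ∈ (RingHom.ker χ • ⊤ : Submodule B (B ⊗[A] P)) := by
  induction hx using Submodule.smul_induction_on' with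
  | smul a ha y _ =>
    rw [TensorProduct.tmul_smul, ← algebraMap_smul B a (b ⊗ₜ[A] y)]
    refine Submodule.smul_mem_smul ?_ Submodule.mem_top
    rw [RingHom.mem_ker, h, (RingHom.mem_ker).1 ha, map_zero]
  | add x _ y _ hx hy => rw [TensorProduct.tmul_add]; exact Submodule.add_mem _ hx hy

/-- Set-theoretic sections of χ and f give an additive map back from B' ⊗ P' to B ⊗ P modulo ker(χ);
changing representatives only matters inside that submodule. The composite is the projection. -/
theorem mem_smul_of_tensorMap_eq_zero (hψ : Function.Surjective ψ) (hχ : Function.Surjective χ) (hf : Function.Surjective f)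
    (hk : ∀ x, f x = 0 → x ∈ (RingHom.ker ψ • ⊤ : Submodule A P)) {z : B ⊗[A] P}
    (hz : tensorMap χ h f z = 0) : z ∈ (RingHom.ker χ • ⊤ : Submodule B (B ⊗[A] P)) := by
  let N : Submodule B (B ⊗[A] P) := RingHom.ker χ • ⊤
  have key (b b' : B) (x x' : P) (hb : χ b = χ b') (hx : f x = f x') :
      N.mkQ (b ⊗ₜ x) = N.mkQ (b' ⊗ₜ x') := by
    rw [Submodule.mkQ_apply, Submodule.mkQ_apply, Submodule.Quotient.eq]
    have h1 : b ⊗ₜ[A] x - b' ⊗ₜ[A] x' = (b - b') • ((1 : B) ⊗ₜ[A] x) + b' ⊗ₜ[A] (x - x') := by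
      rw [TensorProduct.smul_tmul', smul_eq_mul, mul_one, TensorProduct.sub_tmul,
        TensorProduct.tmul_sub]
      abel
    rw [h1]
    refine N.add_mem (Submodule.smul_mem_smul ?_ Submodule.mem_top) (tmul_mem_of_mem_smul h ?_ b')
    · rw [RingHom.mem_ker, map_sub, hb, sub_self]
    · exact hk _ (by rw [map_sub, hx, sub_self])
  let s := Function.surjInv hχ
  let t := Function.surjInv hf
  have hs (b) : χ (s b) = b := Function.surjInv_eq hχ b
  have ht (x) : f (t x) = x := Function.surjInv_eq hf x
  let g : (B' ⊗[A'] P') →+ (B ⊗[A] P) ⧸ N := TensorProduct.liftAddHom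
    (AddMonoidHom.mk' (fun b => AddMonoidHom.mk' (fun x => N.mkQ (s b ⊗ₜ t x))
      (fun x y => by
        rw [← map_add, ← TensorProduct.tmul_add]
        exact key _ _ _ _ rfl (by simp only [map_add, ht])))
      (fun b c => AddMonoidHom.ext fun x => by
        change N.mkQ (s (b + c) ⊗ₜ t x) = N.mkQ (s b ⊗ₜ t x) + N.mkQ (s c ⊗ₜ t x)
        rw [← map_add, ← TensorProduct.add_tmul]
        exact key _ _ _ _ (by simp only [map_add, hs]) rfl))
    (fun r b x => by
      change N.mkQ (s (r • b) ⊗ₜ t x) = N.mkQ (s b ⊗ₜ t (r • x))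
      rw [← ht x]
      generalize t x = x
      have h2 : f (t (r • f x)) = r • f x := ht _
      obtain ⟨a, rfl⟩ := hψ r
      rw [← map_smulₛₗ] at h2 ⊢
      rw [key (s b) (s b) _ (a • x) rfl (ht _), ← TensorProduct.smul_tmul]
      refine key _ _ _ _ ?_ (ht _)
      rw [hs, Algebra.smul_def, Algebra.smul_def, map_mul, h, hs])
  have hg (z : B ⊗[A] P) : g (tensorMap χ h f z) = N.mkQ z := by
    induction z with
    | zero => simp only [map_zero]
    | add x y hx hy => rw [map_add, map_add, hx, hy, map_add]
    | tmul b x => exact key _ _ _ _ (hs _) (ht _)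
  have h3 := hg z
  rw [hz, map_zero] at h3
  exact (Submodule.Quotient.mk_eq_zero N).1 h3.symm

theorem tensorMap_tensorMap {A'' B'' P'' : Type u} [CommRing A''] [CommRing B''] [Algebra A'' B'']
    [AddCommGroup P''] [Module A'' P''] {ψ' : A' →+* A''} {χ' : B' →+* B''}
    {h' : ∀ x, χ' (algebraMap A' B' x) = algebraMap A'' B'' (ψ' x)} {f' : P' →ₛₗ[ψ'] P''}
    {ψ'' : A →+* A''} {χ'' : B →+* B''}
    {h'' : ∀ x, χ'' (algebraMap A B x) = algebraMap A'' B'' (ψ'' x)} {f'' : P →ₛₗ[ψ''] P''}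
    (hχ : ∀ b, χ' (χ b) = χ'' b) (hf : ∀ x, f' (f x) = f'' x) (z : B ⊗[A] P) :
    tensorMap χ' h' f' (tensorMap χ h f z) = tensorMap χ'' h'' f'' z := by
  induction z with
  | zero => simp only [map_zero]
  | add x y hx hy => simp only [map_add, hx, hy]
  | tmul b x => rw [tensorMap_tmul, tensorMap_tmul, tensorMap_tmul, hχ, hf]

theorem tensorMap_congr {χ' : B →+* B'} {ψ' : A →+* A'} {f' : P →ₛₗ[ψ'] P'}
    {h' : ∀ x, χ' (algebraMap A B x) = algebraMap A' B' (ψ' x)}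
    (hχ : ∀ b, χ b = χ' b) (hf : ∀ x, f x = f' x) (z : B ⊗[A] P) :
    tensorMap χ h f z = tensorMap χ' h' f' z := by
  induction z with
  | zero => simp only [map_zero]
  | add x y hx hy => simp only [map_add, hx, hy]
  | tmul b x => rw [tensorMap_tmul, tensorMap_tmul, hχ, hf]

theorem tensorMap_id {χ : B →+* B} {ψ : A →+* A} {f : P →ₛₗ[ψ] P}
    {h : ∀ x, χ (algebraMap A B x) = algebraMap A B (ψ x)}
    (hχ : ∀ b, χ b = b) (hf : ∀ x, f x = x) (z : B ⊗[A] P) : tensorMap χ h f z = z := by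
  induction z with
  | zero => simp only [map_zero]
  | add x y hx hy => simp only [map_add, hx, hy]
  | tmul b x => rw [tensorMap_tmul, hχ, hf]

theorem one_tmul_eq_zero_iff (hs : Function.Surjective (algebraMap A B)) (x : P) :
    (1 : B) ⊗ₜ[A] x = 0 ↔ x ∈ (RingHom.ker (algebraMap A B) • ⊤ : Submodule A P) := by
  let e : (A ⧸ RingHom.ker (Algebra.ofId A B)) ≃ₐ[A] B :=
    Ideal.quotientKerAlgEquivOfSurjective (f := Algebra.ofId A B) hs
  have h1 := LinearMap.ker_tensorProductMk (R := A) (Q := P) (I := RingHom.ker (algebraMap A B))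
  rw [← h1, LinearMap.mem_ker, TensorProduct.mk_apply]
  have h2 : TensorProduct.congr e.toLinearEquiv (LinearEquiv.refl A P) ((1 : A ⧸ _) ⊗ₜ[A] x) =
      (1 : B) ⊗ₜ[A] x := by
    rw [TensorProduct.congr_tmul]; simp
  rw [← h2, LinearEquiv.map_eq_zero_iff]
  rfl

/-- A base change `B ⊗ M` which is a retract of `B ⊗ P` is finitely generated projective. -/
theorem projective_of_retract [Module.Finite A P] [Module.Projective A P] {M : Type u}
    [AddCommGroup M] [Module A M] (k : M →ₗ[A] (B ⊗[A] P)) (r : P →ₗ[A] M)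
    (h : ∀ m, r.baseChange B (k m) = 1 ⊗ₜ m) :
    Module.Finite B (B ⊗[A] M) ∧ Module.Projective B (B ⊗[A] M) := by
  let i : (B ⊗[A] M) →ₗ[B] (B ⊗[A] P) := semiLift (RingHom.id B) k.toAddMonoidHom fun a x => by
    change k (a • x) = _
    rw [map_smul]
    exact (algebraMap_smul B a _).symm
  have hi : (r.baseChange B).comp i = LinearMap.id := LinearMap.ext fun z => by
    induction z with
    | zero => simp
    | add x y hx hy => rw [map_add, hx, hy, map_add]
    | tmul b x =>
      change r.baseChange B (b • k x) = b ⊗ₜ x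
      rw [map_smul, h, TensorProduct.smul_tmul', smul_eq_mul, mul_one]
  exact ⟨Module.Finite.of_surjective (r.baseChange B)
    fun z => ⟨i z, congrArg (fun g : _ →ₗ[B] _ => g z) hi⟩, Module.Projective.of_split i _ hi⟩

/-- Quotients of a base change are projective if there is a suitable projection. -/
theorem projective_quotient_of_retract [Module.Finite A P] [Module.Projective A P]
    {N : Submodule A P} (e : P →ₗ[A] P) (h1 : ∀ x, x - e x ∈ N)
    (h2 : ∀ y ∈ N, (1 : B) ⊗ₜ[A] e y = 0) :
    Module.Finite B (B ⊗[A] (P ⧸ N)) ∧ Module.Projective B (B ⊗[A] (P ⧸ N)) := by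
  refine projective_of_retract (N.liftQ ((TensorProduct.mk A B P 1).comp e) fun y hy => h2 y hy)
    N.mkQ fun m => ?_
  obtain ⟨x, rfl⟩ := N.mkQ_surjective m
  change N.mkQ.baseChange B ((1 : B) ⊗ₜ e x) = 1 ⊗ₜ N.mkQ x
  rw [LinearMap.baseChange_tmul]
  congr 1
  exact ((Submodule.Quotient.eq N).2 (h1 x)).symm

/-- Semilinear maps descend along surjective base change maps. -/
theorem exists_descent (hψ : Function.Surjective ψ) (hf : Function.Surjective f)
    (hk : ∀ x, f x = 0 → x ∈ (RingHom.ker ψ • ⊤ : Submodule A P)) (τ : A' →+* C)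
    (g : P →ₛₗ[τ.comp ψ] M) : ∃ k : P' →ₛₗ[τ] M, ∀ x, k (f x) = g x := by
  have hg (x y : P) (hxy : f x = f y) : g x = g y := by
    rw [← sub_eq_zero, ← map_sub]
    have h1 := hk (x - y) (by rw [map_sub, hxy, sub_self])
    generalize x - y = z at h1
    induction h1 using Submodule.smul_induction_on' with
    | smul a ha z _ =>
      rw [g.map_smulₛₗ, RingHom.comp_apply, (RingHom.mem_ker).1 ha, map_zero, zero_smul]
    | add x _ y _ hx hy => rw [map_add, hx, hy, add_zero]
  let t := Function.surjInv hf
  have ht (x) : f (t x) = x := Function.surjInv_eq hf x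
  refine ⟨{ toFun := fun x => g (t x), map_add' := fun x y => ?_, map_smul' := fun a x => ?_ },
    fun x => hg _ _ (ht _)⟩
  · rw [← map_add]; exact hg _ _ (by simp only [map_add, ht])
  · obtain ⟨a, rfl⟩ := hψ a
    rw [← RingHom.comp_apply, ← g.map_smulₛₗ]
    exact hg _ _ (by rw [ht, f.map_smulₛₗ, ht])

end Tensor

/-! ### Universality of a generating Frobenius-linear map -/

section Twist

variable {A B : Type u} [CommRing A] [CommRing B]

/-- The ring `B`, regarded as an `A`-algebra via `σ`. -/
def Twist (_ : A →+* B) : Type u := B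

instance (σ : A →+* B) : CommRing (Twist σ) := inferInstanceAs (CommRing B)

instance (σ : A →+* B) : Algebra A (Twist σ) := σ.toAlgebra

/-- A semilinear map `Ψ : P → B ⊗ P` with generating image is universal among semilinear maps
from `P` to `B`-modules, if the two homomorphisms `A → B` agree on spectra. -/
theorem exists_factor_of_span_eq_top [Algebra A B] {σ : A →+* B}
    (hσ : ∀ q : PrimeSpectrum B, q.comap σ = q.comap (algebraMap A B))
    {P : Type u} [AddCommGroup P] [Module A P] [Module.Finite A P] [Module.Projective A P]
    (Ψ : P →ₛₗ[σ] (B ⊗[A] P)) (hΨ : Submodule.span B (Set.range Ψ) = ⊤)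
    {M : Type u} [AddCommGroup M] [Module B M] (G : P →ₛₗ[σ] M) :
    ∃ g : (B ⊗[A] P) →ₗ[B] M, ∀ x, g (Ψ x) = G x := by
  let _ : Module B (Twist σ ⊗[A] P) := inferInstanceAs (Module (Twist σ) (Twist σ ⊗[A] P))
  have : Module.Finite B (Twist σ ⊗[A] P) :=
    inferInstanceAs (Module.Finite (Twist σ) (Twist σ ⊗[A] P))
  have : Module.Projective B (Twist σ ⊗[A] P) :=
    inferInstanceAs (Module.Projective (Twist σ) (Twist σ ⊗[A] P))
  let L {M : Type u} [AddCommGroup M] [Module B M] (G : P →ₛₗ[σ] M) :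
      (Twist σ ⊗[A] P) →ₗ[B] M :=
    semiLift (A := A) (B := Twist σ) (C := B) (RingHom.id B) G.toAddMonoidHom
      fun a x => G.map_smulₛₗ a x
  have hL {M : Type u} [AddCommGroup M] [Module B M] (G : P →ₛₗ[σ] M) (x : P) :
      L G ((1 : Twist σ) ⊗ₜ x) = G x := one_smul B _
  have hsurj : Function.Surjective (L Ψ) := by
    rw [← LinearMap.range_eq_top, ← top_le_iff, ← hΨ, Submodule.span_le]
    rintro _ ⟨x, rfl⟩
    exact ⟨_, hL Ψ x⟩
  -- The linearization is a surjection of finitely generated projective modules. Their ranks agree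
  -- at every prime because the two ring homomorphisms induce the same map on spectra.
  have hbij : Function.Bijective (L Ψ) := by
    refine Module.bijective_of_surjective_of_rankAtStalk_eq hsurj fun m _ => ?_
    rw [Module.rankAtStalk_baseChange, ← hσ]
    exact Module.rankAtStalk_baseChange (R := A) (S := Twist σ) (M := P) _
  let E := LinearEquiv.ofBijective (L Ψ) hbij
  refine ⟨(L G).comp E.symm.toLinearMap, fun x => ?_⟩
  rw [LinearMap.comp_apply, ← hL Ψ x]
  have : E.symm (L Ψ ((1 : Twist σ) ⊗ₜ x)) = (1 : Twist σ) ⊗ₜ x := E.symm_apply_apply _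
  exact (congrArg (L G) this).trans (hL G x)

end Twist

end Disp
end

noncomputable section

namespace Disp

/-! ### Normal decompositions of relative truncated displays -/

namespace RelDisplay

variable {p : ℕ} [Fact p.Prime] {n : ℕ} [NeZero n] {S : Type u} [CommRing S] {𝔞 : Ideal S}
  {γ : DividedPowers 𝔞} (X : RelDisplay p n 𝔞 γ)

instance : Module.Finite (CalW p n S) X.P := X.finite

instance : Module.Projective (CalW p n S) X.P := X.projective

variable {X}

/-- Evaluate Ḟ ∘ ε at V(1), where σ̇(V(1)) = 1 and F(V(1)) = p. -/
theorem F_iota (y : X.Q) : X.F (X.iota y) = (p : W p n S) • X.Fdot y := by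
  have h := X.Fdot_eps (verOne n 𝔞) (X.iota y)
  rw [sigmaDot_verOne, one_smul, X.eps_iota, X.Fdot.map_smulₛₗ, CalW.frob_of,
    ← natCast_mul_sigmaDot (γ := γ), sigmaDot_verOne, mul_one] at h
  exact h.symm

theorem smul_eps (c : W p (n + 1) S) (j : J p n 𝔞) (x : X.P) :
    X.eps j (CalW.of p n S c • x) = X.eps (c • j) x := by
  rw [map_smul, X.eps_smul]

theorem exists_eps_of_mem_smul {x : X.P}
    (hx : x ∈ ((J p n 𝔞).map (CalW.of p n S) • ⊤ : Submodule (CalW p n S) X.P)) :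
    ∃ y ∈ Submodule.span (CalW p n S) {y | ∃ j x, y = X.eps j x}, X.iota y = x := by
  induction hx using Submodule.smul_induction_on' with
  | smul a ha x _ =>
    obtain ⟨j, hj, rfl⟩ := (Ideal.mem_map_iff_of_surjective _ CalW.of_surjective).1 ha
    exact ⟨X.eps ⟨j, hj⟩ x, Submodule.subset_span ⟨_, _, rfl⟩, X.iota_eps _ _⟩
  | add x _ y _ hx hy =>
    obtain ⟨x', hx', rfl⟩ := hx
    obtain ⟨y', hy', rfl⟩ := hy
    exact ⟨x' + y', Submodule.add_mem _ hx' hy', map_add _ _ _⟩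

theorem smul_mem_range_iota {x : X.P}
    (hx : x ∈ ((J p n 𝔞).map (CalW.of p n S) • ⊤ : Submodule (CalW p n S) X.P)) :
    x ∈ LinearMap.range X.iota := by
  obtain ⟨y, -, rfl⟩ := exists_eps_of_mem_smul hx
  exact ⟨y, rfl⟩

variable (X) in
/-- A normal decomposition `P = L ⊕ T`, `Q = L ⊕ 𝒥 ⊗ T`, given by the projection `e` onto `T` and
the map `s : P → L → Q`. -/
structure NormalDec where
  e : X.P →ₗ[CalW p n S] X.P
  s : X.P →ₗ[CalW p n S] X.Q
  e_e : ∀ x, e (e x) = e x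
  iota_s : ∀ x, X.iota (s x) = x - e x
  s_e : ∀ x, s (e x) = 0
  e_iota : ∀ y, e (X.iota y) ∈ ((J p n 𝔞).map (CalW.of p n S) • ⊤ : Submodule (CalW p n S) X.P)
  sub_mem : ∀ y, y - s (X.iota y) ∈ Submodule.span (CalW p n S) {y | ∃ j x, y = X.eps j (e x)}

theorem isNilpotent_of_mem_map_J (γ : DividedPowers 𝔞) (hp : IsNilpotent (p : S)) :
    ∀ x ∈ (J p n 𝔞).map (CalW.of p n S), IsNilpotent x := fun _ hx =>
  isNilpotent_CalW hp (DividedPowers.isNilpotent γ hp (mem_map_J.1 hx))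

-- Splitting P/ι(Q), which is projective over S/𝔞, gives a projector modulo the nil ideal κ(𝒥), and
-- this lifts to an idempotent e. Its complement lies in ι(Q) and is lifted through ι by
-- projectivity of P. Injectivity of Q/im ε → P/κ(𝒥)P shows that nothing else is in Q.
variable (X) in
theorem exists_normalDec (hp : IsNilpotent (p : S)) : Nonempty X.NormalDec := by
  let A := CalW p n S
  let C := S ⧸ 𝔞
  let I := (J p n 𝔞).map (CalW.of p n S)
  have hker : RingHom.ker (algebraMap A C) = I := by
    ext x
    rw [RingHom.mem_ker, mem_map_J, ← Ideal.Quotient.eq_zero_iff_mem]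
    rfl
  have hs : Function.Surjective (algebraMap A C) := fun c => by
    obtain ⟨s, rfl⟩ := Ideal.Quotient.mk_surjective c
    obtain ⟨a, rfl⟩ := CalW.algebraMap_surjective (p := p) (n := n) s
    exact ⟨a, rfl⟩
  have hI := isNilpotent_of_mem_map_J (p := p) (n := n) γ hp
  let pr := (LinearMap.range X.iota).mkQ.baseChange C
  have hpr : Function.Surjective pr :=
    LinearMap.lTensor_surjective _ (Submodule.mkQ_surjective _)
  have := X.projective_coker_iota
  obtain ⟨σ, hσ⟩ := Module.projective_lifting_property pr LinearMap.id hpr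
  have hσ' (z) : pr (σ z) = z := congrArg (fun g : _ →ₗ[C] _ => g z) hσ
  have hmk := TensorProduct.mk_surjective A X.P C hs
  obtain ⟨e₀, he₀⟩ := exists_semilinear_of_rel (RingHom.id A) (P := X.P) (M := X.P)
    (fun x m => (1 : C) ⊗ₜ[A] m = σ (pr ((1 : C) ⊗ₜ[A] x))) (by simp)
    (fun x y m m' h h' => by simp only [TensorProduct.tmul_add, map_add, h, h'])
    (fun a x m h => by
      simp only [RingHom.id_apply, TensorProduct.tmul_smul, h]
      rw [← algebraMap_smul C a, ← algebraMap_smul C a ((1 : C) ⊗ₜ[A] x), map_smul, map_smul])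
    (fun x => hmk _)
  have hz (x : X.P) : (1 : C) ⊗ₜ[A] x = 0 ↔ x ∈ (I • ⊤ : Submodule A X.P) := by
    rw [one_tmul_eq_zero_iff hs, hker]
  obtain ⟨e, he, hee⟩ := exists_idempotent_end hI e₀ fun x => by
    rw [← hz, TensorProduct.tmul_sub, he₀, he₀, hσ', sub_self]
  have he1 (x : X.P) : (1 : C) ⊗ₜ[A] e x = σ (pr ((1 : C) ⊗ₜ[A] x)) := by
    rw [← he₀, ← sub_eq_zero, ← TensorProduct.tmul_sub, hz]; exact hee x
  have hrange (x : X.P) : x - e x ∈ LinearMap.range X.iota := by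
    have h1 : (1 : C) ⊗ₜ[A] (LinearMap.range X.iota).mkQ (x - e x) = 0 := by
      have : pr ((1 : C) ⊗ₜ[A] (x - e x)) = 0 := by
        rw [TensorProduct.tmul_sub, he1, map_sub, hσ', sub_self]
      exact this
    rw [one_tmul_eq_zero_iff hs, hker] at h1
    -- By `iota_eps` the ideal κ(𝒥) annihilates P/ι(Q), so vanishing after tensoring with S/𝔞 means
    -- lying in ι(Q).
    have h2 : (I • ⊤ : Submodule A (X.P ⧸ LinearMap.range X.iota)) = ⊥ := by
      rw [eq_bot_iff, Submodule.smul_le]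
      intro a ha q _
      obtain ⟨x, rfl⟩ := Submodule.mkQ_surjective _ q
      rw [← map_smul, Submodule.mem_bot, Submodule.mkQ_apply, Submodule.Quotient.mk_eq_zero]
      exact smul_mem_range_iota (Submodule.smul_mem_smul ha Submodule.mem_top)
    rw [h2, Submodule.mem_bot] at h1
    exact (Submodule.Quotient.mk_eq_zero _).1 h1
  have heι (y : X.Q) : e (X.iota y) ∈ (I • ⊤ : Submodule A X.P) := by
    rw [← hz, he1]
    have : pr ((1 : C) ⊗ₜ[A] X.iota y) = 0 := by
      rw [LinearMap.baseChange_tmul, Submodule.mkQ_apply,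
        (Submodule.Quotient.mk_eq_zero _).2 (LinearMap.mem_range_self X.iota y), TensorProduct.tmul_zero]
    rw [this, map_zero]
  obtain ⟨s₀, hs₀⟩ := exists_semilinear_of_rel (RingHom.id A) (P := X.P) (M := X.Q)
    (fun x q => X.iota q = x - e x) (by simp)
    (fun x y m m' h h' => by simp only [map_add, h, h']; abel)
    (fun a x m h => by simp only [RingHom.id_apply, map_smul, h, smul_sub])
    (fun x => hrange x)
  -- The correction by `s₀ ∘ e` makes s vanish on T.
  let s : X.P →ₗ[A] X.Q := s₀ - s₀.comp e
  have hιs (x : X.P) : X.iota (s x) = x - e x := by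
    simp [s, hs₀, he]
  have hse (x : X.P) : s (e x) = 0 := by simp [s, he]
  refine ⟨⟨e, s, he, hιs, hse, heι, fun y => ?_⟩⟩
  -- On the L-part, ε(j ⊗ ι(s x)) is a multiple of s(x); subtracting it leaves only 𝒥T.
  have key (w) (hw : w ∈ Submodule.span A {y | ∃ j x, y = X.eps j x}) :
      w - s (X.iota w) ∈ Submodule.span A {y | ∃ j x, y = X.eps j (e x)} := by
    induction hw using Submodule.span_induction with
    | mem w hw =>
      obtain ⟨j, x, rfl⟩ := hw
      refine Submodule.subset_span ⟨j, x, ?_⟩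
      rw [X.iota_eps, map_smul, ← X.eps_iota, hιs, map_sub]
      abel
    | zero => simp
    | add x y _ _ hx hy =>
      rw [map_add, map_add, add_sub_add_comm]; exact Submodule.add_mem _ hx hy
    | smul a y _ hy => rw [map_smul, map_smul, ← smul_sub]; exact Submodule.smul_mem _ _ hy
  have h1 : X.iota (y - s (X.iota y)) = e (X.iota y) := by rw [map_sub, hιs]; abel
  have h2 := key _ (X.hodge_injective (y - s (X.iota y)) (by rw [h1]; exact heι y))
  rwa [h1, hse, sub_zero] at h2

namespace NormalDec

variable (D : X.NormalDec)

/-- The Frobenius-linear map `Ψ = Ḟ|_L ⊕ F|_T`. -/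
def psi : X.P →ₛₗ[CalW.frob p n S] (W p n S ⊗[CalW p n S] X.P) :=
  X.Fdot.comp D.s + X.F.comp D.e

theorem psi_apply (x : X.P) : D.psi x = X.Fdot (D.s x) + X.F (D.e x) := rfl

theorem s_sub (x : X.P) : D.s (x - D.e x) = D.s x := by rw [map_sub, D.s_e, sub_zero]

theorem psi_e (x : X.P) : D.psi (D.e x) = X.F (D.e x) := by
  rw [psi_apply, D.s_e, map_zero, zero_add, D.e_e]

theorem psi_sub (x : X.P) : D.psi (x - D.e x) = X.Fdot (D.s x) := by
  rw [psi_apply, s_sub, map_sub, D.e_e, sub_self, map_zero, add_zero]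

/-- Ḟ(Q) generates by axiom, and on 𝒥T one has Ḟ(ε(j ⊗ x)) = σ̇(j)F(x), a multiple of a value of Ψ.
-/
theorem span_psi : Submodule.span (W p n S) (Set.range D.psi) = ⊤ := by
  rw [eq_top_iff, ← X.span_Fdot, Submodule.span_le]
  rintro _ ⟨y, rfl⟩
  have h1 : X.Fdot y = D.psi (X.iota y - D.e (X.iota y)) + X.Fdot (y - D.s (X.iota y)) := by
    rw [psi_sub, ← map_add]; congr 1; abel
  rw [h1]
  refine Submodule.add_mem _ (Submodule.subset_span ⟨_, rfl⟩) ?_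
  have h2 := D.sub_mem y
  generalize y - D.s (X.iota y) = z at h2
  induction h2 using Submodule.span_induction with
  | mem z hz =>
    obtain ⟨j, x, rfl⟩ := hz
    rw [X.Fdot_eps, ← psi_e]
    exact Submodule.smul_mem _ _ (Submodule.subset_span ⟨_, rfl⟩)
  | zero => rw [map_zero]; exact Submodule.zero_mem _
  | add x y _ _ hx hy => rw [map_add]; exact Submodule.add_mem _ hx hy
  | smul a y _ hy => rw [X.Fdot.map_smulₛₗ]; exact Submodule.smul_mem _ _ hy

/-- F(x) and Res(x)^p differ by a nilpotent element, because the zeroth entry of their difference is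
a multiple of p. -/
theorem comap_frob_eq (hp : IsNilpotent (p : S)) (q : PrimeSpectrum (W p n S)) :
    q.comap (CalW.frob p n S) = q.comap (algebraMap (CalW p n S) (W p n S)) := by
  apply PrimeSpectrum.ext
  ext x
  change CalW.frob p n S x ∈ q.asIdeal ↔ CalW.res p n S x ∈ q.asIdeal
  have h1 : CalW.frob p n S x - CalW.res p n S x ^ p ∈ q.asIdeal := by
    refine nilpotent_iff_mem_prime.1 (isNilpotent_W hp ?_) q.asIdeal q.isPrime
    obtain ⟨x, rfl⟩ := CalW.of_surjective x
    obtain ⟨ξ, rfl⟩ := exists_truncate x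
    rw [CalW.frob_of, CalW.res_of, W.frob_truncate, truncate_res, map_sub, map_pow, truncate_zeroth,
      truncate_zeroth, frobenius_coeff_zero, add_sub_cancel_left]
    exact (Commute.all _ _).isNilpotent_mul_right hp
  rw [← Ideal.IsPrime.pow_mem_iff_mem q.isPrime (r := CalW.res p n S x) p
    (Fact.out : p.Prime).pos]
  exact ⟨fun h => by simpa using q.asIdeal.sub_mem h h1,
    fun h => by simpa using q.asIdeal.add_mem h1 h⟩

theorem exists_factor (hp : IsNilpotent (p : S)) {M : Type u} [AddCommGroup M]
    [Module (W p n S) M] (G : X.P →ₛₗ[CalW.frob p n S] M) :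
    ∃ g : (W p n S ⊗[CalW p n S] X.P) →ₗ[W p n S] M, ∀ x, g (D.psi x) = G x :=
  exists_factor_of_span_eq_top (comap_frob_eq hp) D.psi D.span_psi G

/-- Coordinates of the 𝒥T-part of y. Their images in 𝒲_n(S) are read off from ι(y). The last clause
recovers σ̇ of each coordinate from Ḟ, through any functional g compatible with Ψ, and so determines
the part that ι does not see. -/
theorem exists_expansion {r : ℕ} {x : Fin r → X.P} {φ : Fin r → X.P →ₗ[CalW p n S] CalW p n S}
    (h : ∀ y, ∑ i, φ i y • x i = y) (y : X.Q) :
    ∃ ξ : Fin r → J p n 𝔞, y = D.s (X.iota y) + ∑ i, X.eps (ξ i) (x i) ∧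
      (∀ i, CalW.of p n S (ξ i) = φ i (D.e (X.iota y))) ∧
      ∀ i (g : (W p n S ⊗[CalW p n S] X.P) →ₗ[W p n S] W p n S),
        (∀ x, g (D.psi x) = CalW.frob p n S (φ i x)) →
        sigmaDot p n γ (ξ i) = g (X.Fdot (y - D.s (X.iota y))) := by
  suffices H : ∀ z ∈ Submodule.span (CalW p n S) {y | ∃ j x, y = X.eps j (D.e x)},
      ∃ ξ : Fin r → J p n 𝔞, z = ∑ i, X.eps (ξ i) (x i) ∧
      (∀ i, CalW.of p n S (ξ i) = φ i (X.iota z)) ∧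
      ∀ i (g : (W p n S ⊗[CalW p n S] X.P) →ₗ[W p n S] W p n S),
        (∀ x, g (D.psi x) = CalW.frob p n S (φ i x)) →
        sigmaDot p n γ (ξ i) = g (X.Fdot z) by
    obtain ⟨ξ, h1, h2, h3⟩ := H _ (D.sub_mem y)
    refine ⟨ξ, by rw [← h1]; abel, fun i => ?_, h3⟩
    rw [h2, map_sub, D.iota_s]
    congr 1
    abel
  intro z hz
  induction hz using Submodule.span_induction with
  | mem z hz =>
    obtain ⟨j, w, rfl⟩ := hz
    choose c hc using fun i => CalW.of_surjective (φ i (D.e w))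
    -- The coefficients are lifted to W_{n+1}(S), which acts on 𝒥_{n+1} itself rather than on its
    -- image in 𝒲_n(S).
    refine ⟨fun i => c i • j, ?_, fun i => ?_, fun i g hg => ?_⟩
    · conv_lhs => rw [← h (D.e w), map_sum]
      refine Finset.sum_congr rfl fun i _ => ?_
      rw [← hc, smul_eps]
    · rw [X.iota_eps, map_smul, ← hc, smul_eq_mul, mul_comm, ← map_mul]; rfl
    · rw [sigmaDot_smul, X.Fdot_eps, map_smul, ← psi_e, hg, ← hc, CalW.frob_of, smul_eq_mul,
        mul_comm]
  | zero =>
    refine ⟨0, by simp, fun i => by simp, fun i g _ => ?_⟩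
    rw [map_zero, map_zero]
    have := sigmaDot_smul (γ := γ) (n := n) (p := p) 0 0
    rwa [map_zero, zero_mul, zero_smul] at this
  | add z w _ _ hz hw =>
    obtain ⟨ξ, h1, h2, h3⟩ := hz
    obtain ⟨ξ', h1', h2', h3'⟩ := hw
    refine ⟨ξ + ξ', ?_, fun i => ?_, fun i g hg => ?_⟩
    · simp only [Pi.add_apply, map_add, LinearMap.add_apply, Finset.sum_add_distrib, ← h1, ← h1']
    · rw [map_add, map_add, ← h2, ← h2', ← map_add]; rfl
    · rw [map_add, map_add, ← h3 i g hg, ← h3' i g hg, ← sigmaDot_add]; rfl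
  | smul a z _ hz =>
    obtain ⟨ξ, h1, h2, h3⟩ := hz
    obtain ⟨c, rfl⟩ := CalW.of_surjective a
    refine ⟨fun i => c • ξ i, ?_, fun i => ?_, fun i g hg => ?_⟩
    · conv_lhs => rw [h1, Finset.smul_sum]
      exact Finset.sum_congr rfl fun i _ => by rw [← smul_eps, map_smul]
    · rw [map_smul, map_smul, ← h2, smul_eq_mul, ← map_mul]; rfl
    · rw [sigmaDot_smul, X.Fdot.map_smulₛₗ, map_smul, ← h3 i g hg, CalW.frob_of, smul_eq_mul]

end NormalDec

/-- An element of `Q` is determined by its images under `ι` and `Ḟ`. -/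
theorem eq_zero_of_iota_Fdot (hp : IsNilpotent (p : S)) {y : X.Q} (h1 : X.iota y = 0)
    (h2 : X.Fdot y = 0) : y = 0 := by
  obtain ⟨D⟩ := X.exists_normalDec hp
  obtain ⟨r, x, φ, h⟩ := exists_dual_basis (CalW p n S) X.P
  obtain ⟨ξ, h3, h4, h5⟩ := D.exists_expansion h y
  rw [h1, map_zero, zero_add] at h3
  rw [h3]
  refine Finset.sum_eq_zero fun i _ => ?_
  -- Universality of Ψ supplies the functional that reads off σ̇(ξ_i); both it and the zeroth entry
  -- of ξ_i vanish, which forces ξ_i = 0.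
  obtain ⟨g, hg⟩ := D.exists_factor hp
    (M := W p n S) ((CalW.frob p n S).toSemilinearMap.comp (φ i))
  have h6 := h5 i g hg
  rw [h1, map_zero, sub_zero, h2, map_zero] at h6
  have h7 := h4 i
  rw [h1, map_zero, map_zero] at h7
  rw [eq_zero_of_sigmaDot (zeroth_eq_zero_of_of_eq_zero h7) h6, map_zero, LinearMap.zero_apply]

theorem Q_ext (hp : IsNilpotent (p : S)) {y y' : X.Q} (h1 : X.iota y = X.iota y')
    (h2 : X.Fdot y = X.Fdot y') : y = y' := by
  rw [← sub_eq_zero]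
  exact eq_zero_of_iota_Fdot hp (by rw [map_sub, h1, sub_self]) (by rw [map_sub, h2, sub_self])

/-- The kernel of `ι` is contained in `ε(I_{n+1}(S) ⊗ P)`. -/
theorem mem_span_of_iota_eq_zero (hp : IsNilpotent (p : S)) {y : X.Q} (h1 : X.iota y = 0) :
    y ∈ Submodule.span (CalW p n S)
      {y | ∃ (j : J p n 𝔞) (x : X.P), W.zeroth p (n + 1) S j = 0 ∧ y = X.eps j x} := by
  obtain ⟨D⟩ := X.exists_normalDec hp
  obtain ⟨r, x, φ, h⟩ := exists_dual_basis (CalW p n S) X.P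
  obtain ⟨ξ, h3, h4, h5⟩ := D.exists_expansion h y
  rw [h1, map_zero, zero_add] at h3
  rw [h3]
  refine Submodule.sum_mem _ fun i _ => Submodule.subset_span ⟨_, _, ?_, rfl⟩
  have h7 := h4 i
  rw [h1, map_zero, map_zero] at h7
  exact zeroth_eq_zero_of_of_eq_zero h7

end RelDisplay

end Disp
end

noncomputable section

namespace Disp

/-! ### Displays from modules of pairs (ι(y), Ḟ(y)) -/

section Construction

variable (p : ℕ) [Fact p.Prime] (n : ℕ) (S : Type u) [CommRing S]

/-- The module `W_n(S) ⊗ P` with `𝒲_n(S)` acting through the Frobenius. -/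
def FrobTwist (P : Type u) [AddCommGroup P] [Module (CalW p n S) P] : Type u :=
  W p n S ⊗[CalW p n S] P

variable (P : Type u) [AddCommGroup P] [Module (CalW p n S) P]

instance : AddCommGroup (FrobTwist p n S P) :=
  inferInstanceAs (AddCommGroup (W p n S ⊗[CalW p n S] P))

instance : Module (CalW p n S) (FrobTwist p n S P) :=
  Module.compHom (W p n S ⊗[CalW p n S] P) (CalW.frob p n S)

/-- The additive identification of the twist with `W_n(S) ⊗ P`. -/
def FrobTwist.val : FrobTwist p n S P ≃+ (W p n S ⊗[CalW p n S] P) := AddEquiv.refl _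

theorem FrobTwist.val_smul (a : CalW p n S) (z : FrobTwist p n S P) :
    FrobTwist.val p n S P (a • z) = CalW.frob p n S a • FrobTwist.val p n S P z := rfl

variable {p n S P} [NeZero n] {𝔞 : Ideal S} (γ : DividedPowers 𝔞)

/-- The element `ε(j ⊗ x)`, described by its images under `ι` and `Ḟ`. -/
def epsPair (F : P →ₛₗ[CalW.frob p n S] (W p n S ⊗[CalW p n S] P)) (j : J p n 𝔞) :
    P →ₗ[CalW p n S] P × FrobTwist p n S P where
  toFun x := (CalW.of p n S j • x, (FrobTwist.val p n S P).symm (sigmaDot p n γ j • F x))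
  map_add' x y := Prod.ext (smul_add _ _ _) (by
    change sigmaDot p n γ j • F (x + y) = sigmaDot p n γ j • F x + sigmaDot p n γ j • F y
    rw [map_add, smul_add])
  map_smul' a x := Prod.ext (smul_comm _ _ _) (by
    change sigmaDot p n γ j • F (a • x) = CalW.frob p n S a • sigmaDot p n γ j • F x
    rw [F.map_smulₛₗ, smul_comm])

variable {γ} {F : P →ₛₗ[CalW.frob p n S] (W p n S ⊗[CalW p n S] P)}

omit [NeZero n] in
theorem epsPair_fst (j : J p n 𝔞) (x : P) : (epsPair γ F j x).1 = CalW.of p n S j • x := rfl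

omit [NeZero n] in
theorem val_epsPair (j : J p n 𝔞) (x : P) :
    FrobTwist.val p n S P (epsPair γ F j x).2 = sigmaDot p n γ j • F x := rfl

omit [NeZero n] in
theorem pair_ext {y z : P × FrobTwist p n S P} (h1 : y.1 = z.1)
    (h2 : FrobTwist.val p n S P y.2 = FrobTwist.val p n S P z.2) : y = z :=
  Prod.ext h1 ((FrobTwist.val p n S P).injective h2)

omit [NeZero n] in
theorem epsPair_add (j k : J p n 𝔞) (x : P) :
    epsPair γ F (j + k) x = epsPair γ F j x + epsPair γ F k x := by
  refine pair_ext ?_ ?_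
  · rw [Prod.fst_add, epsPair_fst, epsPair_fst, epsPair_fst, ← add_smul, ← map_add]; rfl
  · rw [Prod.snd_add, map_add, val_epsPair, val_epsPair, val_epsPair, sigmaDot_add, add_smul]

omit [NeZero n] in
theorem epsPair_smul (c : W p (n + 1) S) (j : J p n 𝔞) (x : P) :
    epsPair γ F (c • j) x = CalW.of p n S c • epsPair γ F j x := by
  refine pair_ext ?_ ?_
  · rw [Prod.smul_fst, epsPair_fst, epsPair_fst, smul_smul, ← map_mul]; rfl
  · rw [Prod.smul_snd, FrobTwist.val_smul, val_epsPair, val_epsPair, sigmaDot_smul, CalW.frob_of,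
      mul_smul]

variable {Q : Submodule (CalW p n S) (P × FrobTwist p n S P)}

variable (Q) in
/-- The first projection. -/
def pairIota : Q →ₗ[CalW p n S] P := (LinearMap.fst _ _ _).comp Q.subtype

/-- The map `ε`. -/
def pairEps (heps : ∀ (j : J p n 𝔞) (x : P), epsPair γ F j x ∈ Q) :
    J p n 𝔞 →+ P →ₗ[CalW p n S] Q :=
  AddMonoidHom.mk' (fun j => (epsPair γ F j).codRestrict Q (heps j)) fun j k =>
    LinearMap.ext fun x => Subtype.ext (epsPair_add j k x)

omit [NeZero n] in
theorem coe_pairEps (heps : ∀ (j : J p n 𝔞) (x : P), epsPair γ F j x ∈ Q) (j x) :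
    (pairEps heps j x : P × FrobTwist p n S P) = epsPair γ F j x := rfl

variable (heps : ∀ (j : J p n 𝔞) (x : P), epsPair γ F j x ∈ Q)

omit [NeZero n] in
theorem pairIota_pairEps (j : J p n 𝔞) (x : P) :
    pairIota Q (pairEps heps j x) = CalW.of p n S j • x := rfl

omit [NeZero n] in
theorem pairIota_apply (y : Q) : pairIota Q y = y.1.1 := rfl

-- In the second component the identity is σ̇(j)F(ι(y)) = σ̇(j)pḞ(y) = F(j)Ḟ(y).
omit [NeZero n] in
theorem pairEps_pairIota
    (hF : ∀ y ∈ Q, F y.1 = (p : W p n S) • FrobTwist.val p n S P y.2) (j : J p n 𝔞) (y : Q) :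
    pairEps heps j (pairIota Q y) = CalW.of p n S j • y := by
  refine Subtype.ext ?_
  rw [coe_pairEps, Submodule.coe_smul, pairIota_apply]
  refine pair_ext ?_ ?_
  · rw [epsPair_fst, Prod.smul_fst]
  · rw [val_epsPair, Prod.smul_snd, FrobTwist.val_smul, hF _ y.2, CalW.frob_of,
      ← natCast_mul_sigmaDot (γ := γ), smul_smul, mul_comm]

theorem tmul_smul_eq_zero [Module.Finite (CalW p n S) P] (j : J p n 𝔞) (x : P) :
    (1 : S ⧸ 𝔞) ⊗ₜ[CalW p n S] (CalW.of p n S j • x) = 0 := by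
  rw [TensorProduct.tmul_smul, ← algebraMap_smul (S ⧸ 𝔞)]
  have : algebraMap (CalW p n S) (S ⧸ 𝔞) (CalW.of p n S j) = 0 := by
    change Ideal.Quotient.mk 𝔞 (algebraMap (CalW p n S) S (CalW.of p n S j)) = 0
    rw [algebraMap_of, Ideal.Quotient.eq_zero_iff_mem, ← mem_J]
    exact j.2
  rw [this, zero_smul]

theorem tmul_pairIota [Module.Finite (CalW p n S) P] {y : Q}
    (hy : y ∈ Submodule.span (CalW p n S) {y | ∃ j x, y = pairEps heps j x}) :
    (1 : S ⧸ 𝔞) ⊗ₜ[CalW p n S] pairIota Q y = 0 := by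
  induction hy using Submodule.span_induction with
  | mem y hy =>
    obtain ⟨j, x, rfl⟩ := hy
    rw [pairIota_pairEps]
    exact tmul_smul_eq_zero j x
  | zero => rw [map_zero, TensorProduct.tmul_zero]
  | add x y _ _ hx hy => rw [map_add, TensorProduct.tmul_add, hx, hy, add_zero]
  | smul a y _ hy => rw [map_smul, TensorProduct.tmul_smul, hy, smul_zero]

theorem pair_coker_iota [Module.Finite (CalW p n S) P] [Module.Projective (CalW p n S) P]
    (e : P →ₗ[CalW p n S] P) (s : P →ₗ[CalW p n S] Q) (hs1 : ∀ x, pairIota Q (s x) = x - e x)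
    (hs2 : ∀ y : Q, y - s (pairIota Q y) ∈
      Submodule.span (CalW p n S) {y | ∃ j x, y = pairEps heps j x}) :
    Module.Finite (S ⧸ 𝔞) ((S ⧸ 𝔞) ⊗[CalW p n S] (P ⧸ LinearMap.range (pairIota Q))) ∧
      Module.Projective (S ⧸ 𝔞)
        ((S ⧸ 𝔞) ⊗[CalW p n S] (P ⧸ LinearMap.range (pairIota Q))) := by
  refine projective_quotient_of_retract e (fun x => ⟨s x, hs1 x⟩) ?_
  rintro _ ⟨y, rfl⟩
  have h3 : e (pairIota Q y) = pairIota Q (y - s (pairIota Q y)) := by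
    rw [map_sub, hs1]
    abel
  rw [h3]
  exact tmul_pairIota heps (hs2 y)

omit [NeZero n] in
theorem pair_smul_mem (hF : ∀ y ∈ Q, F y.1 = (p : W p n S) • FrobTwist.val p n S P y.2)
    (s : P →ₗ[CalW p n S] Q) {x : P}
    (hx : x ∈ ((J p n 𝔞).map (CalW.of p n S) • ⊤ : Submodule (CalW p n S) P)) :
    s x ∈ Submodule.span (CalW p n S) {y | ∃ j x, y = pairEps heps j x} := by
  induction hx using Submodule.smul_induction_on' with
  | smul a ha x _ =>
    obtain ⟨j, hj, rfl⟩ := (Ideal.mem_map_iff_of_surjective _ CalW.of_surjective).1 ha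
    rw [map_smul]
    exact Submodule.subset_span ⟨⟨j, hj⟩, pairIota Q (s x), (pairEps_pairIota heps hF ⟨j, hj⟩ (s x)).symm⟩
  | add x _ y _ hx hy => rw [map_add]; exact Submodule.add_mem _ hx hy

/-- The maps induced by ι and s exhibit (S/𝔞) ⊗ Q/im ε as a retract of (S/𝔞) ⊗ P. -/
theorem pair_coker_eps [Module.Finite (CalW p n S) P] [Module.Projective (CalW p n S) P]
    (s : P →ₗ[CalW p n S] Q)
    (hs2 : ∀ y : Q, y - s (pairIota Q y) ∈
      Submodule.span (CalW p n S) {y | ∃ j x, y = pairEps heps j x}) :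
    Module.Finite (S ⧸ 𝔞) ((S ⧸ 𝔞) ⊗[CalW p n S]
        (Q ⧸ Submodule.span (CalW p n S) {y | ∃ j x, y = pairEps heps j x})) ∧
      Module.Projective (S ⧸ 𝔞) ((S ⧸ 𝔞) ⊗[CalW p n S]
        (Q ⧸ Submodule.span (CalW p n S) {y | ∃ j x, y = pairEps heps j x})) := by
  refine projective_of_retract (P := P)
    (Submodule.liftQ _ ((TensorProduct.mk (CalW p n S) (S ⧸ 𝔞) P 1).comp (pairIota Q))
      fun y hy => tmul_pairIota heps hy)
    ((Submodule.mkQ _).comp s) fun m => ?_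
  obtain ⟨y, rfl⟩ := Submodule.mkQ_surjective _ m
  refine congrArg (fun z => (1 : S ⧸ 𝔞) ⊗ₜ[CalW p n S] z) ?_
  exact ((Submodule.Quotient.eq _).2 (hs2 y)).symm

/-- The map `Ḟ`. -/
def pairFdot (Q : Submodule (CalW p n S) (P × FrobTwist p n S P)) :
    Q →ₛₗ[CalW.frob p n S] (W p n S ⊗[CalW p n S] P) where
  toFun y := FrobTwist.val p n S P y.1.2
  map_add' _ _ := rfl
  map_smul' _ _ := rfl

omit [NeZero n] in
theorem pairFdot_apply (y : Q) : pairFdot Q y = FrobTwist.val p n S P y.1.2 := rfl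

variable (γ F Q) in
/-- Construction of a relative truncated display from a module `Q` of pairs `(ι(y), Ḟ(y))`. -/
def RelDisplay.ofPairs [Module.Finite (CalW p n S) P] [Module.Projective (CalW p n S) P]
    (hF : ∀ y ∈ Q, F y.1 = (p : W p n S) • FrobTwist.val p n S P y.2)
    (hs : ∃ (e : P →ₗ[CalW p n S] P) (s : P →ₗ[CalW p n S] Q),
      (∀ x, pairIota Q (s x) = x - e x) ∧ ∀ y : Q, y - s (pairIota Q y) ∈
        Submodule.span (CalW p n S) {y | ∃ j x, y = pairEps heps j x})
    (hspan : Submodule.span (W p n S) (Set.range (pairFdot Q)) = ⊤) :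
    RelDisplay p n 𝔞 γ where
  P := P
  Q := Q
  iota := pairIota Q
  eps := pairEps heps
  eps_smul c j x := Subtype.ext (epsPair_smul c j x)
  F := F
  Fdot := pairFdot Q
  finite := inferInstance
  projective := inferInstance
  iota_eps := pairIota_pairEps heps
  eps_iota := pairEps_pairIota heps hF
  finite_coker_iota := by
    obtain ⟨e, s, hs1, hs2⟩ := hs
    exact (pair_coker_iota heps e s hs1 hs2).1
  projective_coker_iota := by
    obtain ⟨e, s, hs1, hs2⟩ := hs
    exact (pair_coker_iota heps e s hs1 hs2).2
  finite_coker_eps := by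
    obtain ⟨e, s, hs1, hs2⟩ := hs
    exact (pair_coker_eps heps s hs2).1
  projective_coker_eps := by
    obtain ⟨e, s, hs1, hs2⟩ := hs
    exact (pair_coker_eps heps s hs2).2
  Fdot_eps j x := val_epsPair j x
  span_Fdot := hspan
  hodge_injective y hy := by
    obtain ⟨e, s, hs1, hs2⟩ := hs
    rw [← sub_add_cancel y (s (pairIota Q y))]
    exact Submodule.add_mem _ (hs2 y) (pair_smul_mem heps hF s hy)

end Construction

end Disp
end

noncomputable section

namespace Disp

/-! ### Homomorphisms and base change along surjections -/

namespace RelDisplay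

variable {p : ℕ} [Fact p.Prime] {n : ℕ} [NeZero n] {S S' : Type u} [CommRing S] [CommRing S']
  {𝔞 : Ideal S} {γ : DividedPowers 𝔞} {𝔞' : Ideal S'} {γ' : DividedPowers 𝔞'}
  {φ : S →+* S'} {h : 𝔞 ≤ 𝔞'.comap φ} {X : RelDisplay p n 𝔞 γ} {Y : RelDisplay p n 𝔞' γ'}

/-- The map `W_n(S) ⊗ P → W_n(S') ⊗ P'` induced by a semilinear map `P → P'`. -/
abbrev twMap (f₀ : X.P →ₛₗ[CalW.map p n φ] Y.P) :
    (W p n S ⊗[CalW p n S] X.P) →ₛₗ[W.map p n φ] (W p n S' ⊗[CalW p n S'] Y.P) :=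
  tensorMap (W.map p n φ) (CalW.map_algebraMap_W p n φ) f₀

namespace Hom

/-- A homomorphism is determined by its first component. -/
def ofP (hp : IsNilpotent (p : S')) (hc : DPCompat γ γ' φ) (f₀ : X.P →ₛₗ[CalW.map p n φ] Y.P)
    (hQ : ∀ y, ∃ y', Y.iota y' = f₀ (X.iota y) ∧ Y.Fdot y' = twMap f₀ (X.Fdot y))
    (hF : ∀ x, twMap f₀ (X.F x) = Y.F (f₀ x)) : Hom φ h X Y where
  f₀ := f₀
  f₁ :=
    have h1 (y) : Y.iota (hQ y).choose = f₀ (X.iota y) := (hQ y).choose_spec.1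
    have h2 (y) : Y.Fdot (hQ y).choose = twMap f₀ (X.Fdot y) := (hQ y).choose_spec.2
    { toFun := fun y => (hQ y).choose
      map_add' := fun y z => Q_ext hp
        ((h1 _).trans (by rw [map_add, map_add, map_add, h1, h1]))
        ((h2 _).trans (by rw [map_add, map_add, map_add, h2, h2]))
      map_smul' := fun a y => Q_ext hp
        ((h1 _).trans (by rw [map_smul, f₀.map_smulₛₗ, map_smul, h1]))
        ((h2 _).trans (by
          rw [Y.Fdot.map_smulₛₗ, h2, X.Fdot.map_smulₛₗ, LinearMap.map_smulₛₗ, CalW.frob_map])) }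
  map_iota y := (hQ y).choose_spec.1.symm
  map_eps j x := by
    refine Q_ext hp ?_ ?_
    · refine (hQ _).choose_spec.1.trans ?_
      rw [X.iota_eps, Y.iota_eps, f₀.map_smulₛₗ, CalW.map_of]
      rfl
    · refine (hQ _).choose_spec.2.trans ?_
      rw [X.Fdot_eps, Y.Fdot_eps, LinearMap.map_smulₛₗ, hF, map_sigmaDot h hc]
  map_F := hF
  map_Fdot y := (hQ y).choose_spec.2.symm

/-- Two elements of `Q` which come from the same element agree if their images in `P` do. -/
theorem f₁_eq (hp : IsNilpotent (p : S')) (f : Hom φ h X Y) {y : X.Q} {y' : Y.Q}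
    (h1 : Y.iota y' = f.f₀ (X.iota y)) (h2 : Y.Fdot y' = twMap f.f₀ (X.Fdot y)) : f.f₁ y = y' :=
  Q_ext hp ((f.map_iota y).symm.trans h1.symm) ((f.map_Fdot y).symm.trans h2.symm)

/-- The identity. -/
def refl (X : RelDisplay p n 𝔞 γ) : Hom (RingHom.id S) le_rfl X X where
  f₀ := { toFun := fun x => x, map_add' := fun _ _ => rfl,
          map_smul' := fun a x => by rw [CalW.map_id'] }
  f₁ := { toFun := fun x => x, map_add' := fun _ _ => rfl,
          map_smul' := fun a x => by rw [CalW.map_id'] }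
  map_iota _ := rfl
  map_eps j x := by
    have : J.map p n (RingHom.id S) le_rfl j = j := Subtype.ext (W.map_id' _)
    rw [this]; rfl
  map_F x := tensorMap_id (fun b => W.map_id' b) (fun _ => rfl) _
  map_Fdot y := tensorMap_id (fun b => W.map_id' b) (fun _ => rfl) _

theorem W_map_comp {S'' : Type u} [CommRing S''] {m : ℕ} (φ : S →+* S') (φ' : S' →+* S'')
    (x : W p m S) : W.map p m φ' (W.map p m φ x) = W.map p m (φ'.comp φ) x := by
  obtain ⟨ξ, rfl⟩ := exists_truncate x
  rw [W.map_truncate, W.map_truncate, W.map_truncate]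
  congr 1

omit [NeZero n] in
theorem CalW_map_comp {S'' : Type u} [CommRing S''] (φ : S →+* S') (φ' : S' →+* S'')
    (x : CalW p n S) : CalW.map p n φ' (CalW.map p n φ x) = CalW.map p n (φ'.comp φ) x :=
  CalW.ext' (W_map_comp _ _ _) (W_map_comp _ _ _)

/-- Composition of homomorphisms. -/
def comp {S'' : Type u} [CommRing S''] {𝔞'' : Ideal S''} {γ'' : DividedPowers 𝔞''}
    {φ' : S' →+* S''} {φ'' : S →+* S''} {h' : 𝔞' ≤ 𝔞''.comap φ'} (h'' : 𝔞 ≤ 𝔞''.comap φ'')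
    {Z : RelDisplay p n 𝔞'' γ''} (hφ : φ'.comp φ = φ'') (g : Hom φ' h' Y Z) (f : Hom φ h X Y) :
    Hom φ'' h'' X Z where
  f₀ := { toFun := fun x => g.f₀ (f.f₀ x), map_add' := fun _ _ => by simp only [map_add],
          map_smul' := fun a x => by
            rw [f.f₀.map_smulₛₗ, g.f₀.map_smulₛₗ, CalW_map_comp, hφ] }
  f₁ := { toFun := fun x => g.f₁ (f.f₁ x), map_add' := fun _ _ => by simp only [map_add],
          map_smul' := fun a x => by
            rw [f.f₁.map_smulₛₗ, g.f₁.map_smulₛₗ, CalW_map_comp, hφ] }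
  map_iota y := by
    change g.f₀ (f.f₀ _) = Z.iota (g.f₁ (f.f₁ y))
    rw [f.map_iota, g.map_iota]
  map_eps j x := by
    change g.f₁ (f.f₁ _) = Z.eps _ (g.f₀ (f.f₀ x))
    rw [f.map_eps, g.map_eps]
    congr 2
    subst hφ
    exact Subtype.ext (W_map_comp _ _ _)
  map_F x := by
    change _ = Z.F (g.f₀ (f.f₀ x))
    rw [← g.map_F, ← f.map_F]
    exact (tensorMap_tensorMap (fun b => by rw [W_map_comp, hφ]) (fun _ => rfl) _).symm
  map_Fdot y := by
    change _ = Z.Fdot (g.f₁ (f.f₁ y))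
    rw [← g.map_Fdot, ← f.map_Fdot]
    exact (tensorMap_tensorMap (fun b => by rw [W_map_comp, hφ]) (fun _ => rfl) _).symm

/-- The properties which characterize base change along a surjective homomorphism. -/
structure IsSurjBaseChange (f : Hom φ h X Y) : Prop where
  surj₀ : Function.Surjective f.f₀
  ker₀ : ∀ x, f.f₀ x = 0 →
    x ∈ (RingHom.ker (CalW.map p n φ) • ⊤ : Submodule (CalW p n S) X.P)
  surj₁ : Function.Surjective f.f₁

/-- On P the factorization is descent along a surjection with the expected kernel. On Q it needs no
kernel condition, since elements of the target Q are determined by their images under ι and Ḟ. -/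
theorem IsSurjBaseChange.isBaseChange {f : Hom φ h X Y} (hf : f.IsSurjBaseChange)
    (hφ : Function.Surjective φ) (hp : IsNilpotent (p : S')) : f.IsBaseChange := by
  intro Z g
  have hcomp : (CalW.map p n (RingHom.id S')).comp (CalW.map p n φ) = CalW.map p n φ :=
    RingHom.ext fun x => CalW.map_id' _
  -- Descent expects a map semilinear over a composite that equals `CalW.map p n φ` only
  -- propositionally, so `g.f₀` is transported along this equality.
  obtain ⟨k₀, hk₀⟩ := exists_descent (CalW.map_surjective hφ) hf.surj₀ hf.ker₀
    (CalW.map p n (RingHom.id S')) (hcomp.symm ▸ g.f₀)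
  have hk₀ (x) : k₀ (f.f₀ x) = g.f₀ x := by
    rw [hk₀]
    have {θ θ' : CalW p n S →+* CalW p n S'} (e : θ = θ') (g : X.P →ₛₗ[θ] Z.P) (x : X.P) :
        (e ▸ g : X.P →ₛₗ[θ'] Z.P) x = g x := by subst e; rfl
    exact this _ _ _
  have htw (z) : twMap k₀ (twMap f.f₀ z) = twMap g.f₀ z :=
    tensorMap_tensorMap (fun b => W.map_id' _) hk₀ z
  let k : Hom (RingHom.id S') le_rfl Y Z := ofP hp DPCompat.id k₀ (fun y => by
      obtain ⟨y, rfl⟩ := hf.surj₁ y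
      refine ⟨g.f₁ y, ?_, ?_⟩
      · rw [← f.map_iota, ← g.map_iota, hk₀]
      · rw [← f.map_Fdot, ← g.map_Fdot, htw]) (fun x => by
      obtain ⟨x, rfl⟩ := hf.surj₀ x
      rw [← f.map_F, htw, hk₀, g.map_F])
  have hk₁ (y) : k.f₁ (f.f₁ y) = g.f₁ y := by
    refine f₁_eq hp k ?_ ?_
    · rw [← g.map_iota, ← f.map_iota]; exact (hk₀ _).symm
    · rw [← g.map_Fdot, ← f.map_Fdot]; exact (htw _).symm
  refine ⟨k, ⟨hk₀, hk₁⟩, fun k' hk' => ?_⟩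
  have h0 : k'.f₀ = k.f₀ := LinearMap.ext fun x => by
    obtain ⟨x, rfl⟩ := hf.surj₀ x
    rw [hk'.1]; exact (hk₀ x).symm
  have h1 : k'.f₁ = k.f₁ := LinearMap.ext fun y => by
    obtain ⟨y, rfl⟩ := hf.surj₁ y
    rw [hk'.2, hk₁]
  cases k'
  cases hk : k
  rw [hk] at h0 h1
  congr

end Hom

-- P is tensored with 𝒲_n(S'), whereas Q is replaced by its image in the module of pairs over the
-- new P. The axioms hold because F, e and s descend and every element of the new Q comes from the
-- old one.
variable (X) in
theorem exists_surjBaseChange (hp : IsNilpotent (p : S)) (hφ : Function.Surjective φ)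
    (h : 𝔞 ≤ (⊥ : Ideal S').comap φ) :
    ∃ (Y : Display p n S') (f : Hom φ h X Y), f.IsSurjBaseChange := by
  let A := CalW p n S
  let A' := CalW p n S'
  let _ : Algebra A A' := (CalW.map p n φ).toAlgebra
  have hψ : Function.Surjective (CalW.map p n φ) := CalW.map_surjective hφ
  let P := A' ⊗[A] X.P
  let f₀ : X.P →ₛₗ[CalW.map p n φ] P :=
    { toFun := fun x => (1 : A') ⊗ₜ x
      map_add' := fun x y => TensorProduct.tmul_add _ _ _
      map_smul' := fun a x => by
        rw [TensorProduct.tmul_smul]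
        exact (algebraMap_smul A' a ((1 : A') ⊗ₜ[A] x)).symm }
  have hf₀ : Function.Surjective f₀ := TensorProduct.mk_surjective A X.P A' hψ
  have hk₀ (x) (hx : f₀ x = 0) :
      x ∈ (RingHom.ker (CalW.map p n φ) • ⊤ : Submodule (CalW p n S) X.P) :=
    (one_tmul_eq_zero_iff hψ x).1 hx
  let T : (W p n S ⊗[A] X.P) →ₛₗ[W.map p n φ] (W p n S' ⊗[A'] P) :=
    tensorMap (W.map p n φ) (CalW.map_algebraMap_W p n φ) f₀
  let G : X.P →ₛₗ[(CalW.frob p n S').comp (CalW.map p n φ)] (W p n S' ⊗[A'] P) :=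
    { toFun := fun x => T (X.F x)
      map_add' := fun x y => by rw [map_add, map_add]
      map_smul' := fun a x => by rw [X.F.map_smulₛₗ, T.map_smulₛₗ]; rfl }
  obtain ⟨F, hF⟩ := exists_descent hψ hf₀ hk₀ (CalW.frob p n S') G
  have hF (x) : F (f₀ x) = T (X.F x) := hF x
  let q : X.Q →ₛₗ[CalW.map p n φ] (P × FrobTwist p n S' P) :=
    { toFun := fun y => (f₀ (X.iota y), (FrobTwist.val p n S' P).symm (T (X.Fdot y)))
      map_add' := fun x y => pair_ext
        (by simp only [map_add, Prod.fst_add])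
        (by simp only [map_add, Prod.snd_add])
      map_smul' := fun a y => pair_ext
        (by simp only [map_smul, f₀.map_smulₛₗ, Prod.smul_fst])
        (by
          simp only [Prod.smul_snd, FrobTwist.val_smul, AddEquiv.apply_symm_apply,
            X.Fdot.map_smulₛₗ, T.map_smulₛₗ]
          rfl) }
  have hq (y) : FrobTwist.val p n S' P (q y).2 = T (X.Fdot y) := rfl
  have _ : RingHomSurjective (CalW.map p n φ) := ⟨hψ⟩
  let Q : Submodule A' (P × FrobTwist p n S' P) := LinearMap.range q
  let q' : X.Q →ₛₗ[CalW.map p n φ] Q := q.codRestrict Q fun y => ⟨y, rfl⟩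
  have hq' : Function.Surjective q' := by
    rintro ⟨_, y, rfl⟩
    exact ⟨y, rfl⟩
  have heps' (j : J p n 𝔞) (x : X.P) :
      epsPair (dividedPowersBot S') F (J.map p n φ h j) (f₀ x) = q (X.eps j x) := by
    refine pair_ext ?_ ?_
    · change _ = f₀ (X.iota (X.eps j x))
      rw [X.iota_eps, f₀.map_smulₛₗ, CalW.map_of]
      rfl
    · rw [hq, X.Fdot_eps, T.map_smulₛₗ, map_sigmaDot h (DPCompat.bot h), ← hF, val_epsPair]
  have heps (j : J p n (⊥ : Ideal S')) (x : P) : epsPair (dividedPowersBot S') F j x ∈ Q := by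
    obtain ⟨j, rfl⟩ := J.map_surjective hφ h j
    obtain ⟨x, rfl⟩ := hf₀ x
    exact ⟨_, (heps' j x).symm⟩
  obtain ⟨D⟩ := X.exists_normalDec hp
  obtain ⟨e, he⟩ := exists_descent hψ hf₀ hk₀ (RingHom.id A') (f₀.comp D.e)
  obtain ⟨s, hs⟩ := exists_descent (M := ↥Q) hψ hf₀ hk₀ (RingHom.id (CalW p n S'))
    (show X.P →ₛₗ[(RingHom.id (CalW p n S')).comp (CalW.map p n φ)] ↥Q from q'.comp D.s)
  have hs (x) : s (f₀ x) = q' (D.s x) := hs x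
  have he (x) : e (f₀ x) = f₀ (D.e x) := he x
  refine ⟨RelDisplay.ofPairs (dividedPowersBot S') F Q heps ?_ ⟨e, s, ?_, ?_⟩ ?_,
    { f₀ := f₀, f₁ := q', map_iota := fun _ => rfl, map_eps := ?_,
      map_F := fun x => (hF x).symm, map_Fdot := fun _ => rfl }, ⟨hf₀, hk₀, hq'⟩⟩
  · rintro _ ⟨y, rfl⟩
    rw [hq]
    change F (f₀ (X.iota y)) = _
    rw [hF, F_iota, T.map_smulₛₗ, map_natCast]
  · intro x
    obtain ⟨x, rfl⟩ := hf₀ x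
    rw [hs, he]
    change f₀ (X.iota (D.s x)) = _
    rw [D.iota_s, map_sub]
  · intro y
    obtain ⟨y, rfl⟩ := hq' y
    change q' y - s (f₀ (X.iota y)) ∈ _
    rw [hs]
    have h1 := D.sub_mem y
    have h2 : q' y - q' (D.s (X.iota y)) = q' (y - D.s (X.iota y)) :=
      Subtype.ext (map_sub q _ _).symm
    rw [h2]
    generalize y - D.s (X.iota y) = z at h1 ⊢
    induction h1 using Submodule.span_induction with
    | mem z hz =>
      obtain ⟨j, x, rfl⟩ := hz
      exact Submodule.subset_span
        ⟨J.map p n φ h j, f₀ (D.e x), Subtype.ext (heps' j (D.e x)).symm⟩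
    | zero => rw [LinearMap.map_zero]; exact Submodule.zero_mem _
    | add x y _ _ hx hy => rw [LinearMap.map_add]; exact Submodule.add_mem _ hx hy
    | smul a y _ hy => rw [q'.map_smulₛₗ]; exact Submodule.smul_mem _ _ hy
  · rw [eq_top_iff]
    rintro z -
    obtain ⟨z, rfl⟩ := tensorMap_surjective (h := CalW.map_algebraMap_W p n φ)
      (W.map_surjective hφ) hf₀ z
    have h1 : z ∈ Submodule.span (W p n S) (Set.range X.Fdot) := by
      rw [X.span_Fdot]; exact Submodule.mem_top
    induction h1 using Submodule.span_induction with
    | mem z hz =>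
      obtain ⟨y, rfl⟩ := hz
      exact Submodule.subset_span ⟨q' y, rfl⟩
    | zero => rw [map_zero]; exact Submodule.zero_mem _
    | add x y _ _ hx hy => rw [map_add]; exact Submodule.add_mem _ hx hy
    | smul a y _ hy => rw [LinearMap.map_smulₛₗ]; exact Submodule.smul_mem _ _ hy
  · exact fun j x => Subtype.ext (heps' j x).symm

/-- Comparison with the constructed base change. Uniqueness in the universal property shows that
going to it and back is the identity, so surjectivity and the kernel carry over. -/
theorem Hom.IsBaseChange.isSurjBaseChange (hp : IsNilpotent (p : S)) (hφ : Function.Surjective φ)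
    {h : 𝔞 ≤ (⊥ : Ideal S').comap φ} {Y : Display p n S'} {f : Hom φ h X Y}
    (hf : f.IsBaseChange) : f.IsSurjBaseChange := by
  have hp' : IsNilpotent (p : S') := by simpa using hp.map φ
  obtain ⟨Y', c, hc⟩ := X.exists_surjBaseChange hp hφ h
  obtain ⟨k, ⟨hk₀, hk₁⟩, -⟩ := hf Y' c
  obtain ⟨l, ⟨hl₀, hl₁⟩, -⟩ := hc.isBaseChange hφ hp' Y f
  obtain ⟨i, -, hi⟩ := hf Y f
  have h1 := hi (l.comp le_rfl (RingHom.comp_id _) k)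
    ⟨fun x => (congrArg l.f₀ (hk₀ x)).trans (hl₀ x),
      fun y => (congrArg l.f₁ (hk₁ y)).trans (hl₁ y)⟩
  have h2 := hi (Hom.refl Y) ⟨fun _ => rfl, fun _ => rfl⟩
  have h3 := h1.trans h2.symm
  refine ⟨fun y => ?_, fun x hx => hc.ker₀ x ?_, fun y => ?_⟩
  · obtain ⟨x, hx⟩ := hc.surj₀ (k.f₀ y)
    refine ⟨x, ?_⟩
    rw [← hl₀, hx]
    exact congrArg (fun g : Hom _ _ Y Y => g.f₀ y) h3
  · rw [← hk₀, hx, map_zero]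
  · obtain ⟨x, hx⟩ := hc.surj₁ (k.f₁ y)
    refine ⟨x, ?_⟩
    rw [← hl₁, hx]
    exact congrArg (fun g : Hom _ _ Y Y => g.f₁ y) h3

end RelDisplay

end Disp
end

noncomputable section

namespace Disp

/-! ### Truncated vectors with few logarithmic coordinates -/

section TruncLog

variable {p : ℕ} [Fact p.Prime] {n : ℕ} {S : Type u} [CommRing S] {𝔞 : Ideal S}

variable (p) in
/-- The image in `W_n(S)` of the Witt vectors with finitely many logarithmic coordinates. -/
def truncLog (n : ℕ) (γ : DividedPowers 𝔞) (k : ℕ) : Ideal (W p n S) :=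
  (logIdeal γ k).map (WittVector.truncate n)

variable {γ : DividedPowers 𝔞}

theorem mem_truncLog {k : ℕ} {x : W p n S} :
    x ∈ truncLog p n γ k ↔ ∃ ξ ∈ logIdeal γ k, WittVector.truncate n ξ = x :=
  Ideal.mem_map_iff_of_surjective _ (WittVector.truncate_surjective p n S)

theorem truncLog_zero : truncLog p n γ 0 = ⊥ := Ideal.map_bot

theorem ker_map_le_truncLog {R : Type u} [CommRing R] (φ : S →+* R)
    (γ : DividedPowers (RingHom.ker φ)) : RingHom.ker (W.map p n φ) ≤ truncLog p n γ n := by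
  intro x hx
  obtain ⟨ξ, rfl⟩ := exists_truncate x
  rw [RingHom.mem_ker, W.map_truncate, ← RingHom.mem_ker, WittVector.mem_ker_truncate] at hx
  rw [mem_truncLog]
  exact exists_mem_logIdeal (mem_coeffIdeal.2 fun i hi => by
    have := hx i hi
    rwa [WittVector.map_coeff] at this)

end TruncLog

section BaseChange

variable {A B P P' : Type u} [CommRing A] [CommRing B] [Algebra A B] [AddCommGroup P] [Module A P]
  [AddCommGroup P'] [Module A P'] {ψ : A →+* A} {χ : B →+* B}
  {h : ∀ x, χ (algebraMap A B x) = algebraMap A B (ψ x)} {f : P →ₛₗ[ψ] P'}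

theorem tensorMap_eq_baseChange {g : P →ₗ[A] P'} (hχ : ∀ b, χ b = b) (hf : ∀ x, f x = g x)
    (z : B ⊗[A] P) : tensorMap χ h f z = g.baseChange B z := by
  induction z with
  | zero => simp only [map_zero]
  | add x y hx hy => simp only [map_add, hx, hy]
  | tmul b x => rw [tensorMap_tmul, LinearMap.baseChange_tmul, hχ, hf]

theorem tensorMap_bijective (hχ : ∀ b, χ b = b) (hψ : ∀ a, ψ a = a) (hf : Function.Bijective f) :
    Function.Bijective (tensorMap χ h f) := by
  have hχ' : Function.Surjective χ := fun b => ⟨b, hχ b⟩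
  refine ⟨?_, tensorMap_surjective hχ' hf.2⟩
  rw [injective_iff_map_eq_zero]
  intro z hz
  have h1 := mem_smul_of_tensorMap_eq_zero (fun a => ⟨a, hψ a⟩) hχ' hf.2 (fun x hx => by
    rw [(injective_iff_map_eq_zero f).1 hf.1 x hx]; exact Submodule.zero_mem _) hz
  have h2 : RingHom.ker χ = ⊥ := by
    rw [eq_bot_iff]
    intro b hb
    rwa [RingHom.mem_ker, hχ] at hb
  rwa [h2, Submodule.bot_smul, Submodule.mem_bot] at h1

end BaseChange

variable {p : ℕ} [Fact p.Prime] {n : ℕ} [NeZero n] {S R : Type u} [CommRing S] [CommRing R]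
  {f : S →+* R} {Xbar : Display p n R}

/-- A linear map as a semilinear map. -/
def toMapId {P P' : Type u} [AddCommGroup P] [Module (CalW p n S) P] [AddCommGroup P']
    [Module (CalW p n S) P'] (g : P →ₗ[CalW p n S] P') :
    P →ₛₗ[CalW.map p n (RingHom.id S)] P' where
  toFun := g
  map_add' := map_add g
  map_smul' a x := by rw [map_smul, CalW.map_id']

/-- A semilinear map as a linear map. -/
def ofMapId {P P' : Type u} [AddCommGroup P] [Module (CalW p n S) P] [AddCommGroup P']
    [Module (CalW p n S) P'] (g : P →ₛₗ[CalW.map p n (RingHom.id S)] P') :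
    P →ₗ[CalW p n S] P' where
  toFun := g
  map_add' := map_add g
  map_smul' a x := by rw [g.map_smulₛₗ, CalW.map_id']; rfl

theorem isNilpotent_of_mem_ker_map (γ : DividedPowers (RingHom.ker f)) (hp : IsNilpotent (p : S)) :
    ∀ x ∈ RingHom.ker (CalW.map p n f), IsNilpotent x := fun x hx => by
  refine isNilpotent_CalW hp (DividedPowers.isNilpotent γ hp ?_)
  rw [RingHom.mem_ker, CalW.map_algebraMap, (RingHom.mem_ker).1 hx, map_zero]

/-! ### Rigidity of morphisms of lifts -/

namespace Lift

variable {𝔞 𝔟 : Ideal S} {γ : DividedPowers 𝔞} {δ : DividedPowers 𝔟}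
  {h : 𝔞 ≤ (⊥ : Ideal R).comap f} {h' : 𝔟 ≤ (⊥ : Ideal R).comap f} {hab : 𝔞 ≤ 𝔟}
  {X : Lift f 𝔞 γ h Xbar} {Y : Lift f 𝔟 δ h' Xbar}

/-- Both modules reduce onto the same one, with kernels generated by ker(𝒲_n(S) → 𝒲_n(R)), a nil
ideal. -/
theorem bijective_of_red (hp : IsNilpotent (p : S)) (hf : Function.Surjective f)
    (ω : DividedPowers (RingHom.ker f)) (g : X.obj.P →ₗ[CalW p n S] Y.obj.P)
    (hg : ∀ x, Y.red.f₀ (g x) = X.red.f₀ x) : Function.Bijective g := by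
  have hX := X.isBaseChange.isSurjBaseChange hp hf
  have hY := Y.isBaseChange.isSurjBaseChange hp hf
  refine bijective_of_nil (I := RingHom.ker (CalW.map p n f))
    (isNilpotent_of_mem_ker_map ω hp) g (fun y => ?_) fun x hx => hX.ker₀ x ?_
  · obtain ⟨x, hx⟩ := hX.surj₀ (Y.red.f₀ y)
    exact ⟨x, hY.ker₀ _ (by rw [map_sub, hg, hx, sub_self])⟩
  · rw [← hg, hx, map_zero]

theorem _root_.Disp.LiftHom.bijective (hp : IsNilpotent (p : S)) (hf : Function.Surjective f)
    (ω : DividedPowers (RingHom.ker f)) (α : LiftHom hab X Y) : Function.Bijective α.hom.f₀ :=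
  bijective_of_red hp hf ω (ofMapId α.hom.f₀) α.red₀

theorem _root_.Disp.LiftHom.fiberMap_bijective (hp : IsNilpotent (p : S))
    (hf : Function.Surjective f) (ω : DividedPowers (RingHom.ker f)) (α : LiftHom hab X Y) :
    Function.Bijective α.hom.fiberMap :=
  tensorMap_bijective (fun _ => rfl) CalW.map_id' (α.bijective hp hf ω)

theorem red₁_of_red₀ (hp : IsNilpotent (p : R)) (k : RelDisplay.Hom (RingHom.id S) hab X.obj Y.obj)
    (hk : ∀ x, Y.red.f₀ (k.f₀ x) = X.red.f₀ x) (y : X.obj.Q) :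
    Y.red.f₁ (k.f₁ y) = X.red.f₁ y := by
  refine RelDisplay.Q_ext hp ?_ ?_
  · rw [← Y.red.map_iota, ← k.map_iota, hk, X.red.map_iota]
  · rw [← Y.red.map_Fdot, ← k.map_Fdot, ← X.red.map_Fdot]
    exact tensorMap_tensorMap (fun b => by rw [W.map_id']) hk _

end Lift

/-! ### Existence of morphisms by successive approximation -/

section Existence

variable {𝔞 : Ideal S} {γ : DividedPowers 𝔞} {δ : DividedPowers (RingHom.ker f)}
  {h : 𝔞 ≤ (⊥ : Ideal R).comap f} {hab : 𝔞 ≤ RingHom.ker f}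
  {h' : RingHom.ker f ≤ (⊥ : Ideal R).comap f}
  {X : Lift f 𝔞 γ h Xbar} {Y : Lift f (RingHom.ker f) δ h' Xbar}

/-- The elements `ε(ξ ⊗ y)` where `ξ` has at most `k` nonzero logarithmic coordinates. -/
def epsLog (Y : RelDisplay p n (RingHom.ker f) δ) (k : ℕ) : Submodule (CalW p n S) Y.Q :=
  Submodule.span (CalW p n S) {q | ∃ (ξ : WittVector p S)
    (h : WittVector.truncate (n + 1) ξ ∈ J p n (RingHom.ker f)) (y : Y.P),
    ξ ∈ logIdeal δ k ∧ q = Y.eps ⟨_, h⟩ y}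

/-- Since Ḟ ∘ ε multiplies by σ̇, which removes one logarithmic coordinate. This is the contraction
behind the approximation. -/
theorem Fdot_mem_of_mem_epsLog {Y : RelDisplay p n (RingHom.ker f) δ} {k : ℕ} {q : Y.Q}
    (hq : q ∈ epsLog Y (k + 1)) :
    Y.Fdot q ∈ (truncLog p n δ k • ⊤ : Submodule (W p n S) (W p n S ⊗[CalW p n S] Y.P)) := by
  induction hq using Submodule.span_induction with
  | mem q hq =>
    obtain ⟨ξ, h, y, hξ, rfl⟩ := hq
    rw [Y.Fdot_eps, sigmaDot_truncate]
    exact Submodule.smul_mem_smul (Ideal.mem_map_of_mem _ hξ.2) Submodule.mem_top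
  | zero => rw [map_zero]; exact Submodule.zero_mem _
  | add x y _ _ hx hy => rw [map_add]; exact Submodule.add_mem _ hx hy
  | smul a y _ hy => rw [Y.Fdot.map_smulₛₗ]; exact Submodule.smul_mem _ _ hy

theorem F_iota_mem_of_mem_epsLog {Y : RelDisplay p n (RingHom.ker f) δ} {k : ℕ} {q : Y.Q}
    (hq : q ∈ epsLog Y (k + 1)) :
    Y.F (Y.iota q) ∈ (truncLog p n δ k • ⊤ : Submodule (W p n S) (W p n S ⊗[CalW p n S] Y.P)) := by
  rw [RelDisplay.F_iota]
  exact Submodule.smul_mem _ _ (Fdot_mem_of_mem_epsLog hq)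

theorem map_eq_zero_of_mem_epsLog {Y : RelDisplay p n (RingHom.ker f) δ}
    (r : RelDisplay.Hom f h' Y Xbar) {k : ℕ} {q : Y.Q}
    (hq : q ∈ epsLog Y k) : r.f₁ q = 0 := by
  induction hq using Submodule.span_induction with
  | mem q hq =>
    obtain ⟨ξ, h, y, hξ, rfl⟩ := hq
    have h0 : J.map p n f h' ⟨_, h⟩ = 0 := Subtype.ext (by
      change W.map p (n + 1) f (WittVector.truncate (n + 1) ξ) = 0
      rw [W.map_truncate, map_eq_zero_of_mem_logIdeal f le_rfl hξ, map_zero])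
    rw [r.map_eps, h0, map_zero, LinearMap.zero_apply]
  | zero => rw [map_zero]
  | add x y _ _ hx hy => rw [map_add, hx, hy, add_zero]
  | smul a y _ hy => rw [r.f₁.map_smulₛₗ, hy, smul_zero]

theorem exists_mem_epsLog {Y : RelDisplay p n (RingHom.ker f) δ} {k : ℕ}
    {z : W p n S ⊗[CalW p n S] Y.P}
    (hz : z ∈ (truncLog p n δ (k + 1) • ⊤ : Submodule (W p n S) (W p n S ⊗[CalW p n S] Y.P))) :
    ∃ q ∈ epsLog Y (k + 1), (1 : W p n S) ⊗ₜ[CalW p n S] Y.iota q = z := by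
  have hs : Function.Surjective (algebraMap (CalW p n S) (W p n S)) := fun b => by
    obtain ⟨ξ, rfl⟩ := exists_truncate b
    exact ⟨CalW.of p n S (WittVector.truncate (n + 1) ξ), truncate_res ξ⟩
  induction hz using Submodule.smul_induction_on' with
  | smul b hb z _ =>
    obtain ⟨ξ, hξ, rfl⟩ := mem_truncLog.1 hb
    obtain ⟨y, rfl⟩ := TensorProduct.mk_surjective (CalW p n S) Y.P (W p n S) hs z
    refine ⟨Y.eps ⟨_, (truncate_mem_J ξ).2 hξ.1⟩ y, Submodule.subset_span ⟨ξ, _, y, hξ, rfl⟩, ?_⟩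
    rw [Y.iota_eps, TensorProduct.tmul_smul, ← algebraMap_smul (W p n S), TensorProduct.mk_apply]
    exact congrArg (· • (1 : W p n S) ⊗ₜ[CalW p n S] y) (truncate_res ξ)
  | add x _ y _ hx hy =>
    obtain ⟨q, hq, rfl⟩ := hx
    obtain ⟨q', hq', rfl⟩ := hy
    exact ⟨q + q', Submodule.add_mem _ hq hq', by rw [map_add, TensorProduct.tmul_add]⟩

/-- A morphism of lifts up to an error in `Ḟ` whose logarithmic coordinates vanish from the
`k`-th on. -/
structure ApproxHom (D : X.obj.NormalDec) (Y : Lift f (RingHom.ker f) δ h' Xbar) (k : ℕ) where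
  g₁ : X.obj.P →ₗ[CalW p n S] Y.obj.Q
  gT : X.obj.P →ₗ[CalW p n S] Y.obj.P
  g₁_e : ∀ x, g₁ (D.e x) = 0
  gT_e : ∀ x, gT (D.e x) = gT x
  red_g₁ : ∀ x, Y.red.f₁ (g₁ x) = X.red.f₁ (D.s x)
  red_gT : ∀ x, Y.red.f₀ (gT x) = X.red.f₀ (D.e x)
  error : ∀ x, (Y.obj.iota.comp g₁ + gT).baseChange (W p n S) (D.psi x) -
    (Y.obj.Fdot (g₁ x) + Y.obj.F (gT x)) ∈
      (truncLog p n δ k • ⊤ : Submodule (W p n S) (W p n S ⊗[CalW p n S] Y.obj.P))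

namespace ApproxHom

variable {D : X.obj.NormalDec}

/-- The underlying map of modules `P`. -/
def f₀ {k : ℕ} (g : ApproxHom D Y k) : X.obj.P →ₗ[CalW p n S] Y.obj.P :=
  Y.obj.iota.comp g.g₁ + g.gT

theorem red_f₀ {k : ℕ} (g : ApproxHom D Y k) (x : X.obj.P) : Y.red.f₀ (g.f₀ x) = X.red.f₀ x := by
  change Y.red.f₀ (Y.obj.iota (g.g₁ x) + g.gT x) = _
  rw [map_add, Y.red.map_iota, g.red_g₁, g.red_gT, ← X.red.map_iota, D.iota_s, ← map_add,
    sub_add_cancel]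

/-- The components on L and T of the identity of the reduction are lifted by projectivity. The error
vanishes over R, so its coefficients lie in the kernel of W_n(S) → W_n(R). -/
theorem exists_initial (hp : IsNilpotent (p : S)) (hf : Function.Surjective f)
    (D : X.obj.NormalDec) (Y : Lift f (RingHom.ker f) δ h' Xbar) : Nonempty (ApproxHom D Y n) := by
  have hY := Y.isBaseChange.isSurjBaseChange hp hf
  obtain ⟨g₁, hg₁⟩ := exists_semilinear_of_rel (RingHom.id (CalW p n S)) (P := X.obj.P)
    (M := Y.obj.Q) (fun x q => Y.red.f₁ q = X.red.f₁ (D.s x)) (by simp only [map_zero])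
    (fun x y m m' h h' => by simp only [map_add, h, h'])
    (fun a x m h => by
      rw [RingHom.id_apply, Y.red.f₁.map_smulₛₗ, h, map_smul, X.red.f₁.map_smulₛₗ])
    (fun x => hY.surj₁ _)
  obtain ⟨gT, hgT⟩ := exists_semilinear_of_rel (RingHom.id (CalW p n S)) (P := X.obj.P)
    (M := Y.obj.P) (fun x q => Y.red.f₀ q = X.red.f₀ (D.e x)) (by simp only [map_zero])
    (fun x y m m' h h' => by simp only [map_add, h, h'])
    (fun a x m h => by
      rw [RingHom.id_apply, Y.red.f₀.map_smulₛₗ, h, map_smul, X.red.f₀.map_smulₛₗ])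
    (fun x => hY.surj₀ _)
  have hr₁ (x) : Y.red.f₁ (g₁ (x - D.e x)) = X.red.f₁ (D.s x) := by rw [hg₁, D.s_sub]
  have hrT (x) : Y.red.f₀ (gT (D.e x)) = X.red.f₀ (D.e x) := by rw [hgT, D.e_e]
  let g₁' : X.obj.P →ₗ[CalW p n S] Y.obj.Q := g₁.comp (LinearMap.id - D.e)
  let gT' : X.obj.P →ₗ[CalW p n S] Y.obj.P := gT.comp D.e
  have hr (x) : Y.red.f₀ ((Y.obj.iota.comp g₁' + gT') x) = X.red.f₀ x := by
    change Y.red.f₀ (Y.obj.iota (g₁ (x - D.e x)) + gT (D.e x)) = _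
    rw [map_add, Y.red.map_iota, hr₁, hrT, ← X.red.map_iota, D.iota_s, ← map_add, sub_add_cancel]
  refine ⟨⟨g₁', gT', fun x => ?_, fun x => ?_, hr₁, hrT, fun x => ?_⟩⟩
  · change g₁ (D.e x - D.e (D.e x)) = 0
    rw [D.e_e, sub_self, map_zero]
  · change gT (D.e (D.e x)) = gT (D.e x)
    rw [D.e_e]
  · refine Submodule.smul_mono_left (ker_map_le_truncLog f δ)
      (mem_smul_of_tensorMap_eq_zero (h := CalW.map_algebraMap_W p n f) (CalW.map_surjective hf)
        (W.map_surjective hf) hY.surj₀ hY.ker₀ ?_)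
    have h1 : tensorMap (W.map p n f) (CalW.map_algebraMap_W p n f) Y.red.f₀
        ((Y.obj.iota.comp g₁' + gT').baseChange (W p n S) (D.psi x)) =
        tensorMap (W.map p n f) (CalW.map_algebraMap_W p n f) X.red.f₀ (D.psi x) := by
      rw [← tensorMap_eq_baseChange (χ := RingHom.id _) (ψ := RingHom.id _)
        (f := Y.obj.iota.comp g₁' + gT') (A := CalW p n S) (B := W p n S) (h := fun _ => rfl)
        (fun _ => rfl) (fun _ => rfl)]
      exact tensorMap_tensorMap (fun _ => rfl) hr _
    rw [map_sub, h1, map_add, D.psi_apply, map_add, X.red.map_Fdot, X.red.map_F, Y.red.map_Fdot,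
      Y.red.map_F]
    change _ - (Xbar.Fdot (Y.red.f₁ (g₁ (x - D.e x))) + Xbar.F (Y.red.f₀ (gT (D.e x)))) = 0
    rw [hr₁, hrT, sub_self]

/-- By universality of Ψ the error is H ∘ Ψ with H linear. Adding ι ∘ d, with d chosen so that its
base change is -H, cancels this error; what remains is Ḟ and F ∘ ι of values of d, which have one
logarithmic coordinate less. -/
theorem exists_pred (hp : IsNilpotent (p : S)) {k : ℕ} (g : ApproxHom D Y (k + 1)) :
    Nonempty (ApproxHom D Y k) := by
  let B := W p n S
  let N : Submodule B (B ⊗[CalW p n S] Y.obj.P) := truncLog p n δ (k + 1) • ⊤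
  let G : X.obj.P →ₛₗ[CalW.frob p n S] (B ⊗[CalW p n S] Y.obj.P) :=
    { toFun := fun x => g.f₀.baseChange B (D.psi x) - (Y.obj.Fdot (g.g₁ x) + Y.obj.F (g.gT x))
      map_add' := fun x y => by simp only [map_add]; abel
      map_smul' := fun a x => by
        simp only [LinearMap.map_smulₛₗ, smul_sub, smul_add, RingHom.id_apply] }
  have hGN (x) : G x ∈ N := g.error x
  obtain ⟨H, hH⟩ := D.exists_factor hp G
  have hHN (z) : H z ∈ N := by
    have hz : z ∈ Submodule.span B (Set.range D.psi) := by
      rw [D.span_psi]; exact Submodule.mem_top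
    induction hz using Submodule.span_induction with
    | mem z hz => obtain ⟨x, rfl⟩ := hz; rw [hH]; exact hGN x
    | zero => rw [map_zero]; exact Submodule.zero_mem _
    | add x y _ _ hx hy => rw [map_add]; exact Submodule.add_mem _ hx hy
    | smul a y _ hy => rw [map_smul]; exact Submodule.smul_mem _ _ hy
  obtain ⟨d, hd⟩ := exists_semilinear_of_rel (RingHom.id (CalW p n S)) (P := X.obj.P)
    (M := Y.obj.Q) (fun x q => q ∈ epsLog Y.obj (k + 1) ∧
      (1 : B) ⊗ₜ[CalW p n S] Y.obj.iota q = -H ((1 : B) ⊗ₜ x))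
    ⟨Submodule.zero_mem _, by simp only [map_zero, TensorProduct.tmul_zero, neg_zero]⟩
    (fun x y m m' h h' => ⟨Submodule.add_mem _ h.1 h'.1, by
      rw [map_add, TensorProduct.tmul_add, h.2, h'.2, TensorProduct.tmul_add, map_add, neg_add]⟩)
    (fun a x m h => ⟨Submodule.smul_mem _ _ h.1, by
      rw [RingHom.id_apply, map_smul, TensorProduct.tmul_smul, h.2, TensorProduct.tmul_smul,
        ← algebraMap_smul B a, ← algebraMap_smul B a ((1 : B) ⊗ₜ x), map_smul, smul_neg]⟩)
    (fun x => exists_mem_epsLog (N.neg_mem (hHN _)))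
  have hd1 (x) : d x ∈ epsLog Y.obj (k + 1) := (hd x).1
  have hdH (z) : (Y.obj.iota.comp d).baseChange B z = -H z := by
    induction z with
    | zero => rw [map_zero, map_zero, neg_zero]
    | add x y hx hy => rw [map_add, hx, hy, map_add, neg_add]
    | tmul b x =>
      have h1 : b ⊗ₜ[CalW p n S] x = b • ((1 : B) ⊗ₜ x) := by
        rw [TensorProduct.smul_tmul', smul_eq_mul, mul_one]
      rw [h1, map_smul, map_smul]
      exact (congrArg (b • ·) (hd x).2).trans (smul_neg _ _)
  -- The correction is split along the decomposition: on L it must stay in Q, on T it is pushed to P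
  -- by ι.
  let g₁' : X.obj.P →ₗ[CalW p n S] Y.obj.Q := g.g₁ + d.comp (LinearMap.id - D.e)
  let gT' : X.obj.P →ₗ[CalW p n S] Y.obj.P := g.gT + (Y.obj.iota.comp d).comp D.e
  have hg₁' (x) : g₁' x = g.g₁ x + d (x - D.e x) := rfl
  have hgT' (x) : gT' x = g.gT x + Y.obj.iota (d (D.e x)) := rfl
  refine ⟨⟨g₁', gT', fun x => ?_, fun x => ?_, fun x => ?_, fun x => ?_, fun x => ?_⟩⟩
  · rw [hg₁', g.g₁_e, D.e_e, sub_self, map_zero, add_zero]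
  · rw [hgT', hgT', g.gT_e, D.e_e]
  · rw [hg₁', map_add, g.red_g₁, map_eq_zero_of_mem_epsLog _ (hd1 _), add_zero]
  · rw [hgT', map_add, g.red_gT, Y.red.map_iota, map_eq_zero_of_mem_epsLog _ (hd1 _), map_zero,
      add_zero]
  · have h1 : Y.obj.iota.comp g₁' + gT' = g.f₀ + Y.obj.iota.comp d := by
      ext y
      change Y.obj.iota (g₁' y) + gT' y = Y.obj.iota (g.g₁ y) + g.gT y + Y.obj.iota (d y)
      rw [hg₁', hgT', map_add, map_sub, map_sub]
      abel
    have h2 : g.f₀.baseChange B (D.psi x) - (Y.obj.Fdot (g.g₁ x) + Y.obj.F (g.gT x)) =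
        H (D.psi x) := (hH x).symm
    have h3 : (Y.obj.iota.comp g₁' + gT').baseChange B (D.psi x) -
        (Y.obj.Fdot (g₁' x) + Y.obj.F (gT' x)) =
        -(Y.obj.Fdot (d (x - D.e x)) + Y.obj.F (Y.obj.iota (d (D.e x)))) := by
      rw [h1, LinearMap.baseChange_add, LinearMap.add_apply, hdH, ← h2, hg₁', hgT', map_add,
        map_add]
      abel
    rw [h3]
    exact Submodule.neg_mem _ (Submodule.add_mem _ (Fdot_mem_of_mem_epsLog (hd1 _))
      (F_iota_mem_of_mem_epsLog (hd1 _)))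

theorem exists_zero (hp : IsNilpotent (p : S)) {k : ℕ} (g : ApproxHom D Y k) :
    Nonempty (ApproxHom D Y 0) := by
  induction k with
  | zero => exact ⟨g⟩
  | succ k ih =>
    obtain ⟨g'⟩ := g.exists_pred hp
    exact ih g'

variable (g : ApproxHom D Y 0)

theorem baseChange_psi (x : X.obj.P) :
    g.f₀.baseChange (W p n S) (D.psi x) = Y.obj.Fdot (g.g₁ x) + Y.obj.F (g.gT x) := by
  have h1 := g.error x
  rw [truncLog_zero, Submodule.bot_smul, Submodule.mem_bot, sub_eq_zero] at h1
  exact h1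

theorem gT_sub (x : X.obj.P) : g.gT (x - D.e x) = 0 := by rw [map_sub, g.gT_e, sub_self]

theorem g₁_sub (x : X.obj.P) : g.g₁ (x - D.e x) = g.g₁ x := by rw [map_sub, g.g₁_e, sub_zero]

theorem f₀_apply (x : X.obj.P) : g.f₀ x = Y.obj.iota (g.g₁ x) + g.gT x := rfl

theorem f₀_e (x : X.obj.P) : g.f₀ (D.e x) = g.gT x := by
  rw [f₀_apply, g.g₁_e, map_zero, zero_add, g.gT_e]

theorem f₀_sub (x : X.obj.P) : g.f₀ (x - D.e x) = Y.obj.iota (g.g₁ x) := by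
  rw [f₀_apply, g₁_sub, gT_sub, add_zero]

theorem baseChange_Fdot_s (x : X.obj.P) :
    g.f₀.baseChange (W p n S) (X.obj.Fdot (D.s x)) = Y.obj.Fdot (g.g₁ x) := by
  rw [← D.psi_sub, baseChange_psi, gT_sub, map_zero, add_zero, g₁_sub]

theorem baseChange_F (x : X.obj.P) :
    g.f₀.baseChange (W p n S) (X.obj.F x) = Y.obj.F (g.f₀ x) := by
  have h1 : g.f₀.baseChange (W p n S) (X.obj.F (D.e x)) = Y.obj.F (g.f₀ (D.e x)) := by
    rw [← D.psi_e, baseChange_psi, g.g₁_e, map_zero, zero_add, g.gT_e, f₀_e]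
  have h2 : g.f₀.baseChange (W p n S) (X.obj.F (x - D.e x)) = Y.obj.F (g.f₀ (x - D.e x)) := by
    rw [f₀_sub, ← D.iota_s, RelDisplay.F_iota, map_smul, baseChange_Fdot_s, RelDisplay.F_iota]
  have h3 := congrArg₂ (· + ·) h2 h1
  simpa only [← map_add, sub_add_cancel] using h3

end ApproxHom

theorem Lift.exists_liftHom (hp : IsNilpotent (p : S)) (hf : Function.Surjective f)
    (hc : DPCompat γ δ (RingHom.id S)) (X : Lift f 𝔞 γ h Xbar) (Y : Lift f (RingHom.ker f) δ h' Xbar) :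
    Nonempty (LiftHom hab X Y) := by
  have hp' : IsNilpotent (p : R) := by simpa using hp.map f
  obtain ⟨D⟩ := X.obj.exists_normalDec hp
  obtain ⟨g⟩ := ApproxHom.exists_initial hp hf D Y
  obtain ⟨g⟩ := g.exists_zero hp
  have htw (z) : RelDisplay.twMap (toMapId g.f₀) z = g.f₀.baseChange (W p n S) z :=
    tensorMap_eq_baseChange (f := toMapId g.f₀) W.map_id' (fun _ => rfl) z
  have hF (x) : RelDisplay.twMap (toMapId g.f₀) (X.obj.F x) = Y.obj.F (g.f₀ x) := by
    rw [htw, g.baseChange_F]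
  let k : RelDisplay.Hom (RingHom.id S) hab X.obj Y.obj :=
    RelDisplay.Hom.ofP hp hc (toMapId g.f₀) (fun y => by
      change ∃ y', Y.obj.iota y' = g.f₀ (X.obj.iota y) ∧ _
      rw [htw]
      -- The L-part of y is handled by `g₁`; only the part in 𝒥T is left.
      suffices H : ∀ z ∈ Submodule.span (CalW p n S) {y | ∃ j x, y = X.obj.eps j (D.e x)},
          ∃ y', Y.obj.iota y' = g.f₀ (X.obj.iota z) ∧
            Y.obj.Fdot y' = g.f₀.baseChange (W p n S) (X.obj.Fdot z) by
        obtain ⟨y', h1, h2⟩ := H _ (D.sub_mem y)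
        refine ⟨g.g₁ (X.obj.iota y) + y', ?_, ?_⟩
        · rw [map_add, h1, ← g.f₀_sub, ← D.iota_s, ← map_add, ← map_add, add_sub_cancel]
        · rw [map_add, h2, ← g.baseChange_Fdot_s, ← map_add, ← map_add, add_sub_cancel]
      intro z hz
      induction hz using Submodule.span_induction with
      | mem z hz =>
        obtain ⟨j, x, rfl⟩ := hz
        refine ⟨Y.obj.eps (J.map p n (RingHom.id S) hab j) (g.f₀ (D.e x)), ?_, ?_⟩
        · rw [Y.obj.iota_eps, X.obj.iota_eps, map_smul]
          change CalW.of p n S (W.map p (n + 1) (RingHom.id S) j) • _ = _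
          rw [W.map_id']
        · rw [Y.obj.Fdot_eps, X.obj.Fdot_eps, map_smul, g.baseChange_F, ← map_sigmaDot (φ := RingHom.id S) hab hc,
            W.map_id']
      | zero => exact ⟨0, by simp only [map_zero], by simp only [map_zero]⟩
      | add z w _ _ hz hw =>
        obtain ⟨y, h1, h2⟩ := hz
        obtain ⟨y', h1', h2'⟩ := hw
        exact ⟨y + y', by simp only [map_add, h1, h1'], by simp only [map_add, h2, h2']⟩
      | smul a z _ hz =>
        obtain ⟨y, h1, h2⟩ := hz
        exact ⟨a • y, by simp only [map_smul, h1], by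
          simp only [LinearMap.map_smulₛₗ, h2, RingHom.id_apply]⟩) hF
  exact ⟨⟨k, g.red_f₀, Lift.red₁_of_red₀ hp' k g.red_f₀⟩⟩

end Existence

end Disp
end

noncomputable section

namespace Disp

/-! ### Logarithmic coordinates on W_n(S) -/

section TruncatedLog

variable {p : ℕ} [Fact p.Prime] {n : ℕ} {S R : Type u} [CommRing S] [CommRing R] {f : S →+* R}
  {γ : DividedPowers (RingHom.ker f)}

variable (γ n) in
/-- The `i`-th logarithmic coordinate of a truncated Witt vector over `ker f`. -/
def tglog (i : ℕ) (b : W p n S) : S := glog γ i (exists_truncate b).choose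

variable (γ n) in
/-- The truncated Witt vectors whose first `i + 1` entries lie in `ker f`. -/
def tcoeff (i : ℕ) : Ideal (W p n S) := (coeffIdeal γ (i + 1)).map (WittVector.truncate n)

theorem truncate_mem_tcoeff {i : ℕ} (hi : i < n) {ξ : WittVector p S} :
    WittVector.truncate n ξ ∈ tcoeff n γ i ↔ ξ ∈ coeffIdeal γ (i + 1) := by
  refine ⟨fun h => ?_, fun h => Ideal.mem_map_of_mem _ h⟩
  obtain ⟨η, hη, h⟩ := (Ideal.mem_map_iff_of_surjective _
    (WittVector.truncate_surjective p n S)).1 h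
  have h1 : WittVector.truncate n (ξ - η) = 0 := by rw [map_sub, h, sub_self]
  have h2 : ξ - η ∈ coeffIdeal γ (i + 1) := mem_coeffIdeal.2 fun j hj => by
    rw [(WittVector.mem_ker_truncate n (ξ - η)).1 h1 j (by omega)]
    exact Ideal.zero_mem _
  simpa using Ideal.add_mem _ h2 hη

theorem ker_map_le_tcoeff {i : ℕ} (hi : i < n) : RingHom.ker (W.map p n f) ≤ tcoeff n γ i := by
  intro b h
  obtain ⟨ξ, rfl⟩ := exists_truncate b
  rw [RingHom.mem_ker, W.map_truncate, ← RingHom.mem_ker, WittVector.mem_ker_truncate] at h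
  refine (truncate_mem_tcoeff hi).2 (mem_coeffIdeal.2 fun j hj => ?_)
  have := h j (by omega)
  rwa [WittVector.map_coeff] at this

theorem tglog_truncate {i : ℕ} (hi : i < n) {ξ : WittVector p S}
    (hξ : ξ ∈ coeffIdeal γ (i + 1)) : tglog n γ i (WittVector.truncate n ξ) = glog γ i ξ :=
  (glog_congr hi hξ (exists_truncate (WittVector.truncate n ξ)).choose_spec.symm).symm

theorem tglog_mem {i : ℕ} (hi : i < n) {b : W p n S} (hb : b ∈ tcoeff n γ i) :
    tglog n γ i b ∈ RingHom.ker f := by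
  obtain ⟨ξ, rfl⟩ := exists_truncate b
  rw [truncate_mem_tcoeff hi] at hb
  rw [tglog_truncate hi hb]
  exact glog_mem hb

theorem tglog_add {i : ℕ} (hi : i < n) {b c : W p n S} (hb : b ∈ tcoeff n γ i)
    (hc : c ∈ tcoeff n γ i) : tglog n γ i (b + c) = tglog n γ i b + tglog n γ i c := by
  obtain ⟨ξ, rfl⟩ := exists_truncate b
  obtain ⟨η, rfl⟩ := exists_truncate c
  rw [truncate_mem_tcoeff hi] at hb hc
  rw [← map_add, tglog_truncate hi hb, tglog_truncate hi hc, tglog_truncate hi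
    (Ideal.add_mem _ hb hc), glog_add hb hc]

theorem tglog_zero {i : ℕ} (hi : i < n) : tglog n γ i (0 : W p n S) = 0 := by
  have h := tglog_add (γ := γ) (p := p) hi (Ideal.zero_mem _) (Ideal.zero_mem _)
  rw [add_zero] at h
  exact left_eq_add.1 h

theorem tglog_sum {i : ℕ} (hi : i < n) {ι : Type*} (s : Finset ι) {b : ι → W p n S}
    (hb : ∀ a, b a ∈ tcoeff n γ i) :
    tglog n γ i (∑ a ∈ s, b a) = ∑ a ∈ s, tglog n γ i (b a) := by
  classical
  induction s using Finset.induction_on with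
  | empty => rw [Finset.sum_empty, Finset.sum_empty, tglog_zero hi]
  | insert a s ha ih =>
    rw [Finset.sum_insert ha, Finset.sum_insert ha,
      tglog_add hi (hb a) (Ideal.sum_mem _ fun c _ => hb c), ih]

theorem tglog_mul {i : ℕ} (hi : i < n) (η : WittVector p S) {b : W p n S}
    (hb : b ∈ tcoeff n γ i) :
    tglog n γ i (WittVector.truncate n η * b) =
      WittVector.ghostComponent i η * tglog n γ i b := by
  obtain ⟨ξ, rfl⟩ := exists_truncate b
  rw [truncate_mem_tcoeff hi] at hb
  rw [← map_mul, tglog_truncate hi hb, tglog_truncate hi (Ideal.mul_mem_left _ _ hb),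
    glog_mul _ hb]

/-- The logarithmic coordinates of `F(ζ)`. -/
theorem tglog_frob {i : ℕ} (hi : i + 1 < n) {c : CalW p n S}
    (hc : CalW.res p n S c ∈ tcoeff n γ (i + 1)) :
    CalW.frob p n S c ∈ tcoeff n γ i ∧
      tglog n γ i (CalW.frob p n S c) = p * tglog n γ (i + 1) (CalW.res p n S c) := by
  obtain ⟨c, rfl⟩ := CalW.of_surjective c
  obtain ⟨ζ, rfl⟩ := exists_truncate c
  rw [CalW.res_of, truncate_res, truncate_mem_tcoeff hi] at hc
  rw [CalW.frob_of, W.frob_truncate, CalW.res_of, truncate_res]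
  have h1 : WittVector.frobenius ζ ∈ coeffIdeal γ (i + 1) := by
    rw [frobenius_eq_vinv hc.1]
    exact Ideal.mul_mem_left _ _ hc.2
  exact ⟨(truncate_mem_tcoeff (by omega)).2 h1, by
    rw [tglog_truncate hi hc, tglog_truncate (by omega) h1, glog_frobenius hc]⟩

/-- The logarithmic coordinates of `σ̇(ξ)`. -/
theorem tglog_sigmaDot {i : ℕ} (hi : i + 1 < n) {j : J p n (RingHom.ker f)}
    (hj : W.res p n S j ∈ tcoeff n γ (i + 1)) :
    sigmaDot p n γ j ∈ tcoeff n γ i ∧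
      tglog n γ i (sigmaDot p n γ j) = tglog n γ (i + 1) (W.res p n S j) := by
  obtain ⟨j, h⟩ := j
  obtain ⟨ω, rfl⟩ := exists_truncate j
  rw [truncate_res, truncate_mem_tcoeff hi] at hj
  rw [sigmaDot_truncate, truncate_res]
  exact ⟨(truncate_mem_tcoeff (by omega)).2 hj.2, by
    rw [tglog_truncate hi hj, tglog_truncate (by omega) hj.2, glog_succ]⟩

theorem tglog_truncate_zeroth [NeZero n] (b : W p n S) :
    tglog n γ 0 b = W.zeroth p n S b := by
  conv_rhs => rw [← (exists_truncate b).choose_spec, truncate_zeroth]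
  rfl

/-- Modulo p the ghost components depend only on the zeroth entry; hence the coordinates below
become Frobenius-semilinear. -/
theorem ghostComponent_modEq (i : ℕ) (η : WittVector p S) :
    ∃ t, WittVector.ghostComponent i η = η.coeff 0 ^ p ^ i + p * t := by
  rw [ghostComponent_eq_sum, Finset.sum_range_succ']
  refine ⟨∑ k ∈ Finset.range i, (p : S) ^ k * η.coeff (k + 1) ^ p ^ (i - (k + 1)), ?_⟩
  rw [Finset.mul_sum, add_comm]
  simp [pow_succ', mul_assoc]

end TruncatedLog

variable {p : ℕ} [Fact p.Prime] {n : ℕ} [NeZero n] {S R : Type u} [CommRing S] [CommRing R]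
  {f : S →+* R} {Xbar : Display p n R}

/-! ### Logarithmic coordinates of the difference of two morphisms -/

section Difference

variable {𝔞 : Ideal S} {γ : DividedPowers 𝔞} {δ : DividedPowers (RingHom.ker f)}
  {h : 𝔞 ≤ (⊥ : Ideal R).comap f} {hab : 𝔞 ≤ RingHom.ker f}
  {h' : RingHom.ker f ≤ (⊥ : Ideal R).comap f}
  {X : Lift f 𝔞 γ h Xbar} {Y : Lift f (RingHom.ker f) δ h' Xbar} (α β : LiftHom hab X Y)

/-- The difference of two morphisms of lifts on the modules `P`. -/
def liftDiff : X.obj.P →ₗ[CalW p n S] Y.obj.P := ofMapId α.hom.f₀ - ofMapId β.hom.f₀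

theorem liftDiff_apply (x : X.obj.P) : liftDiff α β x = α.hom.f₀ x - β.hom.f₀ x := rfl

theorem red_liftDiff (x : X.obj.P) : Y.red.f₀ (liftDiff α β x) = 0 := by
  rw [liftDiff_apply, map_sub, α.red₀, β.red₀, sub_self]

theorem baseChange_liftDiff_Fdot (y : X.obj.Q) :
    (liftDiff α β).baseChange (W p n S) (X.obj.Fdot y) =
      Y.obj.Fdot (α.hom.f₁ y - β.hom.f₁ y) := by
  have h1 (α : LiftHom hab X Y) : (ofMapId α.hom.f₀).baseChange (W p n S) (X.obj.Fdot y) =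
      Y.obj.Fdot (α.hom.f₁ y) := by
    rw [← α.hom.map_Fdot]
    exact (tensorMap_eq_baseChange (f := α.hom.f₀) W.map_id' (fun _ => rfl) _).symm
  rw [liftDiff, LinearMap.baseChange_sub, LinearMap.sub_apply, h1, h1, map_sub]

theorem iota_sub (y : X.obj.Q) :
    Y.obj.iota (α.hom.f₁ y - β.hom.f₁ y) = liftDiff α β (X.obj.iota y) := by
  rw [map_sub, ← α.hom.map_iota, ← β.hom.map_iota, liftDiff_apply]

variable (hp : IsNilpotent (p : S)) (hf : Function.Surjective f)

include hp hf

/-- Both morphisms reduce to the identity, so their difference has coefficients in the kernel of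
W_n(S) → W_n(R). -/
theorem liftDiff_mem (χ : (W p n S ⊗[CalW p n S] Y.obj.P) →ₗ[W p n S] W p n S)
    (z : W p n S ⊗[CalW p n S] X.obj.P) :
    χ ((liftDiff α β).baseChange (W p n S) z) ∈ RingHom.ker (W.map p n f) := by
  have hY := Y.isBaseChange.isSurjBaseChange hp hf
  have h1 : tensorMap (W.map p n f) (CalW.map_algebraMap_W p n f) Y.red.f₀
      ((liftDiff α β).baseChange (W p n S) z) = 0 := by
    induction z with
    | zero => simp only [map_zero]
    | add x y hx hy => simp only [map_add, hx, hy, add_zero]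
    | tmul b x =>
      rw [LinearMap.baseChange_tmul, tensorMap_tmul, red_liftDiff, TensorProduct.tmul_zero]
  have h2 := mem_smul_of_tensorMap_eq_zero (CalW.map_surjective hf) (W.map_surjective hf) hY.surj₀
    hY.ker₀ h1
  generalize (liftDiff α β).baseChange (W p n S) z = w at h2
  induction h2 using Submodule.smul_induction_on' with
  | smul b hb z _ => rw [map_smul, smul_eq_mul]; exact Ideal.mul_mem_right _ _ hb
  | add x _ y _ hx hy => rw [map_add]; exact Ideal.add_mem _ hx hy

omit hp hf in
variable (δ) in
/-- The `i`-th logarithmic coordinate of the value of `χ` at the image of `z` under the difference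
of two morphisms. -/
def dglog (α β : LiftHom hab X Y) (i : ℕ)
    (χ : (W p n S ⊗[CalW p n S] Y.obj.P) →ₗ[W p n S] W p n S)
    (z : W p n S ⊗[CalW p n S] X.obj.P) : S :=
  tglog n δ i (χ ((liftDiff α β).baseChange (W p n S) z))

theorem liftDiff_mem_tcoeff {i : ℕ} (hi : i < n)
    (χ : (W p n S ⊗[CalW p n S] Y.obj.P) →ₗ[W p n S] W p n S)
    (z : W p n S ⊗[CalW p n S] X.obj.P) :
    χ ((liftDiff α β).baseChange (W p n S) z) ∈ tcoeff n δ i :=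
  ker_map_le_tcoeff hi (liftDiff_mem α β hp hf χ z)

theorem dglog_mem {i : ℕ} (hi : i < n) (χ z) : dglog δ α β i χ z ∈ RingHom.ker f :=
  tglog_mem hi (liftDiff_mem_tcoeff α β hp hf hi χ z)

theorem dglog_add {i : ℕ} (hi : i < n) (χ z w) :
    dglog δ α β i χ (z + w) = dglog δ α β i χ z + dglog δ α β i χ w := by
  unfold dglog
  rw [map_add, map_add, tglog_add hi (liftDiff_mem_tcoeff α β hp hf hi χ z)
    (liftDiff_mem_tcoeff α β hp hf hi χ w)]

theorem dglog_smul {i : ℕ} (hi : i < n) (χ z) (η : WittVector p S) :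
    dglog δ α β i χ (WittVector.truncate n η • z) =
      WittVector.ghostComponent i η * dglog δ α β i χ z := by
  unfold dglog
  rw [map_smul, map_smul, smul_eq_mul, tglog_mul hi η (liftDiff_mem_tcoeff α β hp hf hi χ z)]

/-- The recursion formula for the logarithmic coordinates of the difference of two morphisms. -/
theorem dglog_Fdot {i : ℕ} (hi : i + 1 < n) (D : Y.obj.NormalDec) {r : ℕ} {x : Fin r → Y.obj.P}
    {φ : Fin r → Y.obj.P →ₗ[CalW p n S] CalW p n S} (hx : ∀ y, ∑ a, φ a y • x a = y)
    (χ : (W p n S ⊗[CalW p n S] Y.obj.P) →ₗ[W p n S] W p n S) (η η' : Fin r → WittVector p S)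
    (hη : ∀ a, WittVector.truncate n (η a) = χ (Y.obj.F (x a)))
    (hη' : ∀ a, WittVector.truncate n (η' a) = χ (Y.obj.Fdot (D.s (x a)))) (y : X.obj.Q) :
    dglog δ α β i χ (X.obj.Fdot y) =
      ∑ a, WittVector.ghostComponent i (η a) *
        dglog δ α β (i + 1) (dualExt (W p n S) ((φ a).comp D.e)) (1 ⊗ₜ X.obj.iota y) +
      p * ∑ a, WittVector.ghostComponent i (η' a) *
        dglog δ α β (i + 1) (dualExt (W p n S) (φ a)) (1 ⊗ₜ X.obj.iota y) := by
  have hi' : i < n := by omega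
  set q := α.hom.f₁ y - β.hom.f₁ y with hq
  have hιq : Y.obj.iota q = liftDiff α β (X.obj.iota y) := iota_sub α β y
  -- Here q is the difference on Q. Its L-part contributes Frobenius images of coefficients, its
  -- 𝒥T-part contributes values of σ̇.
  obtain ⟨ξ, h1, h2, -⟩ := D.exists_expansion hx q
  have hdual (φ : Y.obj.P →ₗ[CalW p n S] CalW p n S) :
      dualExt (W p n S) φ ((liftDiff α β).baseChange (W p n S) (1 ⊗ₜ X.obj.iota y)) =
        CalW.res p n S (φ (Y.obj.iota q)) := by
    rw [LinearMap.baseChange_tmul, dualExt_tmul, one_mul, hιq]; rfl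
  have hker (φ : Y.obj.P →ₗ[CalW p n S] CalW p n S) :
      CalW.res p n S (φ (Y.obj.iota q)) ∈ tcoeff n δ (i + 1) := by
    rw [← hdual]; exact liftDiff_mem_tcoeff α β hp hf hi _ _
  have hξ (a) : W.res p n S (ξ a) = CalW.res p n S (φ a (D.e (Y.obj.iota q))) := by
    rw [← h2, CalW.res_of]
  have h3 : Y.obj.Fdot q = ∑ a, (CalW.frob p n S (φ a (Y.obj.iota q)) • Y.obj.Fdot (D.s (x a)) +
      sigmaDot p n δ (ξ a) • Y.obj.F (x a)) := by
    have h4 : D.s (Y.obj.iota q) = ∑ a, φ a (Y.obj.iota q) • D.s (x a) := by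
      conv_lhs => rw [← hx (Y.obj.iota q), map_sum]
      exact Finset.sum_congr rfl fun a _ => map_smul _ _ _
    conv_lhs => rw [h1, h4]
    rw [map_add, map_sum, map_sum, ← Finset.sum_add_distrib]
    refine Finset.sum_congr rfl fun a _ => ?_
    rw [Y.obj.Fdot.map_smulₛₗ, Y.obj.Fdot_eps]
  -- Both operations lower the index by one, but only the Frobenius brings a factor p; this accounts
  -- for the two sums.
  have h5 (a) := tglog_frob hi (hker (φ a))
  have h6 (a) := tglog_sigmaDot hi (j := ξ a) (γ := δ)
    (by rw [hξ]; exact hker ((φ a).comp D.e))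
  unfold dglog
  rw [baseChange_liftDiff_Fdot, ← hq, h3, map_sum, tglog_sum hi', Finset.mul_sum,
    ← Finset.sum_add_distrib]
  · refine Finset.sum_congr rfl fun a _ => ?_
    rw [map_add, map_smul, map_smul, smul_eq_mul, smul_eq_mul, ← hη, ← hη',
      mul_comm _ (WittVector.truncate n (η' a)), mul_comm _ (WittVector.truncate n (η a)),
      tglog_add hi' (Ideal.mul_mem_left _ _ (h5 a).1) (Ideal.mul_mem_left _ _ (h6 a).1),
      tglog_mul hi' _ (h5 a).1, tglog_mul hi' _ (h6 a).1, (h5 a).2, (h6 a).2, hdual, hdual, hξ,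
      LinearMap.comp_apply]
    ring
  · intro a
    rw [map_add, map_smul, map_smul, smul_eq_mul, smul_eq_mul]
    exact Ideal.add_mem _ (Ideal.mul_mem_right _ _ (h5 a).1) (Ideal.mul_mem_right _ _ (h6 a).1)

end Difference

end Disp
end

noncomputable section

namespace Disp

/-! ### Factorization through iterates of V -/

section ExtendScalars

open scoped ChangeOfRings

variable {R₀ R₁ C K : Type u} [CommRing R₀] [CommRing R₁] [CommRing C] [AddCommGroup K] [Module C K]

/-- The element `1 ⊗ m` of the extension of scalars. -/
def extOne (σ : R₀ →+* R₁) (M : ModuleCat.{u} R₀) (m : M) :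
    (ModuleCat.extendScalars.{u, u, u} σ).obj M := (1 : R₁) ⊗ₜ[R₀, σ] m

/-- The universal property of the extension of scalars, for semilinear maps. -/
theorem exists_extendScalars_lift (σ : R₀ →+* R₁) (θ : R₁ →+* C) {M : ModuleCat.{u} R₀}
    (G : M →ₛₗ[θ.comp σ] K) :
    ∃ L : ((ModuleCat.extendScalars.{u, u, u} σ).obj M) →ₛₗ[θ] K,
      ∀ m : M, L (extOne σ M m) = G m := by
  let _ : Module R₁ K := Module.compHom K θ
  let g : M ⟶ (ModuleCat.restrictScalars σ).obj (ModuleCat.of R₁ K) :=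
    ModuleCat.ofHom (Y := (ModuleCat.restrictScalars σ).obj (ModuleCat.of R₁ K))
    { toFun := fun m => G m
      map_add' := fun x y => map_add G x y
      map_smul' := fun a x => G.map_smulₛₗ a x }
  let L := (ModuleCat.ExtendRestrictScalarsAdj.HomEquiv.fromExtendScalars σ g).hom
  exact ⟨{ toFun := fun z => L z, map_add' := fun x y => map_add L x y,
           map_smul' := fun a x => map_smul L a x }, fun m => one_smul R₁ (G m)⟩

theorem extendScalars_hom_apply_eq {σ : R₀ →+* R₁} {M : ModuleCat.{u} R₀} {Z : ModuleCat.{u} R₁}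
    (g g' : (ModuleCat.extendScalars.{u, u, u} σ).obj M ⟶ Z)
    (h : ∀ m : M, g.hom (extOne σ M m) = g'.hom (extOne σ M m))
    (z : (ModuleCat.extendScalars.{u, u, u} σ).obj M) : g.hom z = g'.hom z := by
  rw [ModuleCat.ExtendScalars.hom_ext h]

theorem extendScalars_semilinear_ext {σ : R₀ →+* R₁} {θ : R₁ →+* C} {M : ModuleCat.{u} R₀}
    {L L' : ((ModuleCat.extendScalars.{u, u, u} σ).obj M) →ₛₗ[θ] K}
    (h : ∀ m : M, L (extOne σ M m) = L' (extOne σ M m))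
    (z : (ModuleCat.extendScalars.{u, u, u} σ).obj M) : L z = L' z := by
  let _ : Module R₁ K := Module.compHom K θ
  let f (L : ((ModuleCat.extendScalars.{u, u, u} σ).obj M) →ₛₗ[θ] K) :
      (ModuleCat.extendScalars.{u, u, u} σ).obj M ⟶ ModuleCat.of R₁ K :=
    ModuleCat.ofHom (X := (ModuleCat.extendScalars.{u, u, u} σ).obj M) (Y := ModuleCat.of R₁ K)
      { toFun := fun z => L z, map_add' := fun x y => map_add L x y,
                      map_smul' := fun a x => L.map_smulₛₗ a x }
  exact extendScalars_hom_apply_eq (f L) (f L') h z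

/-- The iterates of the Frobenius of `R₀` followed by `θ`. -/
def iterTwist (σ : R₀ →+* R₀) (θ : R₀ →+* C) : ℕ → (R₀ →+* C)
  | 0 => θ
  | j + 1 => (iterTwist σ θ j).comp σ

/-- If each functional of level j is V followed by the extension of a combination of functionals of
level j + 1, then l substitutions factor it through the l-th iterate of V. -/
theorem exists_factor_iterHom {σ : R₀ →+* R₀} {θ : R₀ →+* C} {N : ModuleCat.{u} R₀}
    (V : N ⟶ (ModuleCat.extendScalars.{u, u, u} σ).obj N) {Φ : Type*} {k : ℕ}
    (D : (j : ℕ) → Φ → (N →ₛₗ[iterTwist σ θ j] K))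
    (hD : ∀ j φ, j < k → ∃ (s : ℕ) (u : Fin s → C) (ψ : Fin s → Φ)
      (L : ((ModuleCat.extendScalars.{u, u, u} σ).obj N) →ₛₗ[iterTwist σ θ j] K),
      (∀ m, D j φ m = L (V.hom m)) ∧
      ∀ m : N, L (extOne σ N m) = ∑ a, u a • D (j + 1) (ψ a) m)
    (l j : ℕ) (hj : j + l ≤ k) (φ : Φ) :
    ∃ G : (iterObj (ModuleCat.extendScalars.{u, u, u} σ) N l : ModuleCat.{u} R₀) →ₛₗ[iterTwist σ θ j] K,
      ∀ m, D j φ m = G ((iterHom (ModuleCat.extendScalars.{u, u, u} σ) V l).hom m) := by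
  induction l generalizing j φ with
  | zero => exact ⟨D j φ, fun m => rfl⟩
  | succ l ih =>
    obtain ⟨s, u, ψ, L, hL, hL'⟩ := hD j φ (by omega)
    choose G hG using fun a => ih (j + 1) (by omega) (ψ a)
    let G' : (iterObj (ModuleCat.extendScalars.{u, u, u} σ) N l : ModuleCat.{u} R₀)
      →ₛₗ[iterTwist σ θ (j + 1)] K := ∑ a, u a • G a
    have hG' (t) : G' t = ∑ a, u a • G a t := LinearMap.sum_apply _ _ _
    obtain ⟨L', hL''⟩ := exists_extendScalars_lift σ (iterTwist σ θ j) G'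
    refine ⟨L', fun m => ?_⟩
    rw [hL]
    let ih' := iterHom (ModuleCat.extendScalars.{u, u, u} σ) V l
    have h1 : L (V.hom m) = (L'.comp ((ModuleCat.extendScalars.{u, u, u} σ).map ih').hom)
        (V.hom m) := by
      refine extendScalars_semilinear_ext (fun m => ?_) _
      rw [hL']
      change _ = L' (((ModuleCat.extendScalars.{u, u, u} σ).map ih').hom _)
      have h2 : ((ModuleCat.extendScalars.{u, u, u} σ).map ih').hom (extOne σ N m) =
          extOne σ _ (ih'.hom m) := ModuleCat.ExtendScalars.map_tmul _ _ _ _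
      rw [h2, hL'']
      refine Eq.trans ?_ (hG' _).symm
      exact Finset.sum_congr rfl fun a _ => by rw [hG]
    exact h1

end ExtendScalars

/-! ### The Frobenius of S/p over R/p -/

section Twist

variable {p : ℕ} [Fact p.Prime] {S R : Type u} [CommRing S] [CommRing R] {f : S →+* R}

theorem pow_mem_span (γ : DividedPowers (RingHom.ker f)) {s : S} (hs : s ∈ RingHom.ker f) :
    s ^ p ∈ Ideal.span {(p : S)} := by
  have h := γ.factorial_mul_dpow_eq_pow (n := p) hs
  rw [← h, ← Nat.mul_factorial_pred (Fact.out : p.Prime).ne_zero, Nat.cast_mul, mul_assoc]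
  exact Ideal.mul_mem_right _ _ (Ideal.mem_span_singleton_self _)

/-- The Frobenius of `S/p` factors through `R/p`. -/
theorem exists_frobenius_factor (hf : Function.Surjective f)
    (γ : DividedPowers (RingHom.ker f)) :
    ∃ ϑ : (R ⧸ Ideal.span {(p : R)}) →+* (S ⧸ Ideal.span {(p : S)}),
      ∀ s, ϑ (Ideal.Quotient.mk _ (f s)) = Ideal.Quotient.mk _ s ^ p := by
  let q := (Ideal.Quotient.mk (Ideal.span {(p : R)})).comp f
  have hq : Function.Surjective q := Ideal.Quotient.mk_surjective.comp hf
  let g := (frobeniusOfZero (natCast_eq_zero_mod p S)).comp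
    (Ideal.Quotient.mk (Ideal.span {(p : S)}))
  have hk : RingHom.ker q ≤ RingHom.ker g := by
    intro s hs
    have h1 : f s ∈ Ideal.span {(p : R)} := Ideal.Quotient.eq_zero_iff_mem.1 hs
    obtain ⟨t, ht⟩ := Ideal.mem_span_singleton'.1 h1
    obtain ⟨t, rfl⟩ := hf t
    -- Modulo p the element s may be moved into ker f, where p-th powers are multiples of p by the
    -- divided powers.
    have h2 : s - t * p ∈ RingHom.ker f := by
      rw [RingHom.mem_ker, map_sub, map_mul, map_natCast, ht, sub_self]
    have h3 : Ideal.Quotient.mk (Ideal.span {(p : S)}) s = Ideal.Quotient.mk _ (s - t * p) := by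
      rw [Ideal.Quotient.eq, sub_sub_cancel]
      exact Ideal.mul_mem_left _ _ (Ideal.mem_span_singleton_self _)
    change Ideal.Quotient.mk _ s ^ p = 0
    rw [h3, ← map_pow, Ideal.Quotient.eq_zero_iff_mem]
    exact pow_mem_span γ h2
  exact ⟨RingHom.liftOfSurjective q hq ⟨g, hk⟩, fun s =>
    RingHom.liftOfRightInverse_comp_apply _ _ _ ⟨g, hk⟩ s⟩

theorem iterTwist_apply
    {ϑ : (R ⧸ Ideal.span {(p : R)}) →+* (S ⧸ Ideal.span {(p : S)})}
    (hϑ : ∀ s, ϑ (Ideal.Quotient.mk _ (f s)) = Ideal.Quotient.mk _ s ^ p) (j : ℕ) (s : S) :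
    iterTwist (frobeniusOfZero (natCast_eq_zero_mod p R)) ϑ j (Ideal.Quotient.mk _ (f s)) =
      Ideal.Quotient.mk _ s ^ p ^ (j + 1) := by
  induction j generalizing s with
  | zero => rw [zero_add, pow_one]; exact hϑ s
  | succ j ih =>
    have h1 : frobeniusOfZero (natCast_eq_zero_mod p R) (Ideal.Quotient.mk _ (f s)) =
        Ideal.Quotient.mk _ (f (s ^ p)) := by rw [map_pow, map_pow]; rfl
    change iterTwist _ ϑ j (frobeniusOfZero (natCast_eq_zero_mod p R) _) = _
    rw [h1, ih, map_pow, ← pow_mul, ← pow_succ']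

end Twist

/-! ### Ideals modulo p -/

section QuotientModule

variable {S : Type u} [CommRing S] (p : ℕ) (𝔠 : Ideal S)

/-- The module `𝔠/p𝔠`. -/
abbrev ModP : Type u := 𝔠 ⧸ (Ideal.span {(p : S)} • ⊤ : Submodule S 𝔠)

variable {p 𝔠}

theorem mem_mul_of_mk_eq_zero {x : 𝔠} (h : (Submodule.Quotient.mk x : ModP p 𝔠) = 0) :
    (x : S) ∈ Ideal.span {(p : S)} * 𝔠 := by
  rw [Submodule.Quotient.mk_eq_zero] at h
  induction h using Submodule.smul_induction_on' with
  | smul a ha x _ => exact Ideal.mul_mem_mul ha x.2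
  | add x _ y _ hx hy => exact Ideal.add_mem _ hx hy

theorem mk_eq_sum {r : ℕ} {x : 𝔠} {s t : Fin r → S} {d d' : Fin r → 𝔠}
    (h : (x : S) = ∑ a, s a * d a + p * ∑ a, t a * d' a) :
    (Submodule.Quotient.mk x : ModP p 𝔠) =
      ∑ a, (Ideal.Quotient.mk (Ideal.span {(p : S)}) (s a)) •
        (Submodule.Quotient.mk (d a) : ModP p 𝔠) := by
  have h1 : x = ∑ a, s a • d a + (p : S) • ∑ a, t a • d' a := by
    refine Subtype.ext ?_
    rw [h]
    simp only [Submodule.coe_add, Submodule.coe_sum, Submodule.coe_smul, smul_eq_mul]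
  have h2 : (∑ a, (Ideal.Quotient.mk (Ideal.span {(p : S)}) (s a)) •
        (Submodule.Quotient.mk (d a) : ModP p 𝔠)) = Submodule.Quotient.mk (∑ a, s a • d a) := by
    rw [← Submodule.mkQ_apply, map_sum]
    rfl
  rw [h2, Submodule.Quotient.eq, h1, add_sub_cancel_left]
  exact Submodule.smul_mem_smul (Ideal.mem_span_singleton_self _) Submodule.mem_top

end QuotientModule

end Disp
end

noncomputable section

namespace Disp

variable {p : ℕ} [Fact p.Prime] {n : ℕ} [NeZero n] {S R : Type u} [CommRing S] [CommRing R]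

theorem RelDisplay.Hom.IsSurjBaseChange.comp {S₁ S₂ S₃ : Type u} [CommRing S₁] [CommRing S₂]
    [CommRing S₃] {𝔞₁ : Ideal S₁} {𝔞₂ : Ideal S₂} {𝔞₃ : Ideal S₃} {γ₁ : DividedPowers 𝔞₁}
    {γ₂ : DividedPowers 𝔞₂} {γ₃ : DividedPowers 𝔞₃} {φ : S₁ →+* S₂} {φ' : S₂ →+* S₃}
    {h : 𝔞₁ ≤ 𝔞₂.comap φ} {h' : 𝔞₂ ≤ 𝔞₃.comap φ'} {h'' : 𝔞₁ ≤ 𝔞₃.comap (φ'.comp φ)}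
    {X : RelDisplay p n 𝔞₁ γ₁} {Y : RelDisplay p n 𝔞₂ γ₂} {Z : RelDisplay p n 𝔞₃ γ₃}
    {g : RelDisplay.Hom φ' h' Y Z} {f : RelDisplay.Hom φ h X Y} (hg : g.IsSurjBaseChange)
    (hf : f.IsSurjBaseChange) (hφ : Function.Surjective φ) :
    (RelDisplay.Hom.comp h'' rfl g f).IsSurjBaseChange := by
  refine ⟨hg.surj₀.comp hf.surj₀, fun x hx => ?_, hg.surj₁.comp hf.surj₁⟩
  have key (y : Y.P) (hy : y ∈ (RingHom.ker (CalW.map p n φ') • ⊤ : Submodule (CalW p n S₂) Y.P)) :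
      ∃ x ∈ (RingHom.ker (CalW.map p n (φ'.comp φ)) • ⊤ : Submodule (CalW p n S₁) X.P), f.f₀ x = y := by
    induction hy using Submodule.smul_induction_on' with
    | smul a ha y _ =>
      obtain ⟨a, rfl⟩ := CalW.map_surjective hφ a
      obtain ⟨x, rfl⟩ := hf.surj₀ y
      refine ⟨a • x, Submodule.smul_mem_smul ?_ Submodule.mem_top, f.f₀.map_smulₛₗ a x⟩
      rw [RingHom.mem_ker, CalW_map_comp] at ha
      exact ha
    | add x _ y _ hx hy =>
      obtain ⟨x, hx, rfl⟩ := hx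
      obtain ⟨y, hy, rfl⟩ := hy
      exact ⟨x + y, Submodule.add_mem _ hx hy, map_add _ _ _⟩
  obtain ⟨x', hx', h1⟩ := key _ (hg.ker₀ _ hx)
  rw [← sub_add_cancel x x']
  refine Submodule.add_mem _ ?_ hx'
  refine Submodule.smul_mono_left ?_ (hf.ker₀ (x - x') (by rw [map_sub, h1, sub_self]))
  intro a ha
  rw [RingHom.mem_ker, ← CalW_map_comp, (RingHom.mem_ker).1 ha, map_zero]

/-! ### Reduction of W_n(S) ⊗ P to the fiber -/

section FiberRed

variable {S' : Type u} [CommRing S'] {𝔞 : Ideal S} {γ : DividedPowers 𝔞} {𝔞' : Ideal S'}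
  {γ' : DividedPowers 𝔞'} {φ : S →+* S'} {h : 𝔞 ≤ 𝔞'.comap φ} {X : RelDisplay p n 𝔞 γ}
  {Z : RelDisplay p n 𝔞' γ'} (c : RelDisplay.Hom φ h X Z)

/-- The map `W_n(S) ⊗ P → S' ⊗ P'`. -/
def fiberRed : (W p n S ⊗[CalW p n S] X.P) →ₛₗ[φ.comp (W.zeroth p n S)] Z.Fiber :=
  tensorMap (φ.comp (W.zeroth p n S)) (fun x => CalW.map_algebraMap p n φ x) c.f₀

theorem fiberRed_iota (y : X.Q) :
    fiberRed c (1 ⊗ₜ X.iota y) = (1 : S') ⊗ₜ[CalW p n S'] Z.iota (c.f₁ y) := by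
  change (φ.comp (W.zeroth p n S)) 1 ⊗ₜ[CalW p n S'] c.f₀ _ = _
  rw [map_one, c.map_iota]

theorem fiberRed_Fdot (y : X.Q) : fiberRed c (X.Fdot y) =
    tensorMap (W.zeroth p n S') (ψ := RingHom.id (CalW p n S'))
      (fun _ => rfl) (LinearMap.id : Z.P →ₗ[CalW p n S'] Z.P) (Z.Fdot (c.f₁ y)) := by
  rw [← c.map_Fdot]
  exact (tensorMap_tensorMap (fun b => (W.map_zeroth p n φ b).symm) (fun _ => rfl) _).symm

variable {c}

theorem comp_zeroth_surjective (hφ : Function.Surjective φ) :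
    Function.Surjective (φ.comp (W.zeroth p n S)) := hφ.comp W.zeroth_surjective

theorem fiberRed_surjective (hc : c.IsSurjBaseChange) (hφ : Function.Surjective φ) :
    Function.Surjective (fiberRed c) :=
  tensorMap_surjective (comp_zeroth_surjective hφ) hc.surj₀

theorem mem_smul_of_fiberRed_eq_zero (hc : c.IsSurjBaseChange) (hφ : Function.Surjective φ)
    {z : W p n S ⊗[CalW p n S] X.P} (hz : fiberRed c z = 0) :
    z ∈ (RingHom.ker (φ.comp (W.zeroth p n S)) • ⊤ :
      Submodule (W p n S) (W p n S ⊗[CalW p n S] X.P)) :=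
  mem_smul_of_tensorMap_eq_zero (CalW.map_surjective hφ) (comp_zeroth_surjective hφ) hc.surj₀
    hc.ker₀ hz

end FiberRed

/-! ### Divisibility from nilpotence and uniqueness -/

section Step

variable {f : S →+* R} {Xbar : Display p n R} {𝔞 : Ideal S} {γ : DividedPowers 𝔞}
  {δ : DividedPowers (RingHom.ker f)}
  {h : 𝔞 ≤ (⊥ : Ideal R).comap f} {hab : 𝔞 ≤ RingHom.ker f}
  {h' : RingHom.ker f ≤ (⊥ : Ideal R).comap f}
  {X : Lift f 𝔞 γ h Xbar} {Y : Lift f (RingHom.ker f) δ h' Xbar} (α β : LiftHom hab X Y)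

/-- Modulo `p` the higher logarithmic coordinates descend to the reduction modulo `p`. -/
theorem exists_dglog_descent (hp : IsNilpotent (p : S)) (hf : Function.Surjective f)
    {ϑ : (R ⧸ Ideal.span {(p : R)}) →+* (S ⧸ Ideal.span {(p : S)})}
    (hϑ : ∀ s, ϑ (Ideal.Quotient.mk _ (f s)) = Ideal.Quotient.mk _ s ^ p)
    {h₀ : 𝔞 ≤ (⊥ : Ideal (R ⧸ Ideal.span {(p : R)})).comap ((Ideal.Quotient.mk _).comp f)}
    {X₀ : Display p n (R ⧸ Ideal.span {(p : R)})}
    {c : RelDisplay.Hom ((Ideal.Quotient.mk _).comp f) h₀ X.obj X₀} (hcs : c.IsSurjBaseChange)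
    {𝔠 : Ideal S} {j : ℕ} (hj : j + 1 < n) (χ : (W p n S ⊗[CalW p n S] Y.obj.P) →ₗ[W p n S] W p n S)
    (hc : ∀ z, dglog δ α β (j + 1) χ z ∈ 𝔠) :
    ∃ D : X₀.Fiber →ₛₗ[iterTwist (frobeniusOfZero (natCast_eq_zero_mod p R)) ϑ j] ModP p 𝔠,
      ∀ z, D (fiberRed c z) = Submodule.Quotient.mk ⟨dglog δ α β (j + 1) χ z, hc z⟩ := by
  have hq : Function.Surjective ((Ideal.Quotient.mk (Ideal.span {(p : R)})).comp f) :=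
    Ideal.Quotient.mk_surjective.comp hf
  let θ := iterTwist (frobeniusOfZero (natCast_eq_zero_mod p R)) ϑ j
  -- The scalar by which η acts on the (j+1)-st coordinate is, modulo p, the p^{j+1}-th power of its
  -- zeroth entry, and so depends only on the image of that entry in R/p.
  have hθ (η : WittVector p S) :
      (θ.comp (((Ideal.Quotient.mk _).comp f).comp (W.zeroth p n S))) (WittVector.truncate n η) =
        Ideal.Quotient.mk _ (WittVector.ghostComponent (j + 1) η) := by
    change θ (Ideal.Quotient.mk _ (f (W.zeroth p n S (WittVector.truncate n η)))) = _
    rw [truncate_zeroth, iterTwist_apply hϑ]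
    obtain ⟨t, ht⟩ := ghostComponent_modEq (j + 1) η
    rw [ht, map_add, map_mul, map_pow, map_natCast, natCast_eq_zero_mod, zero_mul, add_zero]
  let G : (W p n S ⊗[CalW p n S] X.obj.P) →ₛₗ[θ.comp
      (((Ideal.Quotient.mk _).comp f).comp (W.zeroth p n S))] ModP p 𝔠 :=
    { toFun := fun z => Submodule.Quotient.mk ⟨dglog δ α β (j + 1) χ z, hc z⟩
      map_add' := fun z w => congrArg Submodule.Quotient.mk
        (Subtype.ext (dglog_add α β hp hf hj χ z w) : (⟨_, hc _⟩ : 𝔠) = ⟨_, hc z⟩ + ⟨_, hc w⟩)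
      map_smul' := fun b z => by
        obtain ⟨η, rfl⟩ := exists_truncate b
        rw [hθ]
        exact congrArg Submodule.Quotient.mk (Subtype.ext (dglog_smul α β hp hf hj χ z η) :
          (⟨_, hc _⟩ : 𝔠) = WittVector.ghostComponent (j + 1) η • ⟨_, hc z⟩) }
  exact exists_descent (comp_zeroth_surjective hq) (fiberRed_surjective hcs hq)
    (fun z hz => mem_smul_of_fiberRed_eq_zero hcs hq hz) θ G

/-- Divisibility of the logarithmic coordinates of the difference of two morphisms of lifts
propagates by nilpotence. -/
theorem dglog_mem_mul (hp : IsNilpotent (p : S)) (hf : Function.Surjective f) {e : ℕ}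
    (hX : NilpotentOrderLE Xbar e) {k : ℕ} (hk : k < n) {𝔠 : Ideal S}
    (hc : ∀ j ≤ k, ∀ χ z, dglog δ α β j χ z ∈ 𝔠) {j : ℕ} (hj : j + (e + 1) ≤ k) (χ z) :
    dglog δ α β j χ z ∈ Ideal.span {(p : S)} * 𝔠 := by
  have hpR : IsNilpotent (p : R) := by simpa using hp.map f
  obtain ⟨X₀, g, hg, hnil⟩ := hX
  let I : Ideal R := Ideal.span {(p : R)}
  let R₀ := R ⧸ I
  let q : R →+* R₀ := Ideal.Quotient.mk I
  have hq : Function.Surjective q := Ideal.Quotient.mk_surjective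
  let σ : R₀ →+* R₀ := frobeniusOfZero (natCast_eq_zero_mod p R)
  obtain ⟨ϑ, hϑ⟩ := exists_frobenius_factor (p := p) hf δ
  let c : RelDisplay.Hom (q.comp f) (fun x hx => by
      have h1 := h hx
      rw [Ideal.mem_comap, Ideal.mem_bot] at h1 ⊢
      rw [RingHom.comp_apply, h1, map_zero]) X.obj X₀ := RelDisplay.Hom.comp _ rfl g X.red
  have hcs : c.IsSurjBaseChange := (hg.isSurjBaseChange hpR hq).comp
    (X.isBaseChange.isSurjBaseChange hp hf) hf
  let B := W p n S
  have hqf : Function.Surjective (q.comp f) := hq.comp hf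
  let r := fiberRed c
  have hr : Function.Surjective r := fiberRed_surjective hcs hqf
  have hrι (y) : r (1 ⊗ₜ X.obj.iota y) = (1 : R₀) ⊗ₜ[CalW p n R₀] X₀.iota (c.f₁ y) :=
    fiberRed_iota c y
  -- `D j` carries coordinate j + 1: on coordinate 0 the scalars are not twisted by Frobenius, so
  -- the descent to R/p does not apply to it. Beyond the known range the value 0 is a dummy.
  have hD (j : ℕ) (χ : (B ⊗[CalW p n S] Y.obj.P) →ₗ[B] B) :
      ∃ D : X₀.Fiber →ₛₗ[iterTwist σ ϑ j] ModP p 𝔠, ∀ (h : j + 1 ≤ k) z,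
        D (r z) = Submodule.Quotient.mk ⟨dglog δ α β (j + 1) χ z, hc _ h χ z⟩ := by
    by_cases h : j + 1 ≤ k
    · obtain ⟨D, hD⟩ := exists_dglog_descent α β hp hf hϑ hcs (by omega) χ (hc _ h χ)
      exact ⟨D, fun _ => hD⟩
    · exact ⟨0, fun h' => absurd h' h⟩
  choose D hD using hD
  obtain ⟨DY⟩ := Y.obj.exists_normalDec hp
  obtain ⟨s, x, φ, hx⟩ := exists_dual_basis (CalW p n S) Y.obj.P
  choose η hη using fun χ : (B ⊗[CalW p n S] Y.obj.P) →ₗ[B] B =>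
    fun a => exists_truncate (χ (Y.obj.F (x a)))
  choose η' hη' using fun χ : (B ⊗[CalW p n S] Y.obj.P) →ₗ[B] B =>
    fun a => exists_truncate (χ (Y.obj.Fdot (DY.s (x a))))
  have hrec {i : ℕ} (hi : i + 1 < n) (χ) (y) :=
    dglog_Fdot α β hp hf hi DY hx χ (η χ) (η' χ) (hη χ) (hη' χ) y
  obtain ⟨V, Vbar, hV, hVV, hVe⟩ := hnil
  -- The recursion formula modulo p: the second sum carries a factor p and disappears, and the
  -- passage from Ḟ(y) to ι(y) is V♯.
  have hDV (j : ℕ) (hj : j + 1 < k) (χ)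
      (L : ((ModuleCat.extendScalars.{u, u, u} σ).obj (ModuleCat.of R₀ X₀.Fiber))
        →ₛₗ[iterTwist σ ϑ j] ModP p 𝔠)
      (hL : ∀ m : X₀.Fiber, L (extOne σ (ModuleCat.of R₀ X₀.Fiber) m) =
        ∑ a, Ideal.Quotient.mk (Ideal.span {(p : S)})
          (WittVector.ghostComponent (j + 1) (η χ a)) •
            D (j + 1) (dualExt B ((φ a).comp DY.e)) m) (m : X₀.Fiber) :
      D j χ m = L (V.hom m) := by
    obtain ⟨z, rfl⟩ := hr m
    have hz : z ∈ Submodule.span B (Set.range X.obj.Fdot) := by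
      rw [X.obj.span_Fdot]; exact Submodule.mem_top
    induction hz using Submodule.span_induction with
    | mem z hz =>
      obtain ⟨y, rfl⟩ := hz
      have h1 : V.hom (r (X.obj.Fdot y)) =
          extOne σ (ModuleCat.of R₀ X₀.Fiber) (r (1 ⊗ₜ X.obj.iota y)) := by
        rw [hrι]
        exact (congrArg V.hom (fiberRed_Fdot c y)).trans (hV (c.f₁ y))
      rw [h1, hL, hD j χ (by omega)]
      simp only [hD (j + 1) _ (show j + 1 + 1 ≤ k by omega)]
      exact mk_eq_sum (d' := fun a => ⟨dglog δ α β (j + 1 + 1) (dualExt B (φ a))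
        (1 ⊗ₜ X.obj.iota y), hc _ (by omega) _ _⟩) (t := fun a =>
          WittVector.ghostComponent (j + 1) (η' χ a)) (hrec (by omega) χ y)
    | zero => simp only [map_zero]
    | add x y _ _ hx hy => simp only [map_add, hx, hy]
    | smul a y _ hy => simp only [LinearMap.map_smulₛₗ, hy, RingHom.id_apply]
  let N := ModuleCat.of R₀ (LinearMap.range (X₀.iota.baseChange R₀))
  let incl : N ⟶ ModuleCat.of R₀ X₀.Fiber :=
    ModuleCat.ofHom (LinearMap.range (X₀.iota.baseChange R₀)).subtype
  let DN (j : ℕ) (χ : (B ⊗[CalW p n S] Y.obj.P) →ₗ[B] B) :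
      N →ₛₗ[iterTwist σ ϑ j] ModP p 𝔠 := (D j χ).comp incl.hom
  -- On the image of Q the functional factors through the e-th iterate of V̄♯, which is zero.
  have hvan (i : ℕ) (hi1 : 1 ≤ i) (hi : i + e ≤ k) (χ) (y) :
      dglog δ α β i χ (1 ⊗ₜ X.obj.iota y) ∈ Ideal.span {(p : S)} * 𝔠 := by
    obtain ⟨j, rfl⟩ : ∃ j, i = j + 1 := ⟨i - 1, by omega⟩
    obtain ⟨G, hG⟩ := exists_factor_iterHom (σ := σ) (θ := ϑ) (k := k - 1) Vbar DN
      (fun j χ hj => by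
        let G : X₀.Fiber →ₛₗ[iterTwist σ ϑ (j + 1)] ModP p 𝔠 :=
          ∑ a, Ideal.Quotient.mk (Ideal.span {(p : S)})
            (WittVector.ghostComponent (j + 1) (η χ a)) •
              D (j + 1) (dualExt B ((φ a).comp DY.e))
        have hG (m) : G m = ∑ a, Ideal.Quotient.mk (Ideal.span {(p : S)})
            (WittVector.ghostComponent (j + 1) (η χ a)) •
              D (j + 1) (dualExt B ((φ a).comp DY.e)) m := LinearMap.sum_apply _ _ _
        obtain ⟨L, hL⟩ := exists_extendScalars_lift (M := ModuleCat.of R₀ X₀.Fiber) σ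
          (iterTwist σ ϑ j) G
        have hDL := hDV j (by omega) χ L (fun m => (hL m).trans (hG m))
        refine ⟨s, fun a => Ideal.Quotient.mk (Ideal.span {(p : S)})
          (WittVector.ghostComponent (j + 1) (η χ a)), fun a => dualExt B ((φ a).comp DY.e),
          L.comp ((ModuleCat.extendScalars.{u, u, u} σ).map incl).hom, fun m => ?_, fun m => ?_⟩
        · refine (hDL (incl.hom m)).trans ?_
          exact congrArg L (congrArg (fun k : N ⟶ _ => k.hom m) hVV).symm
        · have h2 : ((ModuleCat.extendScalars.{u, u, u} σ).map incl).hom (extOne σ N m) =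
            extOne σ _ (incl.hom m) := ModuleCat.ExtendScalars.map_tmul _ _ _ _
          exact (congrArg L h2).trans ((hL _).trans (hG _)))
      e j (by omega) χ
    let m : N := ⟨r (1 ⊗ₜ X.obj.iota y), (1 : R₀) ⊗ₜ c.f₁ y, by rw [hrι]; rfl⟩
    have h1 := hG m
    rw [hVe] at h1
    have h2 : D j χ (r (1 ⊗ₜ X.obj.iota y)) = 0 := h1.trans (map_zero G)
    rw [hD j χ (by omega)] at h2
    exact mem_mul_of_mk_eq_zero h2
  have hz : z ∈ Submodule.span B (Set.range X.obj.Fdot) := by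
    rw [X.obj.span_Fdot]; exact Submodule.mem_top
  have hjn : j < n := by omega
  induction hz using Submodule.span_induction with
  | mem z hz =>
    obtain ⟨y, rfl⟩ := hz
    rw [hrec (by omega)]
    -- One more use of the recursion passes from elements ι(y) to the generators Ḟ(y). This is why a
    -- round costs e + 1 indices rather than e.
    refine Ideal.add_mem _ (Ideal.sum_mem _ fun a _ => Ideal.mul_mem_left _ _
      (hvan _ (by omega) (by omega) _ _)) (Ideal.mul_mem_mul (Ideal.mem_span_singleton_self _)
        (Ideal.sum_mem _ fun a _ => Ideal.mul_mem_left _ _ (hc _ (by omega) _ _)))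
  | zero =>
    have h1 := dglog_smul α β hp hf hjn χ 0 0
    rw [smul_zero, map_zero, zero_mul] at h1
    rw [h1]
    exact Ideal.zero_mem _
  | add x y _ _ hx hy => rw [dglog_add α β hp hf hjn]; exact Ideal.add_mem _ hx hy
  | smul a y _ hy =>
    obtain ⟨η, rfl⟩ := exists_truncate a
    rw [dglog_smul α β hp hf hjn]
    exact Ideal.mul_mem_left _ _ hy

/-- Morphisms of lifts induce a unique map of the modules `S ⊗ P`. -/
theorem LiftHom.fiberMap_eq (hp : IsNilpotent (p : S)) (hf : Function.Surjective f) {e m : ℕ}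
    (hn : m * (e + 1) < n) (hm : ∀ x ∈ RingHom.ker f, (p : S) ^ m * x = 0)
    (hX : NilpotentOrderLE Xbar e) : α.hom.fiberMap = β.hom.fiberMap := by
  -- Each factor p is paid for with e + 1 of the n available coordinates.
  have h1 (c j : ℕ) (hj : j + c * (e + 1) < n) (χ z) :
      dglog δ α β j χ z ∈ Ideal.span {(p : S) ^ c} * RingHom.ker f := by
    induction c generalizing j χ z with
    | zero =>
      rw [pow_zero, Ideal.span_singleton_one, Ideal.top_mul]
      exact dglog_mem α β hp hf (by omega) χ z
    | succ c ih =>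
      rw [pow_succ', ← Ideal.span_singleton_mul_span_singleton, mul_assoc]
      rw [Nat.add_mul, one_mul] at hj
      -- This k is the largest index for which the previous round gives information.
      exact dglog_mem_mul α β hp hf hX (k := n - 1 - c * (e + 1)) (by omega)
        (fun i hi χ z => ih i (by omega) χ z) (by omega) χ z
  have h2 (χ z) : dglog δ α β 0 χ z = 0 := by
    have h3 := h1 m 0 (by omega) χ z
    rw [Ideal.mem_span_singleton_mul] at h3
    obtain ⟨t, ht, h4⟩ := h3
    rw [← h4, hm t ht]
  obtain ⟨r, x, φ, hx⟩ := exists_dual_basis (CalW p n S) Y.obj.P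
  have h3 (y : X.obj.P) : (1 : S) ⊗ₜ[CalW p n S] liftDiff α β y = 0 := by
    rw [← semilinear_eq_of_dual_basis hx ((1 : S) ⊗ₜ[CalW p n S] liftDiff α β y)]
    refine Finset.sum_eq_zero fun a _ => ?_
    have h4 := h2 (dualExt (W p n S) (φ a)) (1 ⊗ₜ y)
    rw [dglog, tglog_truncate_zeroth, LinearMap.baseChange_tmul, dualExt_tmul, one_mul] at h4
    rw [dualExt_tmul, one_mul]
    exact (congrArg (· • (1 : S) ⊗ₜ[CalW p n S] x a) h4).trans (zero_smul _ _)
  refine LinearMap.ext fun z => ?_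
  induction z using TensorProduct.induction_on with
  | zero => simp only [map_zero]
  | add x y hx hy => simp only [map_add, hx, hy]
  | tmul b y =>
    change b ⊗ₜ[CalW p n S] α.hom.f₀ y = b ⊗ₜ[CalW p n S] β.hom.f₀ y
    rw [← sub_eq_zero, ← TensorProduct.tmul_sub, ← liftDiff_apply]
    have h4 := congrArg (b • ·) (h3 y)
    simpa [TensorProduct.smul_tmul'] using h4

end Step

end Disp
end

noncomputable section

namespace Disp

/-! ### Displays with prescribed normal decomposition -/

section OfNormal

variable {p : ℕ} [Fact p.Prime] {n : ℕ} {S : Type u} [CommRing S] {P : Type u} [AddCommGroup P]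
  [Module (CalW p n S) P] {𝔞 : Ideal S} (γ : DividedPowers 𝔞)
  (e : P →ₗ[CalW p n S] P) (Ψ : P →ₛₗ[CalW.frob p n S] (W p n S ⊗[CalW p n S] P))

/-- The map `F` which is `Ψ` on the image and `pΨ` on the kernel of the idempotent `e`. -/
def normalF : P →ₛₗ[CalW.frob p n S] (W p n S ⊗[CalW p n S] P) where
  toFun x := Ψ (e x) + (p : W p n S) • Ψ (x - e x)
  map_add' x y := by simp only [map_add, map_sub, smul_add, smul_sub]; abel
  map_smul' a x := by
    rw [map_smul, ← smul_sub, Ψ.map_smulₛₗ, Ψ.map_smulₛₗ, smul_add, smul_comm]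

theorem normalF_apply (x : P) :
    normalF e Ψ x = Ψ (e x) + (p : W p n S) • Ψ (x - e x) := rfl

/-- The pair `(x - e(x), Ψ(x - e(x)))`. -/
def normalPair : P →ₗ[CalW p n S] P × FrobTwist p n S P where
  toFun x := (x - e x, (FrobTwist.val p n S P).symm (Ψ (x - e x)))
  map_add' x y := pair_ext
    (by simp only [map_add, Prod.fst_add]; abel)
    (by simp only [map_add, map_sub, Prod.snd_add, AddEquiv.apply_symm_apply]; abel)
  map_smul' a x := pair_ext
    (by simp only [map_smul, Prod.smul_fst, RingHom.id_apply, smul_sub])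
    (by
      simp only [map_smul, Prod.smul_snd, RingHom.id_apply, AddEquiv.apply_symm_apply,
        FrobTwist.val_smul]
      rw [← smul_sub, Ψ.map_smulₛₗ])

variable {e Ψ} in
theorem normalPair_fst (x : P) : (normalPair e Ψ x).1 = x - e x := rfl

variable {e Ψ} in
theorem val_normalPair (x : P) :
    FrobTwist.val p n S P (normalPair e Ψ x).2 = Ψ (x - e x) := rfl

/-- The module `Q` of the display with normal decomposition given by `e` and `Ψ`. -/
def normalQ : Submodule (CalW p n S) (P × FrobTwist p n S P) :=
  Submodule.span (CalW p n S)
    (Set.range (normalPair e Ψ) ∪ {y | ∃ (j : J p n 𝔞) (x : P), y = epsPair γ (normalF e Ψ) j x})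

variable {γ e Ψ}

theorem normalPair_mem (x : P) : normalPair e Ψ x ∈ normalQ γ e Ψ :=
  Submodule.subset_span (Or.inl ⟨x, rfl⟩)

theorem epsPair_mem (j : J p n 𝔞) (x : P) :
    epsPair γ (normalF e Ψ) j x ∈ normalQ γ e Ψ :=
  Submodule.subset_span (Or.inr ⟨j, x, rfl⟩)

variable (γ e Ψ) in
/-- The map `P → Q`, `x ↦ (x - e(x), Ψ(x - e(x)))`. -/
def normalS : P →ₗ[CalW p n S] normalQ γ e Ψ := (normalPair e Ψ).codRestrict _ normalPair_mem

theorem normalF_fst (he : ∀ x, e (e x) = e x) {y : P × FrobTwist p n S P}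
    (hy : y ∈ normalQ γ e Ψ) :
    normalF e Ψ y.1 = (p : W p n S) • FrobTwist.val p n S P y.2 := by
  induction hy using Submodule.span_induction with
  | mem y hy =>
    rcases hy with ⟨x, rfl⟩ | ⟨j, x, rfl⟩
    · rw [normalPair_fst, val_normalPair, normalF_apply, map_sub, he, sub_self, map_zero, zero_add,
        sub_zero]
    · rw [epsPair_fst, val_epsPair, (normalF e Ψ).map_smulₛₗ, CalW.frob_of,
        ← natCast_mul_sigmaDot (γ := γ), mul_smul]
  | zero => rw [Prod.fst_zero, Prod.snd_zero, map_zero, map_zero, smul_zero]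
  | add x y _ _ hx hy => rw [Prod.fst_add, Prod.snd_add, map_add, map_add, hx, hy, smul_add]
  | smul a y _ hy =>
    rw [Prod.smul_fst, Prod.smul_snd, FrobTwist.val_smul, (normalF e Ψ).map_smulₛₗ, hy, smul_comm]

theorem normalQ_induction {motive : normalQ γ e Ψ → Prop} (h1 : ∀ x, motive (normalS γ e Ψ x))
    (h2 : ∀ j x, motive (pairEps epsPair_mem j x)) (h3 : motive 0)
    (h4 : ∀ x y, motive x → motive y → motive (x + y)) (h5 : ∀ (a : CalW p n S) y, motive y → motive (a • y))
    (y : normalQ γ e Ψ) : motive y := by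
  obtain ⟨y, hy⟩ := y
  induction hy using Submodule.span_induction with
  | mem y hy =>
    rcases hy with ⟨x, rfl⟩ | ⟨j, x, rfl⟩
    · exact h1 x
    · exact h2 j x
  | zero => exact h3
  | add x y _ _ hx hy => exact h4 _ _ hx hy
  | smul a y _ hy => exact h5 a _ hy

theorem normalS_e (he : ∀ x, e (e x) = e x) (x : P) : normalS γ e Ψ (e x) = 0 := by
  refine Subtype.ext (pair_ext ?_ ?_)
  · change e x - e (e x) = 0
    rw [he, sub_self]
  · change Ψ (e x - e (e x)) = 0
    rw [he, sub_self, map_zero]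

/-- On a generator ε(j ⊗ x) the L-component is κ(j)s(x) = ε(j ⊗ (x - e(x))), which leaves ε(j ⊗
e(x)). -/
theorem sub_normalS_mem (he : ∀ x, e (e x) = e x) (y : normalQ γ e Ψ) :
    y - normalS γ e Ψ (pairIota _ y) ∈
      Submodule.span (CalW p n S) {y | ∃ j x, y = pairEps (γ := γ) epsPair_mem j x} := by
  induction y using normalQ_induction with
  | h1 x =>
    have h1 : pairIota _ (normalS γ e Ψ x) = x - e x := rfl
    rw [h1, map_sub, normalS_e he, sub_zero, sub_self]
    exact Submodule.zero_mem _
  | h2 j x =>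
    have h1 : pairEps (γ := γ) (F := normalF e Ψ) (Q := normalQ γ e Ψ) epsPair_mem j x -
        normalS γ e Ψ (pairIota (normalQ γ e Ψ) (pairEps (γ := γ) (F := normalF e Ψ)
          (Q := normalQ γ e Ψ) epsPair_mem j x)) =
        pairEps (γ := γ) (F := normalF e Ψ) (Q := normalQ γ e Ψ) epsPair_mem j (e x) := by
      have h2 : pairIota (normalQ γ e Ψ) (normalS γ e Ψ x) = x - e x := rfl
      rw [pairIota_pairEps, map_smul,
        ← pairEps_pairIota epsPair_mem (fun y hy => normalF_fst he hy), h2, map_sub,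
        sub_sub_cancel]
    rw [h1]
    exact Submodule.subset_span ⟨j, e x, rfl⟩
  | h3 => rw [map_zero, map_zero, sub_zero]; exact Submodule.zero_mem _
  | h4 x y hx hy =>
    rw [map_add, map_add, add_sub_add_comm]; exact Submodule.add_mem _ hx hy
  | h5 a y hy =>
    rw [map_smul, map_smul]
    have h1 : a • y - a • normalS γ e Ψ (pairIota (normalQ γ e Ψ) y) =
        a • (y - normalS γ e Ψ (pairIota (normalQ γ e Ψ) y)) := (smul_sub a _ _).symm
    rw [h1]
    exact Submodule.smul_mem _ _ hy

/-- The T-part of Ψ is also a value of Ḟ, namely at ε(V(1) ⊗ e(x)), because σ̇(V(1)) = 1. -/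
theorem span_pairFdot (he : ∀ x, e (e x) = e x)
    (hΨ : Submodule.span (W p n S) (Set.range Ψ) = ⊤) :
    Submodule.span (W p n S) (Set.range (pairFdot (normalQ γ e Ψ))) = ⊤ := by
  rw [eq_top_iff, ← hΨ, Submodule.span_le]
  rintro _ ⟨x, rfl⟩
  have h1 : Ψ x = pairFdot _ (normalS γ e Ψ x) +
      pairFdot _ (pairEps (γ := γ) (F := normalF e Ψ) epsPair_mem (verOne n 𝔞) (e x)) := by
    have h2 : pairFdot _ (normalS γ e Ψ x) = Ψ (x - e x) := rfl
    rw [h2, pairFdot_apply, coe_pairEps, val_epsPair, sigmaDot_verOne, one_smul, normalF_apply, he,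
      sub_self, map_zero, smul_zero, add_zero, ← map_add, sub_add_cancel]
  rw [h1]
  exact Submodule.add_mem _ (Submodule.subset_span ⟨_, rfl⟩) (Submodule.subset_span ⟨_, rfl⟩)

variable [NeZero n] [Module.Finite (CalW p n S) P] [Module.Projective (CalW p n S) P]

variable (γ e Ψ) in
/-- The relative truncated display with the normal decomposition given by an idempotent `e` and
`Ψ`. -/
def RelDisplay.ofNormal (he : ∀ x, e (e x) = e x)
    (hΨ : Submodule.span (W p n S) (Set.range Ψ) = ⊤) : RelDisplay p n 𝔞 γ :=
  RelDisplay.ofPairs γ (normalF e Ψ) (normalQ γ e Ψ) epsPair_mem (fun _ hy => normalF_fst he hy)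
    ⟨e, normalS γ e Ψ, fun _ => rfl, sub_normalS_mem he⟩ (span_pairFdot he hΨ)

end OfNormal

/-! ### Homomorphisms out of such displays -/

namespace RelDisplay

variable {p : ℕ} [Fact p.Prime] {n : ℕ} [NeZero n] {S S' : Type u} [CommRing S] [CommRing S']
  {P : Type u} [AddCommGroup P]
  [Module (CalW p n S) P] [Module.Finite (CalW p n S) P] [Module.Projective (CalW p n S) P]
  {𝔞 : Ideal S} {γ : DividedPowers 𝔞} {𝔞' : Ideal S'} {γ' : DividedPowers 𝔞'}
  {φ : S →+* S'} {h : 𝔞 ≤ 𝔞'.comap φ} {Z : RelDisplay p n 𝔞' γ'}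
  {e : P →ₗ[CalW p n S] P} {Ψ : P →ₛₗ[CalW.frob p n S] (W p n S ⊗[CalW p n S] P)}
  {he : ∀ x, e (e x) = e x} {hΨ : Submodule.span (W p n S) (Set.range Ψ) = ⊤}

omit [Module.Finite (CalW p n S) P] [Module.Projective (CalW p n S) P] in
theorem ofNormal_map_F {f₀ : P →ₛₗ[CalW.map p n φ] Z.P}
    (h1 : ∀ x, ∃ y, Z.iota y = f₀ (x - e x) ∧
      Z.Fdot y = tensorMap (W.map p n φ) (CalW.map_algebraMap_W p n φ) f₀ (Ψ (x - e x)))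
    (h2 : ∀ x, tensorMap (W.map p n φ) (CalW.map_algebraMap_W p n φ) f₀ (Ψ (e x)) =
      Z.F (f₀ (e x))) (x : P) :
    tensorMap (W.map p n φ) (CalW.map_algebraMap_W p n φ) f₀ (normalF e Ψ x) = Z.F (f₀ x) := by
  obtain ⟨y, h3, h4⟩ := h1 x
  have h5 : f₀ x = f₀ (e x) + Z.iota y := by rw [h3, ← map_add, add_sub_cancel]
  rw [normalF_apply, map_add, h2, LinearMap.map_smulₛₗ, ← h4, map_natCast, ← F_iota, h5, map_add]

/-- Homomorphisms out of a display with normal decomposition. -/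
theorem exists_hom_ofNormal (hp : IsNilpotent (p : S')) (hc : DPCompat γ γ' φ)
    (f₀ : P →ₛₗ[CalW.map p n φ] Z.P)
    (h1 : ∀ x, ∃ y, Z.iota y = f₀ (x - e x) ∧
      Z.Fdot y = tensorMap (W.map p n φ) (CalW.map_algebraMap_W p n φ) f₀ (Ψ (x - e x)))
    (h2 : ∀ x, tensorMap (W.map p n φ) (CalW.map_algebraMap_W p n φ) f₀ (Ψ (e x)) =
      Z.F (f₀ (e x))) :
    ∃ k : Hom φ h (ofNormal γ e Ψ he hΨ) Z, k.f₀ = f₀ := by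
  have hF := ofNormal_map_F h1 h2
  let T := tensorMap (W.map p n φ) (CalW.map_algebraMap_W p n φ) f₀
  refine ⟨Hom.ofP (X := ofNormal γ e Ψ he hΨ) hp hc f₀ (fun y => ?_) hF, rfl⟩
  induction y using normalQ_induction with
  | h1 x => exact h1 x
  | h2 j x =>
    refine ⟨Z.eps (J.map p n φ h j) (f₀ x), ?_, ?_⟩
    · rw [Z.iota_eps]
      refine Eq.trans ?_ (f₀.map_smulₛₗ (CalW.of p n S j) x).symm
      rw [CalW.map_of]
      rfl
    · rw [Z.Fdot_eps, ← map_sigmaDot h hc, ← hF]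
      exact (LinearMap.map_smulₛₗ (tensorMap (W.map p n φ) (CalW.map_algebraMap_W p n φ) f₀)
        (sigmaDot p n γ j) (normalF e Ψ x)).symm
  | h3 =>
    exact ⟨0, (map_zero Z.iota).trans (map_zero f₀).symm, (map_zero Z.Fdot).trans (map_zero T).symm⟩
  | h4 x y hx hy =>
    obtain ⟨z, h1, h2⟩ := hx
    obtain ⟨z', h1', h2'⟩ := hy
    exact ⟨z + z', (map_add Z.iota z z').trans ((congrArg₂ (· + ·) h1 h1').trans
      (map_add f₀ _ _).symm), (map_add Z.Fdot z z').trans ((congrArg₂ (· + ·) h2 h2').trans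
      (map_add T _ _).symm)⟩
  | h5 a y hy =>
    obtain ⟨z, h1, h2⟩ := hy
    refine ⟨CalW.map p n φ a • z, (map_smul Z.iota _ _).trans ((congrArg _ h1).trans
      (f₀.map_smulₛₗ a _).symm), ?_⟩
    have h3 : T (CalW.frob p n S a • FrobTwist.val p n S P (y : P × FrobTwist p n S P).2) =
        CalW.frob p n S' (CalW.map p n φ a) •
          T (FrobTwist.val p n S P (y : P × FrobTwist p n S P).2) := by
      rw [LinearMap.map_smulₛₗ, CalW.frob_map]
    exact (Z.Fdot.map_smulₛₗ _ _).trans ((congrArg _ h2).trans h3.symm)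

end RelDisplay

/-- Finitely generated projective modules lift along nil ideals. -/
theorem exists_projective_lift {A A' : Type u} [CommRing A] [CommRing A'] {ψ : A →+* A'}
    (hψ : Function.Surjective ψ) (hk : ∀ x ∈ RingHom.ker ψ, IsNilpotent x) (M : Type u)
    [AddCommGroup M] [Module A' M] [Module.Finite A' M] [Module.Projective A' M] :
    ∃ (P : Type u) (_ : AddCommGroup P) (_ : Module A P) (f₀ : P →ₛₗ[ψ] M),
      Module.Finite A P ∧ Module.Projective A P ∧ Function.Surjective f₀ ∧
      ∀ x, f₀ x = 0 → x ∈ (RingHom.ker ψ • ⊤ : Submodule A P) := by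
  obtain ⟨r, x, φ, hx⟩ := exists_dual_basis A' M
  let F := Fin r → A
  let π : F →ₛₗ[ψ] M :=
    { toFun := fun v => ∑ i, ψ (v i) • x i
      map_add' := fun v w => by
        change ∑ i, ψ (v i + w i) • x i = _
        simp only [map_add, add_smul, Finset.sum_add_distrib]
      map_smul' := fun a v => by
        change ∑ i, ψ (a * v i) • x i = _
        simp only [map_mul, mul_smul, Finset.smul_sum] }
  have hπ (v : F) : π v = ∑ i, ψ (v i) • x i := rfl
  have hF (v : F) (hv : ∀ i, ψ (v i) = 0) : v ∈ (RingHom.ker ψ • ⊤ : Submodule A F) := by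
    rw [← Finset.univ_sum_single v]
    refine Submodule.sum_mem _ fun i _ => ?_
    have : (Pi.single i (v i) : F) = v i • Pi.single i 1 := by
      rw [← Pi.single_smul, smul_eq_mul, mul_one]
    rw [this]
    exact Submodule.smul_mem_smul (hv i) Submodule.mem_top
  have hF' {v : F} (hv : v ∈ (RingHom.ker ψ • ⊤ : Submodule A F)) (i : Fin r) : ψ (v i) = 0 := by
    induction hv using Submodule.smul_induction_on' with
    | smul a ha v _ => rw [Pi.smul_apply, smul_eq_mul, map_mul, (RingHom.mem_ker).1 ha, zero_mul]
    | add v _ w _ hv hw => rw [Pi.add_apply, map_add, hv, hw, add_zero]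
  -- A lift to the free module of the idempotent matrix of the dual basis; once made idempotent, its
  -- image is the wanted lift of M.
  obtain ⟨e₀, he₀⟩ := exists_semilinear_of_rel (RingHom.id A) (P := F) (M := F)
    (fun v w => ∀ i, ψ (w i) = φ i (π v)) (fun i => by
      change ψ 0 = φ i (π 0)
      rw [map_zero, map_zero, map_zero])
    (fun v w v' w' h h' i => by rw [Pi.add_apply, map_add, h, h', map_add, map_add])
    (fun a v w h i => by
      rw [RingHom.id_apply, Pi.smul_apply, smul_eq_mul, map_mul, h, π.map_smulₛₗ, map_smul,
        smul_eq_mul])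
    (fun v => by
      choose w hw using fun i => hψ (φ i (π v))
      exact ⟨w, hw⟩)
  have hπe₀ (v : F) : π (e₀ v) = π v := by
    rw [hπ]
    simp only [he₀]
    exact hx _
  obtain ⟨e, he, hee⟩ := exists_idempotent_end hk e₀ fun v => hF _ fun i => by
    rw [Pi.sub_apply, map_sub, he₀, he₀, hπe₀, sub_self]
  have hψe (v : F) (i) : ψ (e v i) = φ i (π v) := by
    rw [← he₀, ← sub_eq_zero, ← map_sub]
    exact hF' (hee v) i
  have hπe (v : F) : π (e v) = π v := by
    rw [hπ]
    simp only [hψe]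
    exact hx _
  have heP (v : LinearMap.range e) : e v = v := by
    obtain ⟨_, v, rfl⟩ := v
    exact he v
  refine ⟨LinearMap.range e, inferInstance, inferInstance, π.comp (LinearMap.range e).subtype,
    inferInstance, ?_, fun m => ?_, fun v hv => ?_⟩
  · exact Module.Projective.of_split (LinearMap.range e).subtype e.rangeRestrict
      (LinearMap.ext fun v => Subtype.ext (heP v))
  · choose w hw using fun i => hψ (φ i m)
    have h1 : π w = m := by
      rw [hπ]
      simp only [hw]
      exact hx m
    exact ⟨⟨e w, w, rfl⟩, (hπe w).trans h1⟩
  · have h1 : (v : F) ∈ (RingHom.ker ψ • ⊤ : Submodule A F) := hF _ fun i => by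
      rw [← heP v, hψe]
      exact (congrArg (φ i) hv).trans (map_zero _)
    have h2 := Submodule.mem_map_of_mem (f := e.rangeRestrict) h1
    rw [Submodule.map_smul''] at h2
    have h3 : e.rangeRestrict (v : F) = v := Subtype.ext (heP v)
    rw [h3] at h2
    exact Submodule.smul_mono le_rfl le_top h2

end Disp
end

noncomputable section

namespace Disp

/-! ### Existence of relative lifts -/

variable {p : ℕ} [Fact p.Prime] {n : ℕ} [NeZero n] {S R : Type u} [CommRing S] [CommRing R]
  {f : S →+* R}

/-- The image contains everything generated by ε, because P and 𝒥_{n+1} map surjectively; so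
surjectivity may be checked modulo that submodule. -/
theorem RelDisplay.Hom.f₁_surjective {𝔞 : Ideal S} {γ : DividedPowers 𝔞}
    {h : 𝔞 ≤ (⊥ : Ideal R).comap f} {X : RelDisplay p n 𝔞 γ} {Z : Display p n R}
    (hf : Function.Surjective f) (k : RelDisplay.Hom f h X Z) (h₀ : Function.Surjective k.f₀)
    (h₁ : ∀ z, ∃ y, z - k.f₁ y ∈ Submodule.span (CalW p n R) {y | ∃ j x, y = Z.eps j x}) :
    Function.Surjective k.f₁ := by
  have key : ∀ z ∈ Submodule.span (CalW p n R) {y | ∃ j x, y = Z.eps j x}, ∃ y, k.f₁ y = z := by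
    intro z hz
    induction hz using Submodule.span_induction with
    | mem z hz =>
      obtain ⟨j, x, rfl⟩ := hz
      obtain ⟨j, rfl⟩ := J.map_surjective hf h j
      obtain ⟨x, rfl⟩ := h₀ x
      exact ⟨_, k.map_eps j x⟩
    | zero => exact ⟨0, map_zero _⟩
    | add x y _ _ hx hy =>
      obtain ⟨x, rfl⟩ := hx
      obtain ⟨y, rfl⟩ := hy
      exact ⟨x + y, map_add _ _ _⟩
    | smul a y _ hy =>
      obtain ⟨a, rfl⟩ := CalW.map_surjective hf a
      obtain ⟨y, rfl⟩ := hy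
      exact ⟨a • y, LinearMap.map_smulₛₗ _ _ _⟩
  intro z
  obtain ⟨y, hy⟩ := h₁ z
  obtain ⟨y', hy'⟩ := key _ hy
  exact ⟨y + y', by rw [map_add, hy', add_sub_cancel]⟩

/-- Truncated displays lift along divided power thickenings. -/
theorem Lift.exists_relLift (hp : IsNilpotent (p : S)) (hf : Function.Surjective f)
    (γ : DividedPowers (RingHom.ker f)) (h : RingHom.ker f ≤ (⊥ : Ideal R).comap f)
    (Xbar : Display p n R) : Nonempty (Lift f (RingHom.ker f) γ h Xbar) := by
  have hp' : IsNilpotent (p : R) := by simpa using hp.map f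
  have hψ : Function.Surjective (CalW.map p n f) := CalW.map_surjective hf
  have hk := isNilpotent_of_mem_ker_map (n := n) γ hp
  obtain ⟨P, i₁, i₂, f₀, i₃, i₄, hf₀, hf₀'⟩ := exists_projective_lift hψ hk Xbar.P
  obtain ⟨D⟩ := Xbar.exists_normalDec hp'
  let T := tensorMap (W.map p n f) (CalW.map_algebraMap_W p n f) f₀
  have hT : Function.Surjective T := tensorMap_surjective (W.map_surjective hf) hf₀
  obtain ⟨e₀, he₀⟩ := exists_semilinear_of_rel (RingHom.id (CalW p n S)) (P := P) (M := P)
    (fun x y => f₀ y = D.e (f₀ x)) (by rw [map_zero, map_zero])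
    (fun x y m m' h h' => by rw [map_add, map_add, map_add, h, h'])
    (fun a x m h => by
      rw [RingHom.id_apply, LinearMap.map_smulₛₗ, LinearMap.map_smulₛₗ, map_smul, h])
    (fun x => hf₀ _)
  obtain ⟨e, he, hee⟩ := exists_idempotent_end hk e₀ fun x => hf₀' _ (by
    rw [map_sub, he₀, he₀, D.e_e, sub_self])
  have hfe (x) : f₀ (e x) = D.e (f₀ x) := by
    rw [← he₀, ← sub_eq_zero, ← map_sub]
    have h1 := hee x
    generalize e x - e₀ x = y at h1
    induction h1 using Submodule.smul_induction_on' with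
    | smul a ha x _ => rw [LinearMap.map_smulₛₗ, (RingHom.mem_ker).1 ha, zero_smul]
    | add x _ y _ hx hy => rw [map_add, hx, hy, add_zero]
  -- Any Frobenius-linear lift of Ψ will do: generation is preserved by Nakayama.
  obtain ⟨Ψ, hΨ⟩ := exists_semilinear_of_rel (CalW.frob p n S) (P := P)
    (M := W p n S ⊗[CalW p n S] P)
    (fun x y => T y = D.psi (f₀ x)) (by rw [map_zero, map_zero, map_zero])
    (fun x y m m' h h' => by rw [map_add, map_add, map_add, h, h'])
    (fun a x m h => by
      rw [LinearMap.map_smulₛₗ, LinearMap.map_smulₛₗ, LinearMap.map_smulₛₗ, h, CalW.frob_map])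
    (fun x => hT _)
  have hspan : Submodule.span (W p n S) (Set.range Ψ) = ⊤ := by
    refine eq_top_of_nil (I := RingHom.ker (W.map p n f)) (fun x hx => ?_) fun z => ?_
    · refine isNilpotent_W hp (DividedPowers.isNilpotent γ hp ?_)
      rw [RingHom.mem_ker, W.map_zeroth, (RingHom.mem_ker).1 hx, map_zero]
    · have h1 : T z ∈ Submodule.span (W p n R) (Set.range D.psi) := by
        rw [D.span_psi]; exact Submodule.mem_top
      suffices H : ∀ w ∈ Submodule.span (W p n R) (Set.range D.psi),
          ∃ y ∈ Submodule.span (W p n S) (Set.range Ψ), T y = w by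
        obtain ⟨y, hy, hy'⟩ := H _ h1
        exact ⟨y, hy, mem_smul_of_tensorMap_eq_zero hψ (W.map_surjective hf) hf₀ hf₀'
          (z := z - y) ((map_sub T z y).trans (by rw [hy', sub_self]))⟩
      intro w hw
      induction hw using Submodule.span_induction with
      | mem w hw =>
        obtain ⟨x, rfl⟩ := hw
        obtain ⟨x, rfl⟩ := hf₀ x
        exact ⟨Ψ x, Submodule.subset_span ⟨x, rfl⟩, hΨ x⟩
      | zero => exact ⟨0, Submodule.zero_mem _, map_zero T⟩
      | add x y _ _ hx hy =>
        obtain ⟨x, hx, rfl⟩ := hx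
        obtain ⟨y, hy, rfl⟩ := hy
        exact ⟨x + y, Submodule.add_mem _ hx hy, map_add T _ _⟩
      | smul a y _ hy =>
        obtain ⟨a, rfl⟩ := W.map_surjective hf a
        obtain ⟨y, hy, rfl⟩ := hy
        exact ⟨a • y, Submodule.smul_mem _ _ hy, LinearMap.map_smulₛₗ _ _ _⟩
  have hs (x) : Xbar.iota (D.s (f₀ x)) = f₀ (x - e x) := by rw [D.iota_s, map_sub, hfe]
  have hs' (x) : Xbar.Fdot (D.s (f₀ x)) = T (Ψ (x - e x)) := by
    rw [hΨ, map_sub, hfe, D.psi_sub]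
  obtain ⟨k, hk⟩ := RelDisplay.exists_hom_ofNormal (γ := γ) (h := h) (he := he) (hΨ := hspan) hp'
    (DPCompat.bot h) f₀ (fun x => ⟨_, hs x, hs' x⟩) fun x => by
      rw [hfe]
      exact (hΨ _).trans (by rw [hfe, D.psi_e])
  have hk (x) : k.f₀ x = f₀ x := congrArg (fun g => g x) hk
  have h₀ : Function.Surjective k.f₀ := fun x => by
    obtain ⟨y, hy⟩ := hf₀ x
    exact ⟨y, (hk y).trans hy⟩
  have h₁ : Function.Surjective k.f₁ := by
    refine k.f₁_surjective hf h₀ fun z => ?_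
    obtain ⟨x, hx⟩ := hf₀ (Xbar.iota z)
    have h1 : k.f₁ (normalS γ e Ψ x) = D.s (Xbar.iota z) := by
      rw [← hx]
      refine RelDisplay.Hom.f₁_eq hp' k ((hs x).trans (hk (x - e x)).symm) ((hs' x).trans ?_)
      exact tensorMap_congr (fun _ => rfl) (fun x => (hk x).symm) _
    refine ⟨normalS γ e Ψ x, ?_⟩
    rw [h1]
    refine Submodule.span_mono ?_ (D.sub_mem z)
    rintro _ ⟨j, x, rfl⟩
    exact ⟨j, _, rfl⟩
  have hbc : k.IsSurjBaseChange := ⟨h₀, fun x hx => hf₀' x ((hk x).symm.trans hx), h₁⟩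
  exact ⟨⟨_, k, hbc.isBaseChange hf hp'⟩⟩

end Disp
end

noncomputable section

namespace Disp

/-- Surjections with the same kernel have isomorphic targets. -/
theorem exists_linearEquiv_of_ker {A M N N' : Type*} [CommRing A] [AddCommGroup M] [Module A M]
    [AddCommGroup N] [Module A N] [AddCommGroup N'] [Module A N'] {g : M →ₗ[A] N} {g' : M →ₗ[A] N'}
    (hg : Function.Surjective g) (hg' : Function.Surjective g') (h : ∀ z, g z = 0 ↔ g' z = 0) :
    ∃ θ : N ≃ₗ[A] N', ∀ z, θ (g z) = g' z := by
  refine ⟨(g.quotKerEquivOfSurjective hg).symm.trans ((Submodule.quotEquivOfEq _ _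
    (Submodule.ext h)).trans (g'.quotKerEquivOfSurjective hg')), fun z => ?_⟩
  have h1 : (g.quotKerEquivOfSurjective hg).symm (g z) = (LinearMap.ker g).mkQ z := by
    rw [LinearEquiv.symm_apply_eq]; rfl
  rw [LinearEquiv.trans_apply, h1]
  rfl

/-! ### The fiber S ⊗ P and the Hodge filtration -/

section Fiber

variable {p : ℕ} [Fact p.Prime] {n : ℕ} [NeZero n] {S : Type u} [CommRing S]

theorem one_tmul_surjective (p : ℕ) [Fact p.Prime] (n : ℕ) [NeZero n] (S P : Type u) [CommRing S]
    [AddCommGroup P] [Module (CalW p n S) P] (z : S ⊗[CalW p n S] P) :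
    ∃ x, (1 : S) ⊗ₜ[CalW p n S] x = z :=
  TensorProduct.mk_surjective _ P S CalW.algebraMap_surjective z

theorem one_tmul_mem_smul {P : Type u} [AddCommGroup P] [Module (CalW p n S) P] {𝔞 : Ideal S}
    {x : P} (hx : (1 : S) ⊗ₜ[CalW p n S] x ∈ (𝔞 • ⊤ : Submodule S (S ⊗[CalW p n S] P))) :
    x ∈ ((J p n 𝔞).map (CalW.of p n S) • ⊤ : Submodule (CalW p n S) P) := by
  have key : ∀ z ∈ (𝔞 • ⊤ : Submodule S (S ⊗[CalW p n S] P)),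
      ∃ w ∈ ((J p n 𝔞).map (CalW.of p n S) • ⊤ : Submodule (CalW p n S) P),
        (1 : S) ⊗ₜ[CalW p n S] w = z := by
    intro z hz
    induction hz using Submodule.smul_induction_on' with
    | smul a ha z _ =>
      obtain ⟨x, rfl⟩ := one_tmul_surjective p n S P z
      obtain ⟨b, rfl⟩ := CalW.algebraMap_surjective (p := p) (n := n) a
      refine ⟨b • x, Submodule.smul_mem_smul (mem_map_J.2 ha) Submodule.mem_top, ?_⟩
      rw [TensorProduct.tmul_smul, algebraMap_smul]
    | add x _ y _ hx hy =>
      obtain ⟨x, hx, rfl⟩ := hx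
      obtain ⟨y, hy, rfl⟩ := hy
      exact ⟨x + y, Submodule.add_mem _ hx hy, TensorProduct.tmul_add _ _ _⟩
  obtain ⟨w, hw, h1⟩ := key _ hx
  have h2 : (1 : S) ⊗ₜ[CalW p n S] (x - w) = 0 := by rw [TensorProduct.tmul_sub, h1, sub_self]
  rw [one_tmul_eq_zero_iff CalW.algebraMap_surjective] at h2
  rw [← sub_add_cancel x w]
  refine Submodule.add_mem _ (Submodule.smul_mono (fun a ha => ?_) le_rfl h2) hw
  rw [mem_map_J, (RingHom.mem_ker).1 ha]
  exact 𝔞.zero_mem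

theorem mem_smul_of_one_tmul_eq_zero {P : Type u} [AddCommGroup P] [Module (CalW p n S) P]
    {𝔞 : Ideal S} {x : P} (hx : (1 : S) ⊗ₜ[CalW p n S] x = 0) :
    x ∈ ((J p n 𝔞).map (CalW.of p n S) • ⊤ : Submodule (CalW p n S) P) :=
  one_tmul_mem_smul (by rw [hx]; exact Submodule.zero_mem _)

theorem one_tmul_eq_zero_of_mem {P : Type u} [AddCommGroup P] [Module (CalW p n S) P] {x : P}
    (hx : x ∈ ((J p n (⊥ : Ideal S)).map (CalW.of p n S) • ⊤ : Submodule (CalW p n S) P)) :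
    (1 : S) ⊗ₜ[CalW p n S] x = 0 := by
  rw [one_tmul_eq_zero_iff CalW.algebraMap_surjective]
  refine Submodule.smul_mono (fun a ha => ?_) le_rfl hx
  exact (mem_map_J.1 ha : _)

namespace RelDisplay

/-- The kernel of 𝒲_n(S) → S already annihilates P/ι(Q), so tensoring with S loses nothing. -/
theorem hodge_one_tmul_eq_zero (X : Display p n S) (x : X.P) :
    X.hodge ((1 : S) ⊗ₜ x) = 0 ↔ x ∈ LinearMap.range X.iota := by
  have h1 : X.hodge ((1 : S) ⊗ₜ x) = (1 : S) ⊗ₜ (LinearMap.range X.iota).mkQ x := rfl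
  rw [h1]
  constructor
  · intro h
    have h2 := mem_smul_of_one_tmul_eq_zero (𝔞 := (⊥ : Ideal S)) h
    have h3 : ∀ z ∈ ((J p n (⊥ : Ideal S)).map (CalW.of p n S) • ⊤ :
        Submodule (CalW p n S) (X.P ⧸ LinearMap.range X.iota)), z = 0 := by
      intro z hz
      induction hz using Submodule.smul_induction_on' with
      | smul a ha z _ =>
        obtain ⟨y, rfl⟩ := (LinearMap.range X.iota).mkQ_surjective z
        rw [← map_smul]
        exact (Submodule.Quotient.mk_eq_zero _).2
          (smul_mem_range_iota (Submodule.smul_mem_smul ha Submodule.mem_top))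
      | add x _ y _ hx hy => rw [hx, hy, add_zero]
    exact (Submodule.Quotient.mk_eq_zero _).1 (h3 _ h2)
  · intro h
    have h2 : (LinearMap.range X.iota).mkQ x = 0 := (Submodule.Quotient.mk_eq_zero _).2 h
    rw [h2, TensorProduct.tmul_zero]

theorem hodge_surjective (X : Display p n S) : Function.Surjective X.hodge :=
  LinearMap.lTensor_surjective _ (Submodule.mkQ_surjective _)

theorem hodgeQuot_projective (X : Display p n S) (hp : IsNilpotent (p : S)) :
    Module.Finite S X.HodgeQuot ∧ Module.Projective S X.HodgeQuot := by
  obtain ⟨D⟩ := X.exists_normalDec hp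
  refine projective_quotient_of_retract D.e (fun x => ⟨D.s x, D.iota_s x⟩) ?_
  rintro _ ⟨y, rfl⟩
  exact one_tmul_eq_zero_of_mem (D.e_iota y)

end RelDisplay

end Fiber

variable {p : ℕ} [Fact p.Prime] {n : ℕ} [NeZero n] {S R : Type u} [CommRing S] [CommRing R]
  {f : S →+* R} {Xbar : Display p n R} {γ : DividedPowers (RingHom.ker f)} {Y : RelLift f γ Xbar}

theorem Lift.hodge_fiberMap {X : AbsLift f Xbar} (z : X.obj.Fiber) :
    X.red.hodgeQuotMap (X.obj.hodge z) = Xbar.hodge (X.red.fiberMap z) := by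
  obtain ⟨x, rfl⟩ := one_tmul_surjective p n S _ z
  rfl

theorem LiftHom.red_fiberMap {𝔞 𝔟 : Ideal S} {γ : DividedPowers 𝔞} {δ : DividedPowers 𝔟}
    {h : 𝔞 ≤ (⊥ : Ideal R).comap f} {h' : 𝔟 ≤ (⊥ : Ideal R).comap f} {hab : 𝔞 ≤ 𝔟}
    {X : Lift f 𝔞 γ h Xbar} {Y : Lift f 𝔟 δ h' Xbar} (α : LiftHom hab X Y) (z : X.obj.Fiber) :
    Y.red.fiberMap (α.hom.fiberMap z) = X.red.fiberMap z :=
  tensorMap_tensorMap (fun _ => rfl) α.red₀ z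

theorem smul_eq_zero_of_mem_ker {M N : Type u} [AddCommGroup M] [Module S M] [AddCommGroup N]
    [Module R N] (ρ : M →ₛₗ[f] N) {t : M} (ht : t ∈ (RingHom.ker f • ⊤ : Submodule S M)) :
    ρ t = 0 := by
  induction ht using Submodule.smul_induction_on' with
  | smul a ha x _ => rw [LinearMap.map_smulₛₗ, (RingHom.mem_ker).1 ha, zero_smul]
  | add x _ y _ hx hy => rw [map_add, hx, hy, add_zero]

/-! ### Lifts of the Hodge filtration as quotients of the fiber -/

namespace HodgeLift

variable {H H' : HodgeLift Y}

/-- Nakayama: modulo the nil ideal ker f it is the Hodge filtration over R, which is surjective. -/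
theorem π_surjective (hp : IsNilpotent (p : S)) (hf : Function.Surjective f) (H : HodgeLift Y) :
    Function.Surjective H.π := by
  have _ := H.finite
  have hY := Y.isBaseChange.isSurjBaseChange hp hf
  refine LinearMap.range_eq_top.1 (eq_top_of_nil (I := RingHom.ker f)
    (fun a ha => DividedPowers.isNilpotent γ hp ha) fun t => ?_)
  obtain ⟨z, hz⟩ := Xbar.hodge_surjective (H.ρ t)
  obtain ⟨z, rfl⟩ := tensorMap_surjective (h := CalW.map_algebraMap p n f) hf hY.surj₀ z
  refine ⟨H.π z, ⟨z, rfl⟩, (H.ρ_ker _).1 ?_⟩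
  rw [map_sub, H.comm, ← hz]
  exact sub_self _

theorem isIso_of_ker (hp : IsNilpotent (p : S)) (hf : Function.Surjective f)
    (h : ∀ z, H.π z = 0 ↔ H'.π z = 0) : H.IsIso H' := by
  obtain ⟨θ, hθ⟩ := exists_linearEquiv_of_ker (H.π_surjective hp hf) (H'.π_surjective hp hf) h
  refine ⟨θ, hθ, fun t => ?_⟩
  obtain ⟨z, rfl⟩ := H.π_surjective hp hf t
  rw [hθ, H.comm, H'.comm]

theorem IsIso.ker (h : H.IsIso H') (z) : H.π z = 0 ↔ H'.π z = 0 := by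
  obtain ⟨θ, hθ, -⟩ := h
  rw [← hθ, LinearEquiv.map_eq_zero_iff]

theorem mk_eq_mk_iff (hp : IsNilpotent (p : S)) (hf : Function.Surjective f) :
    Quot.mk (IsIso (Y := Y)) H = Quot.mk _ H' ↔ ∀ z, H.π z = 0 ↔ H'.π z = 0 := by
  refine ⟨fun h => ?_, fun h => Quot.sound (isIso_of_ker hp hf h)⟩
  -- Equality in `Quot` only gives the generated equivalence relation, so the kernel is recovered
  -- through a function on classes.
  let K : Class Y → Set Y.obj.Fiber := Quot.lift (fun H => {z | H.π z = 0})
    fun H H' h => Set.ext h.ker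
  exact fun z => Set.ext_iff.1 (congrArg K h) z

variable {X : AbsLift f Xbar}

/-- Both quotient maps are surjective, so the isomorphism exists as soon as the kernels agree;
compatibility with ρ is then forced by the commuting square. -/
theorem isHodgeOf_iff (hp : IsNilpotent (p : S)) (hf : Function.Surjective f)
    (α : LiftHom bot_le X Y) : H.IsHodgeOf α ↔
      ∀ x, H.π ((1 : S) ⊗ₜ α.hom.f₀ x) = 0 ↔ x ∈ LinearMap.range X.obj.iota := by
  have h0 : Function.Surjective α.hom.fiberMap := (α.fiberMap_bijective hp hf γ).2
  let g : X.obj.Fiber →ₗ[S] H.T :=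
    { toFun := fun z => H.π (α.hom.fiberMap z)
      map_add' := fun z w => by rw [map_add, map_add]
      map_smul' := fun a z => by rw [LinearMap.map_smulₛₗ, map_smul] }
  have hg : Function.Surjective g := (H.π_surjective hp hf).comp h0
  have hg' (x : X.obj.P) : g ((1 : S) ⊗ₜ x) = H.π ((1 : S) ⊗ₜ α.hom.f₀ x) := by
    change H.π (tensorMap _ _ _ _) = _
    rw [tensorMap_tmul, map_one]
  constructor
  · rintro ⟨θ, hθ, -⟩ x
    rw [← X.obj.hodge_one_tmul_eq_zero, ← hg', ← LinearEquiv.map_eq_zero_iff θ, hθ]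
    rfl
  · intro h
    obtain ⟨θ, hθ⟩ := exists_linearEquiv_of_ker X.obj.hodge_surjective hg fun z => by
      obtain ⟨x, rfl⟩ := one_tmul_surjective p n S _ z
      rw [hg', h, X.obj.hodge_one_tmul_eq_zero]
    refine ⟨θ, hθ, fun t => ?_⟩
    obtain ⟨z, rfl⟩ := X.obj.hodge_surjective t
    rw [hθ, Lift.hodge_fiberMap, ← α.red_fiberMap]
    exact H.comm _

theorem IsHodgeOf.ker_iff {α : LiftHom bot_le X Y} (h : H.IsHodgeOf α) (z) : H.π (α.hom.fiberMap z) = 0 ↔ X.obj.hodge z = 0 := by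
  obtain ⟨θ, hθ, -⟩ := h
  rw [← hθ, LinearEquiv.map_eq_zero_iff]

theorem IsHodgeOf.congr (hp : IsNilpotent (p : S)) (hf : Function.Surjective f)
    {α : LiftHom bot_le X Y} (h : H.IsHodgeOf α) :
    Quot.mk (IsIso (Y := Y)) H = Quot.mk _ H' ↔ H'.IsHodgeOf α := by
  rw [mk_eq_mk_iff hp hf]
  constructor
  · intro h'
    rw [isHodgeOf_iff hp hf] at h ⊢
    exact fun x => (h' _).symm.trans (h x)
  · intro h' z
    obtain ⟨z, rfl⟩ := (α.fiberMap_bijective hp hf γ).2 z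
    rw [h.ker_iff, h'.ker_iff]

/-- The Hodge filtration of a lift, transported to the crystal. -/
theorem exists_isHodgeOf (hp : IsNilpotent (p : S)) (hf : Function.Surjective f)
    (α : LiftHom bot_le X Y) : ∃ H : HodgeLift Y, H.IsHodgeOf α := by
  have hX := X.isBaseChange.isSurjBaseChange hp hf
  have hY := Y.isBaseChange.isSurjBaseChange hp hf
  let ε := Equiv.ofBijective _ (α.fiberMap_bijective hp hf γ)
  have hε (z) : α.hom.fiberMap (ε.symm z) = z := ε.apply_symm_apply z
  have hε' (z) : ε.symm (α.hom.fiberMap z) = z := ε.symm_apply_apply z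
  let g : Y.obj.Fiber →ₗ[S] X.obj.HodgeQuot :=
    { toFun := fun z => X.obj.hodge (ε.symm z)
      map_add' := fun z w => by
        rw [← map_add]
        congr 1
        rw [ε.symm_apply_eq]
        change _ = α.hom.fiberMap _
        rw [map_add, hε, hε]
      map_smul' := fun a z => by
        rw [RingHom.id_apply, ← map_smul]
        congr 1
        rw [ε.symm_apply_eq]
        change _ = α.hom.fiberMap _
        rw [LinearMap.map_smulₛₗ, hε, RingHom.id_apply] }
  have hg (z) : g (α.hom.fiberMap z) = X.obj.hodge z := congrArg X.obj.hodge (hε' z)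
  let H : HodgeLift Y :=
    { T := X.obj.HodgeQuot
      finite := (X.obj.hodgeQuot_projective hp).1
      projective := (X.obj.hodgeQuot_projective hp).2
      π := g
      ρ := X.red.hodgeQuotMap
      comm := fun z => by
        obtain ⟨z, rfl⟩ := (α.fiberMap_bijective hp hf γ).2 z
        rw [hg, Lift.hodge_fiberMap, α.red_fiberMap]
      ρ_surjective := tensorMap_surjective hf fun y => by
        obtain ⟨y, rfl⟩ := Submodule.mkQ_surjective _ y
        obtain ⟨x, rfl⟩ := hX.surj₀ y
        exact ⟨Submodule.mkQ _ x, rfl⟩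
      ρ_ker := fun t => by
        refine ⟨fun h => ?_, smul_eq_zero_of_mem_ker _⟩
        refine mem_smul_of_tensorMap_eq_zero (CalW.map_surjective hf) hf (fun y => ?_)
          (fun x hx => ?_) h
        · obtain ⟨y, rfl⟩ := Submodule.mkQ_surjective _ y
          obtain ⟨x, rfl⟩ := hX.surj₀ y
          exact ⟨Submodule.mkQ _ x, rfl⟩
        · obtain ⟨x, rfl⟩ := Submodule.mkQ_surjective _ x
          obtain ⟨y, hy⟩ := (Submodule.Quotient.mk_eq_zero _).1 hx
          obtain ⟨y, rfl⟩ := hX.surj₁ y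
          have h1 := hX.ker₀ (x - X.obj.iota y) (by rw [map_sub, X.red.map_iota, hy, sub_self])
          have h2 := Submodule.mem_map_of_mem (f := (LinearMap.range X.obj.iota).mkQ) h1
          rw [Submodule.map_smul''] at h2
          have h3 : (LinearMap.range X.obj.iota).mkQ (x - X.obj.iota y) =
              (LinearMap.range X.obj.iota).mkQ x := by
            rw [map_sub, sub_eq_self]
            exact (Submodule.Quotient.mk_eq_zero _).2 ⟨y, rfl⟩
          rw [h3] at h2
          exact Submodule.smul_mono le_rfl le_top h2 }
  exact ⟨H, LinearEquiv.refl _ _, fun z => (hg z).symm, fun _ => rfl⟩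

end HodgeLift

end Disp
end

noncomputable section

namespace Disp

variable {p : ℕ} [Fact p.Prime] {n : ℕ} [NeZero n] {S R : Type u} [CommRing S] [CommRing R]
  {f : S →+* R} {Xbar : Display p n R} {γ : DividedPowers (RingHom.ker f)} {Y : RelLift f γ Xbar}

/-! ### Injectivity: the Hodge filtration determines the lift -/

namespace HodgeLift

variable {H : HodgeLift Y} {X X' : AbsLift f Xbar} {α : LiftHom bot_le X Y}
  {α' : LiftHom bot_le X' Y}

/-- Equal Hodge filtrations give ι(Q_X) and ι(Q_{X'}) the same image in P_Y, so the element is hit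
up to ker ι_Y. That kernel lies in ε(I_{n+1}(S) ⊗ P_Y), which every absolute lift reaches through
its own ε. -/
theorem IsHodgeOf.exists_f₁_eq (hp : IsNilpotent (p : S)) (hf : Function.Surjective f)
    (hα : H.IsHodgeOf α) (hα' : H.IsHodgeOf α') (y : X.obj.Q) :
    ∃ y', α'.hom.f₁ y' = α.hom.f₁ y := by
  rw [isHodgeOf_iff hp hf] at hα hα'
  have hs := (α'.bijective hp hf γ).2
  obtain ⟨x', hx'⟩ := hs (α.hom.f₀ (X.obj.iota y))
  obtain ⟨y₀, rfl⟩ := (hα' x').1 (by rw [hx']; exact (hα _).2 ⟨y, rfl⟩)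
  rw [α'.hom.map_iota, α.hom.map_iota] at hx'
  have key : ∀ d ∈ Submodule.span (CalW p n S) {y | ∃ (j : J p n (RingHom.ker f)) (x : Y.obj.P),
      W.zeroth p (n + 1) S j = 0 ∧ y = Y.obj.eps j x}, ∃ y', α'.hom.f₁ y' = d := by
    intro d hd
    induction hd using Submodule.span_induction with
    | mem d hd =>
      obtain ⟨j, x, hj, rfl⟩ := hd
      obtain ⟨x, rfl⟩ := hs x
      refine ⟨X'.obj.eps ⟨j, (mem_J _ _ _ _).2 hj⟩ x, (α'.hom.map_eps _ _).trans ?_⟩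
      congr 2
      exact Subtype.ext (W.map_id' _)
    | zero => exact ⟨0, map_zero _⟩
    | add x y _ _ hx hy =>
      obtain ⟨x, rfl⟩ := hx
      obtain ⟨y, rfl⟩ := hy
      exact ⟨x + y, map_add _ _ _⟩
    | smul a y _ hy =>
      obtain ⟨y, rfl⟩ := hy
      exact ⟨a • y, by rw [LinearMap.map_smulₛₗ, CalW.map_id']⟩
  obtain ⟨y', hy'⟩ := key _ (RelDisplay.mem_span_of_iota_eq_zero hp
    (y := α.hom.f₁ y - α'.hom.f₁ y₀) (by rw [map_sub, hx', sub_self]))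
  exact ⟨y₀ + y', by rw [map_add, hy', add_sub_cancel]⟩

/-- Lifts with the same Hodge filtration are isomorphic. -/
theorem IsHodgeOf.isIso (hp : IsNilpotent (p : S)) (hf : Function.Surjective f)
    (hα : H.IsHodgeOf α) (hα' : H.IsHodgeOf α') : AbsLift.IsIso X X' := by
  have hp' : IsNilpotent (p : R) := by simpa using hp.map f
  have hb := α.bijective hp hf γ
  have hb' := α'.bijective hp hf γ
  let ε := LinearEquiv.ofBijective (ofMapId α'.hom.f₀) hb'
  -- On P the isomorphism can only be α'⁻¹ ∘ α; all compatibilities are checked after applying the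
  -- injective α'.
  let g : X.obj.P →ₗ[CalW p n S] X'.obj.P := ε.symm.toLinearMap.comp (ofMapId α.hom.f₀)
  have hg (x) : α'.hom.f₀ (g x) = α.hom.f₀ x := ε.apply_symm_apply _
  have hgb : Function.Bijective g := ε.symm.bijective.comp hb
  have htw (z) : RelDisplay.twMap α'.hom.f₀ (RelDisplay.twMap (toMapId g) z) =
      RelDisplay.twMap α.hom.f₀ z :=
    tensorMap_tensorMap (f := toMapId g) (fun b => W.map_id' _) hg z
  have hinj : Function.Injective (RelDisplay.twMap α'.hom.f₀) :=
    (tensorMap_bijective W.map_id' CalW.map_id' hb').1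
  have hgtw : Function.Injective (RelDisplay.twMap (X := X.obj) (Y := X'.obj) (toMapId g)) :=
    (tensorMap_bijective W.map_id' CalW.map_id' hgb).1
  have h1 (y y') (h : α'.hom.f₁ y' = α.hom.f₁ y) : X'.obj.iota y' = g (X.obj.iota y) ∧
      X'.obj.Fdot y' = RelDisplay.twMap (toMapId g) (X.obj.Fdot y) := by
    refine ⟨hb'.1 ?_, hinj ?_⟩
    · rw [hg, α.hom.map_iota, α'.hom.map_iota, h]
    · rw [htw, α.hom.map_Fdot, α'.hom.map_Fdot, h]
  let k : RelDisplay.Hom (RingHom.id S) le_rfl X.obj X'.obj :=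
    RelDisplay.Hom.ofP hp DPCompat.id (toMapId g) (fun y => by
      obtain ⟨y', hy'⟩ := hα.exists_f₁_eq hp hf hα' y
      exact ⟨y', h1 y y' hy'⟩) fun x => hinj (by
        rw [htw, α.hom.map_F, α'.hom.map_F]
        exact congrArg _ (hg x).symm)
  have hred (x) : X'.red.f₀ (k.f₀ x) = X.red.f₀ x := by
    rw [← α'.red₀, ← α.red₀]
    exact congrArg _ (hg x)
  refine ⟨⟨k, hred, Lift.red₁_of_red₀ hp' k hred⟩, hgb, fun y z h => ?_, fun y' => ?_⟩
  · refine RelDisplay.Q_ext hp (hgb.1 ?_) (hgtw ?_)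
    · exact (k.map_iota y).trans ((congrArg _ h).trans (k.map_iota z).symm)
    · exact (k.map_Fdot y).trans ((congrArg _ h).trans (k.map_Fdot z).symm)
  · obtain ⟨y, hy⟩ := hα'.exists_f₁_eq hp hf hα y'
    exact ⟨y, RelDisplay.Hom.f₁_eq hp k (h1 y y' hy.symm).1 (h1 y y' hy.symm).2⟩

end HodgeLift

end Disp
end

noncomputable section

namespace Disp

variable {p : ℕ} [Fact p.Prime] {n : ℕ} [NeZero n] {S R : Type u} [CommRing S] [CommRing R]
  {f : S →+* R} {Xbar : Display p n R} {γ : DividedPowers (RingHom.ker f)} {Y : RelLift f γ Xbar}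

/-! ### Surjectivity: displays from lifts of the Hodge filtration -/

namespace HodgeLift

variable {H : HodgeLift Y}

/-- An idempotent of `P` which splits the Hodge filtration `H`. -/
theorem exists_idempotent_splitting (hp : IsNilpotent (p : S)) (hf : Function.Surjective f)
    (H : HodgeLift Y) : ∃ e : Y.obj.P →ₗ[CalW p n S] Y.obj.P, (∀ x, e (e x) = e x) ∧
      (∀ x, H.π ((1 : S) ⊗ₜ e x) = H.π ((1 : S) ⊗ₜ x)) ∧
      (∀ x, H.π ((1 : S) ⊗ₜ x) = 0 → (1 : S) ⊗ₜ[CalW p n S] e x = 0) ∧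
      ∀ x, H.π ((1 : S) ⊗ₜ x) ∈ (RingHom.ker f • ⊤ : Submodule S H.T) →
        (1 : S) ⊗ₜ[CalW p n S] e x ∈ (RingHom.ker f • ⊤ : Submodule S Y.obj.Fiber) := by
  have _ := H.projective
  obtain ⟨σ, hσ⟩ := Module.projective_lifting_property H.π LinearMap.id (H.π_surjective hp hf)
  have hσ (t) : H.π (σ t) = t := congrArg (fun g : H.T →ₗ[S] H.T => g t) hσ
  obtain ⟨e₀, he₀⟩ := exists_semilinear_of_rel (RingHom.id (CalW p n S)) (P := Y.obj.P)
    (M := Y.obj.P) (fun x y => (1 : S) ⊗ₜ[CalW p n S] y = σ (H.π ((1 : S) ⊗ₜ x)))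
    (by rw [TensorProduct.tmul_zero, map_zero, map_zero])
    (fun x y m m' h h' => by
      rw [TensorProduct.tmul_add, TensorProduct.tmul_add, map_add, map_add, h, h'])
    (fun a x m h => by
      rw [RingHom.id_apply, TensorProduct.tmul_smul, TensorProduct.tmul_smul,
        ← algebraMap_smul S a, ← algebraMap_smul S a, map_smul, map_smul, h])
    (fun x => one_tmul_surjective p n S _ _)
  -- The projector of S ⊗ P given by the splitting is lifted to P along the kernel of 𝒲_n(S) → S,
  -- which is nil.
  obtain ⟨e, he, hee⟩ := exists_idempotent_end
    (I := RingHom.ker (algebraMap (CalW p n S) S))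
    (fun a ha => isNilpotent_CalW hp (by rw [(RingHom.mem_ker).1 ha]; exact IsNilpotent.zero))
    e₀ fun x => by
      rw [← one_tmul_eq_zero_iff CalW.algebraMap_surjective, TensorProduct.tmul_sub, he₀, he₀, hσ,
        sub_self]
  have hπ (x) : (1 : S) ⊗ₜ[CalW p n S] e x = σ (H.π ((1 : S) ⊗ₜ x)) := by
    rw [← he₀, ← sub_eq_zero, ← TensorProduct.tmul_sub,
      one_tmul_eq_zero_iff CalW.algebraMap_surjective]
    exact hee x
  refine ⟨e, he, fun x => by rw [hπ, hσ], fun x hx => by rw [hπ, hx, map_zero], fun x hx => ?_⟩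
  rw [hπ]
  have h1 := Submodule.mem_map_of_mem (f := σ) hx
  rw [Submodule.map_smul''] at h1
  exact Submodule.smul_mono le_rfl le_top h1

theorem π_iota_mem (y : Y.obj.Q) :
    H.π ((1 : S) ⊗ₜ Y.obj.iota y) ∈ (RingHom.ker f • ⊤ : Submodule S H.T) := by
  rw [← H.ρ_ker, H.comm]
  have h1 : Y.red.fiberMap ((1 : S) ⊗ₜ Y.obj.iota y) = (1 : R) ⊗ₜ Xbar.iota (Y.red.f₁ y) := by
    change tensorMap _ _ _ _ = _
    rw [tensorMap_tmul, map_one, Y.red.map_iota]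
  rw [h1, Xbar.hodge_one_tmul_eq_zero]
  exact ⟨_, rfl⟩

theorem mem_range_iota_of_π (hp : IsNilpotent (p : S)) (hf : Function.Surjective f) {x : Y.obj.P}
    (hx : H.π ((1 : S) ⊗ₜ x) = 0) : x ∈ LinearMap.range Y.obj.iota := by
  have hY := Y.isBaseChange.isSurjBaseChange hp hf
  have h1 : Y.red.fiberMap ((1 : S) ⊗ₜ x) = (1 : R) ⊗ₜ Y.red.f₀ x := by
    change tensorMap _ _ _ _ = _
    rw [tensorMap_tmul, map_one]
  have h2 := H.comm ((1 : S) ⊗ₜ x)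
  rw [hx, map_zero, h1, eq_comm, Xbar.hodge_one_tmul_eq_zero] at h2
  obtain ⟨y, hy⟩ := h2
  obtain ⟨y, rfl⟩ := hY.surj₁ y
  have h3 := hY.ker₀ (x - Y.obj.iota y) (by rw [map_sub, Y.red.map_iota, hy, sub_self])
  have h4 : x - Y.obj.iota y ∈ LinearMap.range Y.obj.iota := by
    refine RelDisplay.smul_mem_range_iota (Submodule.smul_mono (fun a ha => ?_) le_rfl h3)
    rw [mem_map_J, RingHom.mem_ker, CalW.map_algebraMap, (RingHom.mem_ker).1 ha, map_zero]
  rw [← sub_add_cancel x (Y.obj.iota y)]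
  exact Submodule.add_mem _ h4 ⟨y, rfl⟩

/-- Every lift of the Hodge filtration comes from a lift of the truncated display. -/
theorem exists_lift (hp : IsNilpotent (p : S)) (hf : Function.Surjective f) (H : HodgeLift Y) :
    ∃ (X : AbsLift f Xbar) (α : LiftHom bot_le X Y), H.IsHodgeOf α := by
  have hp' : IsNilpotent (p : R) := by simpa using hp.map f
  have hY := Y.isBaseChange.isSurjBaseChange hp hf
  obtain ⟨e, he, h1, h2, h3⟩ := H.exists_idempotent_splitting hp hf
  have h4 (x) : H.π ((1 : S) ⊗ₜ (x - e x)) = 0 := by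
    rw [TensorProduct.tmul_sub, map_sub, h1, sub_self]
  obtain ⟨s₀, hs₀⟩ := exists_semilinear_of_rel (RingHom.id (CalW p n S)) (P := Y.obj.P)
    (M := Y.obj.Q) (fun x y => Y.obj.iota y = x - e x)
    (by rw [map_zero, map_zero, sub_zero])
    (fun x y m m' h h' => by rw [map_add, map_add, h, h']; abel)
    (fun a x m h => by rw [RingHom.id_apply, map_smul, map_smul, h, smul_sub])
    (fun x => mem_range_iota_of_π hp hf (h4 x))
  let s : Y.obj.P →ₗ[CalW p n S] Y.obj.Q := s₀.comp (LinearMap.id - e)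
  have hs (x) : Y.obj.iota (s x) = x - e x := by
    change Y.obj.iota (s₀ (x - e x)) = _
    rw [hs₀, map_sub, he, sub_self, sub_zero]
  have hse (x) : s (e x) = 0 := by
    change s₀ (e x - e (e x)) = _
    rw [he, sub_self, map_zero]
  let Ψ : Y.obj.P →ₛₗ[CalW.frob p n S] (W p n S ⊗[CalW p n S] Y.obj.P) :=
    Y.obj.Fdot.comp s + Y.obj.F.comp e
  have hΨ (x) : Ψ x = Y.obj.Fdot (s x) + Y.obj.F (e x) := rfl
  have hΨe (x) : Ψ (e x) = Y.obj.F (e x) := by rw [hΨ, hse, map_zero, zero_add, he]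
  have hΨs (x) : Ψ (x - e x) = Y.obj.Fdot (s x) := by
    rw [hΨ, map_sub, hse, sub_zero, map_sub, he, sub_self, map_zero, add_zero]
  -- Modulo ker f the filtration H is the one of Y, so e(ι(y)) lies in κ(𝒥)P and the injectivity
  -- axiom of Y applies. Thus e is adapted to Y as well as to H.
  have hsub (y) : y - s (Y.obj.iota y) ∈
      Submodule.span (CalW p n S) {y | ∃ j x, y = Y.obj.eps j x} := by
    refine Y.obj.hodge_injective _ ?_
    rw [map_sub, hs, sub_sub_cancel]
    exact one_tmul_mem_smul (h3 _ (π_iota_mem y))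
  have hF (x) : Y.obj.F x ∈ Submodule.span (W p n S) (Set.range Ψ) := by
    have h5 : Y.obj.F x = Ψ (e x) + (p : W p n S) • Ψ (x - e x) := by
      rw [hΨe, hΨs, ← RelDisplay.F_iota, hs, ← map_add, add_sub_cancel]
    rw [h5]
    exact Submodule.add_mem _ (Submodule.subset_span ⟨_, rfl⟩)
      (Submodule.smul_mem _ _ (Submodule.subset_span ⟨_, rfl⟩))
  have hspan : Submodule.span (W p n S) (Set.range Ψ) = ⊤ := by
    rw [eq_top_iff, ← Y.obj.span_Fdot, Submodule.span_le]
    rintro _ ⟨y, rfl⟩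
    have key : ∀ z ∈ Submodule.span (CalW p n S) {y | ∃ j x, y = Y.obj.eps j x},
        Y.obj.Fdot z ∈ Submodule.span (W p n S) (Set.range Ψ) := by
      intro z hz
      induction hz using Submodule.span_induction with
      | mem z hz =>
        obtain ⟨j, x, rfl⟩ := hz
        rw [Y.obj.Fdot_eps]
        exact Submodule.smul_mem _ _ (hF x)
      | zero => rw [map_zero]; exact Submodule.zero_mem _
      | add x y _ _ hx hy => rw [map_add]; exact Submodule.add_mem _ hx hy
      | smul a y _ hy => rw [LinearMap.map_smulₛₗ]; exact Submodule.smul_mem _ _ hy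
    have h5 := Submodule.add_mem _ (key _ (hsub y))
      (Submodule.subset_span (R := W p n S) ⟨Y.obj.iota y - e (Y.obj.iota y), hΨs _⟩)
    rwa [← map_add, sub_add_cancel] at h5
  -- The same P, e and Ψ, now with the zero ideal: only 𝒥_{n+1} shrinks to I_{n+1}(S).
  let X₀ := RelDisplay.ofNormal (dividedPowersBot S) e Ψ he hspan
  let ι₀ : Y.obj.P →ₛₗ[CalW.map p n (RingHom.id S)] Y.obj.P := toMapId LinearMap.id
  have hid (z) : tensorMap (W.map p n (RingHom.id S)) (CalW.map_algebraMap_W p n _) ι₀ z = z :=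
    tensorMap_id W.map_id' (fun _ => rfl) z
  obtain ⟨k, hk⟩ := RelDisplay.exists_hom_ofNormal (γ := dividedPowersBot S)
    (h := (bot_le : (⊥ : Ideal S) ≤ (RingHom.ker f).comap (RingHom.id S))) (he := he)
    (hΨ := hspan) (Z := Y.obj) hp DPCompat.of_bot ι₀
    (fun x => ⟨s x, hs x, by rw [hid, hΨs]⟩) (fun x => by rw [hid, hΨe]; rfl)
  have hk (x : Y.obj.P) : k.f₀ x = x := congrArg (fun g => g x) hk
  have hk₁ (x : Y.obj.P) : k.f₁ (normalS (dividedPowersBot S) e Ψ x) = s x := by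
    refine RelDisplay.Hom.f₁_eq hp k ((hs x).trans (hk (x - e x)).symm) ((hΨs x).symm.trans ?_)
    exact (tensorMap_id W.map_id' hk _).symm
  let red : RelDisplay.Hom f bot_le X₀ Xbar := RelDisplay.Hom.comp bot_le (RingHom.comp_id f) Y.red k
  have hred (x : Y.obj.P) : red.f₀ x = Y.red.f₀ x := congrArg Y.red.f₀ (hk x)
  have h₀ : Function.Surjective red.f₀ := fun x => by
    obtain ⟨x, rfl⟩ := hY.surj₀ x
    exact ⟨x, hred x⟩
  have hbc : red.IsSurjBaseChange := by
    refine ⟨h₀, fun x hx => hY.ker₀ x ((hred x).symm.trans hx),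
      red.f₁_surjective hf h₀ fun z => ?_⟩
    obtain ⟨y, rfl⟩ := hY.surj₁ z
    refine ⟨normalS (dividedPowersBot S) e Ψ (Y.obj.iota y), ?_⟩
    have h5 : red.f₁ (normalS (dividedPowersBot S) e Ψ (Y.obj.iota y)) =
        Y.red.f₁ (s (Y.obj.iota y)) := congrArg Y.red.f₁ (hk₁ _)
    rw [h5, ← map_sub]
    have h6 := hsub y
    generalize y - s (Y.obj.iota y) = w at h6
    induction h6 using Submodule.span_induction with
    | mem z hz =>
      obtain ⟨j, x, rfl⟩ := hz
      rw [Y.red.map_eps]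
      exact Submodule.subset_span ⟨_, _, rfl⟩
    | zero => rw [map_zero]; exact Submodule.zero_mem _
    | add x y _ _ hx hy => rw [map_add]; exact Submodule.add_mem _ hx hy
    | smul a y _ hy => rw [LinearMap.map_smulₛₗ]; exact Submodule.smul_mem _ _ hy
  let X : AbsLift f Xbar := ⟨X₀, red, hbc.isBaseChange hf hp'⟩
  let α : LiftHom bot_le X Y := ⟨k, fun _ => rfl, fun _ => rfl⟩
  refine ⟨X, α, (isHodgeOf_iff hp hf α).2 fun (x : Y.obj.P) => ?_⟩
  have h5 : H.π ((1 : S) ⊗ₜ α.hom.f₀ x) = H.π ((1 : S) ⊗ₜ x) :=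
    congrArg (fun y => H.π ((1 : S) ⊗ₜ y)) (hk x)
  rw [h5]
  clear h5
  constructor
  · intro hx
    have h6 : (e x : Y.obj.P) ∈ LinearMap.range X₀.iota :=
      RelDisplay.smul_mem_range_iota (X := X₀) (mem_smul_of_one_tmul_eq_zero (h2 x hx))
    have h7 : (x - e x : Y.obj.P) ∈ LinearMap.range X₀.iota :=
      ⟨normalS (dividedPowersBot S) e Ψ x, rfl⟩
    have h8 : (x - e x + e x : Y.obj.P) ∈ LinearMap.range X₀.iota := Submodule.add_mem _ h7 h6
    exact (congrArg (· ∈ LinearMap.range X₀.iota) (sub_add_cancel x (e x))).mp h8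
  · rintro ⟨y, rfl⟩
    induction y using normalQ_induction with
    | h1 x => exact h4 x
    | h2 j x =>
      have h6 : (1 : S) ⊗ₜ[CalW p n S] (CalW.of p n S (j : W p (n + 1) S) • x) = 0 :=
        one_tmul_eq_zero_of_mem
          (Submodule.smul_mem_smul (Ideal.mem_map_of_mem _ j.2) Submodule.mem_top)
      exact (congrArg H.π h6).trans (map_zero _)
    | h3 => exact (congrArg H.π (TensorProduct.tmul_zero _ _)).trans (map_zero _)
    | h4 x y hx hy =>
      refine (congrArg H.π (TensorProduct.tmul_add (1 : S) (pairIota _ x) (pairIota _ y))).trans ?_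
      exact (map_add H.π _ _).trans ((congrArg₂ (· + ·) hx hy).trans (add_zero _))
    | h5 a y hy =>
      refine (congrArg H.π ((TensorProduct.tmul_smul a (1 : S) (pairIota _ y)).trans
        (algebraMap_smul S a _).symm)).trans ?_
      exact (map_smul H.π _ _).trans ((congrArg _ hy).trans (smul_zero _))

end HodgeLift

end Disp
end

noncomputable section

namespace Disp

/-! ### Invariance under isomorphism and the main theorem -/

variable {p : ℕ} [Fact p.Prime] {n : ℕ} [NeZero n] {S R : Type u} [CommRing S] [CommRing R]
  {f : S →+* R} {Xbar : Display p n R} {γ : DividedPowers (RingHom.ker f)} {Y : RelLift f γ Xbar}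

/-- Isomorphic lifts have the same Hodge filtration. -/
theorem HodgeLift.IsHodgeOf.comp_iso {H : HodgeLift Y} {X X' : AbsLift f Xbar}
    {α : LiftHom bot_le X' Y} (hp : IsNilpotent (p : S)) (hf : Function.Surjective f)
    (h : H.IsHodgeOf α) (β : LiftHom le_rfl X X') (hβ : Function.Bijective β.hom.f₀)
    (hβ' : Function.Bijective β.hom.f₁) : ∃ α' : LiftHom bot_le X Y, H.IsHodgeOf α' := by
  let α' : LiftHom bot_le X Y :=
    { hom := RelDisplay.Hom.comp bot_le (RingHom.comp_id _) α.hom β.hom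
      red₀ := fun x => (α.red₀ _).trans (β.red₀ x)
      red₁ := fun y => (α.red₁ _).trans (β.red₁ y) }
  refine ⟨α', (isHodgeOf_iff hp hf α').2 fun x => ?_⟩
  refine ((isHodgeOf_iff hp hf α).1 h (β.hom.f₀ x)).trans ⟨?_, ?_⟩
  · rintro ⟨y, hy⟩
    obtain ⟨y, rfl⟩ := hβ'.2 y
    exact ⟨y, hβ.1 ((β.hom.map_iota y).trans hy)⟩
  · rintro ⟨y, rfl⟩
    exact ⟨_, (β.hom.map_iota y).symm⟩

end Disp
end

theorem mainTheorem4 (p : ℕ) [Fact p.Prime] (n m e : ℕ) [NeZero n] (hn : m * (e + 1) + 1 < n)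
    {S R : Type u} [CommRing S] [CommRing R] (hp : IsNilpotent (p : S))
    (f : S →+* R) (hf : Function.Surjective f) (γ : DividedPowers (RingHom.ker f))
    (hm : ∀ x ∈ RingHom.ker f, (p : S) ^ m * x = 0)
    (Xbar : Disp.Display p n R) (hX : Disp.NilpotentOrderLE Xbar e) :
    Nonempty (Disp.RelLift f γ Xbar) ∧
    (∀ Y Y' : Disp.RelLift f γ Xbar, Disp.CanonicallyIsomorphicFibers le_rfl Y Y') ∧
    ∀ Y : Disp.RelLift f γ Xbar,
      (∀ X : Disp.AbsLift f Xbar, Disp.CanonicallyIsomorphicFibers bot_le X Y) ∧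
      ∃ Θ : Disp.AbsLiftClass f Xbar → Disp.HodgeLift.Class Y,
        Function.Bijective Θ ∧
        ∀ (X : Disp.AbsLift f Xbar) (α : Disp.LiftHom bot_le X Y) (H : Disp.HodgeLift Y),
          Θ (Quot.mk _ X) = Quot.mk _ H ↔ H.IsHodgeOf α := by
  have hn' : m * (e + 1) < n := by omega
  refine ⟨Disp.Lift.exists_relLift hp hf γ _ Xbar, fun Y Y' =>
    ⟨Disp.Lift.exists_liftHom hp hf Disp.DPCompat.id Y Y',
      fun α => α.fiberMap_bijective hp hf γ,
      fun α β => Disp.LiftHom.fiberMap_eq α β hp hf hn' hm hX⟩, fun Y => ?_⟩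
  have hex (X : Disp.AbsLift f Xbar) : Nonempty (Disp.LiftHom bot_le X Y) :=
    Disp.Lift.exists_liftHom hp hf Disp.DPCompat.of_bot X Y
  have huniq {X : Disp.AbsLift f Xbar} (α β : Disp.LiftHom bot_le X Y) :
      α.hom.fiberMap = β.hom.fiberMap := Disp.LiftHom.fiberMap_eq α β hp hf hn' hm hX
  refine ⟨fun X => ⟨hex X, fun α => α.fiberMap_bijective hp hf γ, huniq⟩, ?_⟩
  -- The transported filtration depends on α only through the fiber map, which is unique; the
  -- arbitrary choice of morphisms below is therefore harmless.
  have hHodge {X : Disp.AbsLift f Xbar} {α : Disp.LiftHom bot_le X Y} {H : Disp.HodgeLift Y}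
      (h : H.IsHodgeOf α) (β : Disp.LiftHom bot_le X Y) : H.IsHodgeOf β := by
    obtain ⟨θ, hθ, hθ'⟩ := h
    exact ⟨θ, fun z => by rw [hθ, huniq α β], hθ'⟩
  choose H hH using fun X : Disp.AbsLift f Xbar =>
    Disp.HodgeLift.exists_isHodgeOf hp hf (hex X).some
  have hiso (X X' : Disp.AbsLift f Xbar) (h : Disp.AbsLift.IsIso X X') :
      Quot.mk (Disp.HodgeLift.IsIso (Y := Y)) (H X) = Quot.mk _ (H X') := by
    obtain ⟨β, hβ, hβ'⟩ := h
    exact ((hH X).congr hp hf).2 (hHodge ((hH X').comp_iso hp hf β hβ hβ').choose_spec _)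
  have hΘ (X : Disp.AbsLift f Xbar) (α : Disp.LiftHom bot_le X Y) (H' : Disp.HodgeLift Y) :
      Quot.mk (Disp.HodgeLift.IsIso (Y := Y)) (H X) = Quot.mk _ H' ↔ H'.IsHodgeOf α :=
    (hHodge (hH X) α).congr hp hf
  refine ⟨Quot.lift (fun X => Quot.mk _ (H X)) hiso, ⟨?_, ?_⟩, hΘ⟩
  · rintro ⟨X⟩ ⟨X'⟩ h
    -- Equal classes make `H X'` the Hodge filtration of both X and X'.
    exact Quot.sound (((hΘ X (hex X).some (H X')).1 h).isIso hp hf (hH X'))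
  · rintro ⟨H'⟩
    obtain ⟨X, α, hα⟩ := H'.exists_lift hp hf
    exact ⟨Quot.mk _ X, (hΘ X α H').2 hα⟩
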